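/- **Model.** A unit-cost random access machine in the comparison model. It has finitely many integer and value registers and finitely many infinite integer and value arrays. Keys are natural numbers. On integers (keys, sizes, addresses) it can do addition, truncated subtraction, halving, comparison and array access. Values come from an arbitrary linearly ordered set; they can only be copied and compared. Control flow consists of tests, loops and (recursive) procedures. Each elementary operation costs one time unit. Memory is initially cleared (integers are $0$, value cells hold $B$). **Problem.** Let $N\ge 0$ and $M\ge 1$ be integers, and let $B$ be an upper bound on all values involved. A finite set $D$ of key/value pairs with distinct keys, initially empty, is to be maintained under the following operations. At most $N$ Insert operations are performed; after every operation, different keys in $D$ have different values. * **Insert**$(a,b)$: add the pair $\langle a,b\rangle$ with $b\le B$. If the key $a$ is already present, keep the smaller of its two values. * **BatchPrepend**$(\mathcal L)$: add all pairs of a list $\mathcal L$ of $L$ pairs, whose values are at most $B$ and are all smaller than every value currently in $D$. If there are several pairs with the same key, keep the one with the smallest value. * **Pull**: return, and remove from $D$, a set $S'$ of exactly $\min\{M,|D|\}$ keys, namely those with the smallest values in $D$, together with a bound $x$. If no pairs remain, then $x=B$. Otherwise $v<x\le w$ for every value $v$ of a key in $S'$ and every remaining value $w$. **Lemma 3.3.**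 There are fixed programs for Initialize$(M,B)$ and the three operations (not depending on $N$, $M$, $B$ or the ordered set of values), and an absolute constant $C$, such that initialization and every operation terminate and are carried out correctly in every such sequence of operations, with the following amortized running times: * Insert: $O(\max\{1,\log (N/M)\})$ (read as $O(1)$ if $N=0$); * BatchPrepend of $L$ pairs: $O(\max\{1,L\}\cdot\max\{1,\log (L/M)\})$ (read as $O(1)$ if $L=0$); * Pull: $O(\max\{1,|S'|\})$. That is, the total running time of the initialization and of any such sequence of operations is at most $C$ times the sum of $1$ and of these bounds (with logarithms to base $2$ and without the $O$) over all operations of the sequence. -/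

import Mathlib

universe u

namespace PartialHeap

/-! ### Machine model: a unit-cost random access machine in the comparison model

Programs are finite syntactic objects. They handle natural numbers (keys, sizes, addresses) and
values from a linear order `α`; values can only be copied and compared. There are integer and
value registers, and integer and value arrays, all indexed by `ℕ`; a program mentions only finitely
many registers and arrays. -/

/-- Integer expressions. `load a e` is the cell with index `e` of integer array number `a`,
`sub` is truncated subtraction and `half` is division by two, rounded down. -/
inductive NExp : Type
  | const (n : ℕ)
  | reg (i : ℕ)
  | load (a : ℕ) (e : NExp)
  | add (e f : NExp)
  | sub (e f : NExp)
  | half (e : NExp)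

/-- Value expressions: no operation on values besides copying. -/
inductive VExp : Type
  | reg (i : ℕ)
  | load (a : ℕ) (e : NExp)

/-- Tests. Values enter the control flow only through the comparison `valLe`. -/
inductive Test : Type
  | natLe (e f : NExp)
  | valLe (v w : VExp)
  | neg (b : Test)
  | conj (b c : Test)

/-- Programs. `storeNat a e f` writes `f` to cell `e` of integer array `a`. `call p ns vs` runs
procedure number `p`, see `Exec.call`. -/
inductive Cmd : Type
  | skip
  | setNat (i : ℕ) (e : NExp)
  | setVal (i : ℕ) (v : VExp)
  | storeNat (a : ℕ) (e f : NExp)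
  | storeVal (a : ℕ) (e : NExp) (v : VExp)
  | seq (c d : Cmd)
  | branch (b : Test) (c d : Cmd)
  | loop (b : Test) (c : Cmd)
  | call (p : ℕ) (ns vs : List ℕ)

/-- The memory: array number `a` has the cells `nat a 0, nat a 1, …`, likewise for values. -/
structure Memory (α : Type u) : Type u where
  nat : ℕ → ℕ → ℕ
  val : ℕ → ℕ → α

/-- Write `x` to the cell `i` of integer array `a`. -/
def Memory.setNat {α : Type u} (m : Memory α) (a i x : ℕ) : Memory α where
  nat := Function.update m.nat a (Function.update (m.nat a) i x)
  val := m.val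

/-- Write `x` to the cell `i` of value array `a`. -/
def Memory.setVal {α : Type u} (m : Memory α) (a i : ℕ) (x : α) : Memory α where
  nat := m.nat
  val := Function.update m.val a (Function.update (m.val a) i x)

/-- A machine state: registers and memory. -/
structure State (α : Type u) : Type u where
  nreg : ℕ → ℕ
  vreg : ℕ → α
  mem : Memory α

section Semantics

variable {α : Type u}

def NExp.eval (s : State α) : NExp → ℕ
  | .const n => n
  | .reg i => s.nreg i
  | .load a e => s.mem.nat a (e.eval s)
  | .add e f => e.eval s + f.eval s
  | .sub e f => e.eval s - f.eval s
  | .half e => e.eval s / 2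

/-- Every node of an expression costs one time unit. -/
def NExp.cost : NExp → ℕ
  | .const _ => 1
  | .reg _ => 1
  | .load _ e => e.cost + 1
  | .add e f => e.cost + f.cost + 1
  | .sub e f => e.cost + f.cost + 1
  | .half e => e.cost + 1

def VExp.eval (s : State α) : VExp → α
  | .reg i => s.vreg i
  | .load a e => s.mem.val a (e.eval s)

def VExp.cost : VExp → ℕ
  | .reg _ => 1
  | .load _ e => e.cost + 1

def Test.eval [LinearOrder α] (s : State α) : Test → Bool
  | .natLe e f => decide (e.eval s ≤ f.eval s)
  | .valLe v w => decide (v.eval s ≤ w.eval s)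
  | .neg b => !(b.eval s)
  | .conj b c => b.eval s && c.eval s

def Test.cost : Test → ℕ
  | .natLe e f => e.cost + f.cost + 1
  | .valLe v w => v.cost + w.cost + 1
  | .neg b => b.cost + 1
  | .conj b c => b.cost + c.cost + 1

/-- `Exec procs c s s' t`: with the procedure table `procs`, the program `c` started in the state
`s` terminates in the state `s'` after `t` time units. (For given `c` and `s` there is at most one
such pair `s'`, `t`, and there is none if `c` does not terminate.) -/
inductive Exec [LinearOrder α] (procs : List Cmd) : Cmd → State α → State α → ℕ → Prop
  | skip (s : State α) : Exec procs .skip s s 1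
  | setNat (i : ℕ) (e : NExp) (s : State α) :
      Exec procs (.setNat i e) s { s with nreg := Function.update s.nreg i (e.eval s) }
        (e.cost + 1)
  | setVal (i : ℕ) (v : VExp) (s : State α) :
      Exec procs (.setVal i v) s { s with vreg := Function.update s.vreg i (v.eval s) }
        (v.cost + 1)
  | storeNat (a : ℕ) (e f : NExp) (s : State α) :
      Exec procs (.storeNat a e f) s
        { s with mem := s.mem.setNat a (e.eval s) (f.eval s) }
        (e.cost + f.cost + 1)
  | storeVal (a : ℕ) (e : NExp) (v : VExp) (s : State α) :
      Exec procs (.storeVal a e v) s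
        { s with mem := s.mem.setVal a (e.eval s) (v.eval s) }
        (e.cost + v.cost + 1)
  | seq {c d : Cmd} {s s₁ s₂ : State α} {t₁ t₂ : ℕ} :
      Exec procs c s s₁ t₁ → Exec procs d s₁ s₂ t₂ → Exec procs (.seq c d) s s₂ (t₁ + t₂)
  | branchTrue {b : Test} {c d : Cmd} {s s₁ : State α} {t : ℕ} :
      b.eval s = true → Exec procs c s s₁ t → Exec procs (.branch b c d) s s₁ (b.cost + t)
  | branchFalse {b : Test} {c d : Cmd} {s s₁ : State α} {t : ℕ} :
      b.eval s = false → Exec procs d s s₁ t → Exec procs (.branch b c d) s s₁ (b.cost + t)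
  | loopTrue {b : Test} {c : Cmd} {s s₁ s₂ : State α} {t₁ t₂ : ℕ} :
      b.eval s = true → Exec procs c s s₁ t₁ → Exec procs (.loop b c) s₁ s₂ t₂ →
        Exec procs (.loop b c) s s₂ (b.cost + t₁ + t₂)
  | loopFalse {b : Test} {c : Cmd} {s : State α} :
      b.eval s = false → Exec procs (.loop b c) s s b.cost
  /-- A procedure works on a private copy of the registers (recursion is allowed). Its changes of
  the memory persist; of its registers, only the integer registers in `ns` and the value registers
  in `vs` are handed back, and the others are restored. -/
  | call {p : ℕ} {ns vs : List ℕ} {c : Cmd} {s s₁ : State α} {t : ℕ} :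
      procs[p]? = some c → Exec procs c s s₁ t →
        Exec procs (.call p ns vs) s
          { nreg := fun i => if i ∈ ns then s₁.nreg i else s.nreg i
            vreg := fun i => if i ∈ vs then s₁.vreg i else s.vreg i
            mem := s₁.mem }
          (t + 1)

end Semantics

/-! ### The data structure problem -/

/-- An implementation: one program for the initialization and one for each of the three
operations, with common procedures. -/
structure Implementation : Type where
  procs : List Cmd
  init : Cmd
  insert : Cmd
  batchPrepend : Cmd
  pull : Cmd

/-- A finite collection of key/value pairs with distinct keys, as a map from keys to values, where
`⊤` marks the keys that are not present. -/
abbrev Content (α : Type u) : Type u := ℕ → WithTop α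

/-- The three operations. Keys are natural numbers. -/
inductive Op (α : Type u) : Type u
  | insert (a : ℕ) (b : α)
  | batchPrepend (L : List (ℕ × α))
  | pull

section Interface

variable {α : Type u}

/-- The keys that are present. -/
def Content.keys (D : Content α) : Set ℕ := {k | D k ≠ ⊤}

/-- Different keys that are present have different values. -/
def Content.DistinctValues (D : Content α) : Prop :=
  ∀ k ∈ D.keys, ∀ l ∈ D.keys, D k = D l → k = l

/-- Add the pair `⟨a, b⟩`. If `a` is present already, the smaller of the two values is kept. -/
def Content.add [LinearOrder α] (D : Content α) (p : ℕ × α) : Content α :=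
  Function.update D p.1 (min (D p.1) (p.2 : WithTop α))

/-- Remove the keys in `S`. -/
def Content.remove (D : Content α) (S : Finset ℕ) : Content α :=
  fun k => if k ∈ S then ⊤ else D k

/-- The memory before the initialization: all integers are `0` and all values are `B`. -/
def Memory.blank (B : α) : Memory α where
  nat := fun _ _ => 0
  val := fun _ _ => B

/-- Write the list `L` of pairs to the first `L.length` cells of the two arrays number `0`. -/
def Memory.write (m : Memory α) (L : List (ℕ × α)) : Memory α where
  nat := Function.update m.nat 0 (fun i => (L[i]?.map Prod.fst).getD (m.nat 0 i))
  val := Function.update m.val 0 (fun i => (L[i]?.map Prod.snd).getD (m.val 0 i))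

/-- The state with memory `m` where the integer register `0` holds `n`, the value register `0`
holds `b`, and all other registers are cleared. -/
def State.entry (B : α) (n : ℕ) (b : α) (m : Memory α) : State α where
  nreg := fun i => if i = 0 then n else 0
  vreg := fun i => if i = 0 then b else B
  mem := m

/-- The keys that a state presents as output: the integer register `0` holds their number and the
integer array `0` lists them. -/
def State.output (s : State α) : List ℕ := (List.range (s.nreg 0)).map (s.mem.nat 0)

/-- The program that performs an operation. -/
def Op.code (P : Implementation) : Op α → Cmd
  | .insert _ _ => P.insert
  | .batchPrepend _ => P.batchPrepend
  | .pull => P.pull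

/-- The state in which the program of an operation is started when the data structure occupies the
memory `m`: the pair to be inserted is in the registers number `0`; a batch is in the arrays number
`0` and its length is in the integer register `0`. -/
def Op.start (B : α) (m : Memory α) : Op α → State α
  | .insert a b => State.entry B a b m
  | .batchPrepend L => State.entry B L.length B (m.write L)
  | .pull => State.entry B 0 B m

/-- When an operation may be called on a data structure with content `D`: all values are at most
`B`, the values in a batch are smaller than all values that are present, and afterwards different
keys have different values. -/
def Op.Legal [LinearOrder α] (B : α) (D : Content α) : Op α → Prop
  | .insert a b => b ≤ B ∧ (D.add (a, b)).DistinctValues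
  | .batchPrepend L =>
      (∀ p ∈ L, p.2 ≤ B ∧ ∀ k ∈ D.keys, (p.2 : WithTop α) < D k) ∧
        (L.foldl Content.add D).DistinctValues
  | .pull => True

/-- The content after an operation whose program ended in the state `s`. -/
def Op.next [LinearOrder α] (D : Content α) (s : State α) : Op α → Content α
  | .insert a b => D.add (a, b)
  | .batchPrepend L => L.foldl Content.add D
  | .pull => D.remove s.output.toFinset

/-- The number of single insertions in an operation. -/
def Op.inserts : Op α → ℕ
  | .insert _ _ => 1
  | _ => 0

/-- The amortized time, up to a constant factor, of an operation whose program ended in the state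
`s`. A batch without pairs and a pull without results count as one unit. -/
noncomputable def Op.budget (N M : ℕ) (s : State α) : Op α → ℝ
  | .insert _ _ => max 1 (Real.logb 2 ((N : ℝ) / M))
  | .batchPrepend L => max 1 (L.length : ℝ) * max 1 (Real.logb 2 ((L.length : ℝ) / M))
  | .pull => max 1 (s.output.toFinset.card : ℝ)

/-- The list `S` and the bound `x` are a correct answer to a pull from the content `D`: `S` lists,
without repetition, `M` keys of `D` (all of them if there are fewer) with the smallest values, and
`x` separates them from the remaining ones. -/
structure PullCorrect [LinearOrder α] (M : ℕ) (B : α) (D : Content α) (S : List ℕ) (x : α) :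
    Prop where
  nodup : S.Nodup
  subset : ∀ k ∈ S, k ∈ D.keys
  card : S.length = min M D.keys.ncard
  smallest : ∀ k ∈ S, ∀ l ∈ D.keys, l ∉ S → D k ≤ D l
  bound_of_empty : (D.remove S.toFinset).keys = ∅ → x = B
  bound_of_nonempty : (D.remove S.toFinset).keys ≠ ∅ →
    (∀ k ∈ S, D k < x) ∧ ∀ l ∈ (D.remove S.toFinset).keys, (x : WithTop α) ≤ D l

/-- `History P N M B n D m t β`: after the initialization and some finite sequence of legal
operations, among them `n ≤ N` single insertions, the content is `D`, the memory is `m`, the total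
running time was `t`, and the budgets of all operations (and `1` for the initialization) add up to
`β`. -/
inductive History [LinearOrder α] (P : Implementation) (N M : ℕ) (B : α) :
    ℕ → Content α → Memory α → ℕ → ℝ → Prop
  | init {s : State α} {t : ℕ} :
      Exec P.procs P.init (State.entry B M B (Memory.blank B)) s t →
        History P N M B 0 (fun _ => ⊤) s.mem t 1
  | step {n : ℕ} {D : Content α} {m : Memory α} {t : ℕ} {β : ℝ}
      (op : Op α) {s : State α} {τ : ℕ} :
      History P N M B n D m t β → op.Legal B D → n + op.inserts ≤ N →
        Exec P.procs (op.code P) (op.start B m) s τ →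
          History P N M B (n + op.inserts) (op.next D s) s.mem (t + τ) (β + op.budget N M s)

end Interface

end PartialHeap

/-!
The data structure is a stack of blocks. Block `j` is a linked list of items together with an upper
bound `hi j` for its live items; the bounds decrease weakly from the bottom block `0` (with bound
`B`) to the top, and all live items of a block are larger than the bounds of the blocks above it.
An item is a key with a value. Each key points to its current item, which makes that item live; when
a key gets a smaller value or is removed, the old item stays in its block as garbage. All blocks but
the top one have at least `M` items (garbage included), so that there are `O(1 + F / M)` blocks when
`F` items have been created. The invariant of the memory is `Rep`.

* Insert finds the block of the new item by binary search in the array of bounds.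
* BatchPrepend adds the batch to the top block if that has fewer than `M` items, and to a new block
  otherwise. Blocks whose bounds do not exceed the largest value of the batch contain only garbage
  and are dropped before.
* Pull takes blocks from the top until more than `M` live items have been collected. A block with
  more than `2M` live items is instead halved at its median, which is found in linear time by the
  median-of-medians algorithm (`selectBody_spec`), and the halves are put back. At most `3M` items
  are collected in the end. Selection finds the item of rank `M`; the smaller ones are output, and
  the others, at most `2M`, become the new top block.

Running times are amortized with the potential `pot`. The potential of a block of size `s` is a
linear combination of `1`, `s` and `levelSum M s`, which is the sum of the levels
`level M i = max 0 ⌈log₂ (i / M)⌉` of `i = 1, …, s`. By `levelSum_half`, halving a block of size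
`s > 2M` releases `s - M ≥ s / 2` units, which pay for the selection. Adding an item to a block of
size `s` costs `level M (s + 1)` units.

This charges an Insert `level M F` units, where `F` may exceed `N` because of batches. But if `n`
items are inserted singly and `T` items come from batches, then `n * level M (n + T)` is at most
`n * (level M N + 1) + 2 * T` if `n ≤ N` (`mul_level_add_le`, essentially `log (1 + x) ≤ x`), so
that the batches pay for the excess.

Programs are verified with a total-correctness calculus `Runs` that also bounds the running time;
its rule for loops (`runs_loop`) takes an invariant with a potential.
-/

namespace PartialHeap

/-! ### Total correctness with running times -/

attribute [simp] NExp.eval VExp.eval NExp.cost VExp.cost Test.cost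

section Test

variable {α : Type u} [LinearOrder α] {s : State α}

@[simp] theorem Test.natLe_eval_true {e f : NExp} :
    (Test.natLe e f).eval s = true ↔ e.eval s ≤ f.eval s := decide_eq_true_iff

@[simp] theorem Test.natLe_eval_false {e f : NExp} :
    (Test.natLe e f).eval s = false ↔ f.eval s < e.eval s := decide_eq_false_iff_not.trans not_le

@[simp] theorem Test.valLe_eval_true {v w : VExp} :
    (Test.valLe v w).eval s = true ↔ v.eval s ≤ w.eval s := decide_eq_true_iff

@[simp] theorem Test.valLe_eval_false {v w : VExp} :
    (Test.valLe v w).eval s = false ↔ w.eval s < v.eval s := decide_eq_false_iff_not.trans not_le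

@[simp] theorem Test.neg_eval_true {b : Test} : b.neg.eval s = true ↔ b.eval s = false := by
  simp [Test.eval]

@[simp] theorem Test.neg_eval_false {b : Test} : b.neg.eval s = false ↔ b.eval s = true := by
  simp [Test.eval]

@[simp] theorem Test.conj_eval_true {b c : Test} :
    (b.conj c).eval s = true ↔ b.eval s = true ∧ c.eval s = true := by
  simp [Test.eval]

@[simp] theorem Test.conj_eval_false {b c : Test} :
    (b.conj c).eval s = false ↔ b.eval s = false ∨ c.eval s = false := by
  simp [Test.eval, -Bool.and_eq_false_imp, Bool.and_eq_false_iff]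

end Test

section Runs

variable {α : Type u} [LinearOrder α] {procs : List Cmd}

/-- Programs are deterministic. -/
theorem Exec.det {c : Cmd} {s s₁ s₂ : State α} {t₁ t₂ : ℕ} (h₁ : Exec procs c s s₁ t₁)
    (h₂ : Exec procs c s s₂ t₂) : s₁ = s₂ ∧ t₁ = t₂ := by
  induction h₁ generalizing s₂ t₂ with
  | skip | setNat | setVal | storeNat | storeVal => cases h₂; exact ⟨rfl, rfl⟩
  | seq _ _ ih₁ ih₂ =>
    cases h₂ with
    | seq a b =>
      obtain ⟨rfl, rfl⟩ := ih₁ a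
      obtain ⟨rfl, rfl⟩ := ih₂ b
      exact ⟨rfl, rfl⟩
  | branchTrue hb _ ih | branchFalse hb _ ih =>
    cases h₂ with
    | branchTrue hb' a | branchFalse hb' a =>
      first
        | (obtain ⟨rfl, rfl⟩ := ih a; exact ⟨rfl, rfl⟩)
        | simp [hb] at hb'
  | loopTrue hb _ _ ih₁ ih₂ =>
    cases h₂ with
    | loopTrue _ a b =>
      obtain ⟨rfl, rfl⟩ := ih₁ a
      obtain ⟨rfl, rfl⟩ := ih₂ b
      exact ⟨rfl, rfl⟩
    | loopFalse hb' => simp [hb] at hb'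
  | loopFalse hb =>
    cases h₂ with
    | loopTrue hb' => simp [hb] at hb'
    | loopFalse => exact ⟨rfl, rfl⟩
  | call hp _ ih =>
    cases h₂ with
    | call hp' a =>
      rw [hp] at hp'
      obtain rfl := Option.some.inj hp'
      obtain ⟨rfl, rfl⟩ := ih a
      exact ⟨rfl, rfl⟩

/-- The program `c`, started in the state `s`, terminates, and its final state and running time
satisfy `Q`. This is the weakest precondition of `c` for `Q`; the lemmas below compute it for each
program construct. -/
def Runs (procs : List Cmd) (c : Cmd) (s : State α) (Q : State α → ℕ → Prop) : Prop :=
  ∃ s' t, Exec procs c s s' t ∧ Q s' t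

theorem Runs.mono {c : Cmd} {s : State α} {Q Q' : State α → ℕ → Prop} (h : Runs procs c s Q)
    (hQ : ∀ s' t, Q s' t → Q' s' t) : Runs procs c s Q' :=
  let ⟨s', t, he, hq⟩ := h
  ⟨s', t, he, hQ _ _ hq⟩

variable {Q : State α → ℕ → Prop} {s : State α}

@[simp] theorem runs_skip : Runs procs .skip s Q ↔ Q s 1 :=
  ⟨fun ⟨_, _, h, hq⟩ => by cases h; exact hq, fun h => ⟨_, _, .skip s, h⟩⟩

@[simp] theorem runs_setNat {i : ℕ} {e : NExp} : Runs procs (.setNat i e) s Q ↔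
    Q { s with nreg := Function.update s.nreg i (e.eval s) } (e.cost + 1) :=
  ⟨fun ⟨_, _, h, hq⟩ => by cases h; exact hq, fun h => ⟨_, _, .setNat i e s, h⟩⟩

@[simp] theorem runs_setVal {i : ℕ} {v : VExp} : Runs procs (.setVal i v) s Q ↔
    Q { s with vreg := Function.update s.vreg i (v.eval s) } (v.cost + 1) :=
  ⟨fun ⟨_, _, h, hq⟩ => by cases h; exact hq, fun h => ⟨_, _, .setVal i v s, h⟩⟩

@[simp] theorem runs_storeNat {a : ℕ} {e f : NExp} : Runs procs (.storeNat a e f) s Q ↔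
    Q { s with mem := s.mem.setNat a (e.eval s) (f.eval s) } (e.cost + f.cost + 1) :=
  ⟨fun ⟨_, _, h, hq⟩ => by cases h; exact hq, fun h => ⟨_, _, .storeNat a e f s, h⟩⟩

@[simp] theorem runs_storeVal {a : ℕ} {e : NExp} {v : VExp} : Runs procs (.storeVal a e v) s Q ↔
    Q { s with mem := s.mem.setVal a (e.eval s) (v.eval s) } (e.cost + v.cost + 1) :=
  ⟨fun ⟨_, _, h, hq⟩ => by cases h; exact hq, fun h => ⟨_, _, .storeVal a e v s, h⟩⟩

@[simp] theorem runs_seq {c d : Cmd} : Runs procs (.seq c d) s Q ↔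
    Runs procs c s (fun s₁ t₁ => Runs procs d s₁ (fun s₂ t₂ => Q s₂ (t₁ + t₂))) := by
  constructor
  · rintro ⟨_, _, h, hq⟩
    cases h with
    | seq a b => exact ⟨_, _, a, _, _, b, hq⟩
  · rintro ⟨_, _, a, _, _, b, hq⟩
    exact ⟨_, _, .seq a b, hq⟩

@[simp] theorem runs_branch {b : Test} {c d : Cmd} : Runs procs (.branch b c d) s Q ↔
    (b.eval s = true → Runs procs c s (fun s' t => Q s' (b.cost + t))) ∧
      (b.eval s = false → Runs procs d s (fun s' t => Q s' (b.cost + t))) := by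
  constructor
  · rintro ⟨_, _, h, hq⟩
    cases h with
    | branchTrue hb a => exact ⟨fun _ => ⟨_, _, a, hq⟩, fun hb' => by simp [hb] at hb'⟩
    | branchFalse hb a => exact ⟨fun hb' => by simp [hb] at hb', fun _ => ⟨_, _, a, hq⟩⟩
  · rintro ⟨h₁, h₂⟩
    cases hb : b.eval s with
    | true =>
      obtain ⟨_, _, a, hq⟩ := h₁ hb
      exact ⟨_, _, .branchTrue hb a, hq⟩
    | false =>
      obtain ⟨_, _, a, hq⟩ := h₂ hb
      exact ⟨_, _, .branchFalse hb a, hq⟩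

/-- The loop rule. The invariant `I` carries a potential that pays for every round; as every round
costs at least one unit, the potential also bounds the number of rounds. -/
theorem runs_loop {b : Test} {c : Cmd} {p : ℕ} (I : State α → ℕ → Prop) (h₀ : I s p)
    (hstep : ∀ s p, I s p → b.eval s = true →
      Runs procs c s (fun s' t => ∃ p', I s' p' ∧ b.cost + t + p' ≤ p))
    (hQ : ∀ s' t p', I s' p' → b.eval s' = false → t + p' ≤ p + b.cost → Q s' t) :
    Runs procs (.loop b c) s Q := by
  have hpos : 0 < b.cost := by cases b <;> simp [Test.cost]
  suffices H : ∀ p s, I s p → Runs procs (.loop b c) s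
      (fun s' t => ∃ p', I s' p' ∧ b.eval s' = false ∧ t + p' ≤ p + b.cost) from
    (H p s h₀).mono fun s' t ⟨p', hI, hb, ht⟩ => hQ s' t p' hI hb ht
  intro p
  induction p using Nat.strong_induction_on with
  | _ p ih =>
    intro s hI
    cases hb : b.eval s with
    | false => exact ⟨_, _, .loopFalse hb, p, hI, hb, by omega⟩
    | true =>
      obtain ⟨s₁, t₁, he, p₁, hI₁, hp₁⟩ := hstep s p hI hb
      obtain ⟨s₂, t₂, he₂, p₂, hI₂, hb₂, hp₂⟩ := ih p₁ (by omega) s₁ hI₁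
      exact ⟨_, _, .loopTrue hb he he₂, p₂, hI₂, hb₂, by omega⟩

/-- A procedure call that hands back one integer register. -/
theorem runs_call_one {p i : ℕ} {c : Cmd} (hp : procs[p]? = some c)
    (h : Runs procs c s (fun s₁ t =>
      Q ⟨Function.update s.nreg i (s₁.nreg i), s.vreg, s₁.mem⟩ (t + 1))) :
    Runs procs (.call p [i] []) s Q := by
  obtain ⟨s₁, t, he, hq⟩ := h
  refine ⟨_, _, .call hp he, ?_⟩
  convert hq using 2
  · funext j
    by_cases hj : j = i
    · subst hj; simp
    · simp [hj]
  · simp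

/-- A procedure call that hands back no register. -/
theorem runs_call_none {p : ℕ} {c : Cmd} (hp : procs[p]? = some c)
    (h : Runs procs c s (fun s₁ t => Q ⟨s.nreg, s.vreg, s₁.mem⟩ (t + 1))) :
    Runs procs (.call p [] []) s Q := by
  obtain ⟨s₁, t, he, hq⟩ := h
  exact ⟨_, _, .call hp he, by simpa using hq⟩

/-- Sequential composition of a list of programs. -/
def Cmd.block : List Cmd → Cmd
  | [] => .skip
  | c :: cs => .seq c (Cmd.block cs)

@[simp] theorem runs_block_nil : Runs procs (.block []) s Q ↔ Q s 1 := runs_skip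

@[simp] theorem runs_block_cons {c : Cmd} {cs : List Cmd} : Runs procs (.block (c :: cs)) s Q ↔
    Runs procs c s (fun s₁ t₁ => Runs procs (.block cs) s₁ (fun s₂ t₂ => Q s₂ (t₁ + t₂))) :=
  runs_seq

end Runs

@[simp] theorem Memory.setNat_val {α : Type u} (m : Memory α) (a i x : ℕ) :
    (m.setNat a i x).val = m.val := rfl

@[simp] theorem Memory.setVal_nat {α : Type u} (m : Memory α) (a i : ℕ) (x : α) :
    (m.setVal a i x).nat = m.nat := rfl

@[simp] theorem Memory.setNat_nat {α : Type u} (m : Memory α) (a i x b : ℕ) :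
    (m.setNat a i x).nat b = if b = a then Function.update (m.nat a) i x else m.nat b := by
  by_cases h : b = a
  · subst h; simp [Memory.setNat]
  · simp [Memory.setNat, h]

@[simp] theorem Memory.setVal_val {α : Type u} (m : Memory α) (a i : ℕ) (x : α) (b : ℕ) :
    (m.setVal a i x).val b = if b = a then Function.update (m.val a) i x else m.val b := by
  by_cases h : b = a
  · subst h; simp [Memory.setVal]
  · simp [Memory.setVal, h]

/-! ### Array segments -/

/-- The cells `lo, …, lo + n - 1` of the array `W`. -/
def seg (W : ℕ → ℕ) (lo n : ℕ) : List ℕ := (List.range n).map (fun i => W (lo + i))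

@[simp] theorem length_seg (W : ℕ → ℕ) (lo n : ℕ) : (seg W lo n).length = n := by simp [seg]

@[simp] theorem seg_zero (W : ℕ → ℕ) (lo : ℕ) : seg W lo 0 = [] := rfl

theorem seg_succ (W : ℕ → ℕ) (lo n : ℕ) : seg W lo (n + 1) = seg W lo n ++ [W (lo + n)] := by
  simp [seg, List.range_succ]

theorem seg_congr {W W' : ℕ → ℕ} {lo n : ℕ} (h : ∀ i, lo ≤ i → i < lo + n → W' i = W i) :
    seg W' lo n = seg W lo n := by
  refine List.map_congr_left fun i hi => h _ (by omega) ?_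
  have := List.mem_range.1 hi
  omega

theorem seg_add (W : ℕ → ℕ) (lo a b : ℕ) :
    seg W lo (a + b) = seg W lo a ++ seg W (lo + a) b := by
  simp [seg, List.range_add, Function.comp_def, add_assoc]

theorem mem_seg {W : ℕ → ℕ} {lo n x : ℕ} : x ∈ seg W lo n ↔ ∃ i < n, W (lo + i) = x := by
  simp [seg]

/-! ### The programs -/

/-!
In the descriptions, `r0, r1, …` and `v0, v1, …` are the integer and value registers. An item is a
positive number, and `0` stands for no item. The integer arrays hold

* `0`: the keys of a batch, or the output,
* `1`: the number `M`, the number of blocks, and the number of items created so far,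
* `2`: the current item of each key,
* `3`, `4`: the key of each item, and the next item in its block,
* `5`, `6`: the first item and the size of each block,
* `7`: the work space;

the value arrays hold

* `0`: the values of a batch,
* `1`: the value of each item,
* `2`: the bound of each block.
-/

/-- The test whether the value of item `r6` is smaller than `v1`. -/
def lessTest : Test := .neg (.valLe (.reg 1) (.load 1 (.reg 6)))

/-- The test whether the value of item `r6` is larger than `v1`. -/
def greaterTest : Test := .neg (.valLe (.load 1 (.reg 6)) (.reg 1))

/-- Copy the items of the segment of length `r2` at `r1` of the work space that pass the test `b`
(about the item in `r6`) to the segment at `r7`, and count them in `r0`. -/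
def filterBody (b : Test) : Cmd := .block [
  .setNat 0 (.const 0),
  .setNat 4 (.const 0),
  .loop (.natLe (.add (.reg 4) (.const 1)) (.reg 2)) (.block [
    .setNat 6 (.load 7 (.add (.reg 1) (.reg 4))),
    .branch b (.block [
      .storeNat 7 (.add (.reg 7) (.reg 0)) (.reg 6),
      .setNat 0 (.add (.reg 0) (.const 1))]) .skip,
    .setNat 4 (.add (.reg 4) (.const 1))])]

/-- Find, in quadratic time, the item of rank `r3` in the segment of length `r2` at `r1`. The result
is in `r5`; the work space from `r7` on is scratch. -/
def bruteBody : Cmd := .block [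
  .setNat 4 (.const 0),
  .loop (.natLe (.add (.reg 4) (.const 1)) (.reg 2)) (.block [
    .setNat 6 (.load 7 (.add (.reg 1) (.reg 4))),
    .setVal 1 (.load 1 (.reg 6)),
    .call 2 [0] [],
    .branch (.conj (.natLe (.reg 0) (.reg 3)) (.natLe (.reg 3) (.reg 0)))
      (.setNat 5 (.reg 6)) .skip,
    .setNat 4 (.add (.reg 4) (.const 1))])]

/-- Write the medians of consecutive groups of five items of the segment of length `r11` at `r10`
right behind that segment, and count them in `r8`. -/
def mediansBody : Cmd := .block [
  .setNat 8 (.const 0),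
  .setNat 9 (.const 0),
  .setNat 2 (.const 5),
  .setNat 3 (.const 2),
  .loop (.natLe (.add (.reg 9) (.const 5)) (.reg 11)) (.block [
    .setNat 1 (.add (.reg 10) (.reg 9)),
    .setNat 7 (.add (.add (.reg 10) (.reg 11)) (.reg 8)),
    .call 1 [5] [],
    .storeNat 7 (.reg 7) (.reg 5),
    .setNat 8 (.add (.reg 8) (.const 1)),
    .setNat 9 (.add (.reg 9) (.const 5))])]

/-- Find, in linear time, the item of rank `r3` in the segment of length `r2` at `r1`. The result is
in `r5`; the work space behind the segment is scratch. -/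
def selectBody : Cmd := .block [
  .setNat 10 (.reg 1),
  .setNat 11 (.reg 2),
  .setNat 12 (.reg 3),
  .setNat 9 (.add (.reg 1) (.reg 2)),
  .setNat 7 (.reg 9),
  .branch (.natLe (.reg 2) (.const 100))
    (.call 1 [5] [])
    (.block [
      .call 4 [8] [],
      .setNat 1 (.reg 9),
      .setNat 2 (.reg 8),
      .setNat 3 (.half (.reg 8)),
      .call 0 [5] [],
      .setVal 1 (.load 1 (.reg 5)),
      .setNat 1 (.reg 10),
      .setNat 2 (.reg 11),
      .call 2 [0] [],
      .branch (.natLe (.add (.reg 12) (.const 1)) (.reg 0))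
        (.block [
          .setNat 1 (.reg 9),
          .setNat 2 (.reg 0),
          .setNat 3 (.reg 12),
          .call 0 [5] []])
        (.branch (.natLe (.reg 12) (.reg 0))
          .skip
          (.block [
            .setNat 3 (.sub (.reg 12) (.add (.reg 0) (.const 1))),
            .call 3 [0] [],
            .setNat 1 (.reg 9),
            .setNat 2 (.reg 0),
            .call 0 [5] []]))])]

/-- Put the item in register `x` in front of the list of the block in register `j`. -/
def linkCode (x j : ℕ) : Cmd := .block [
  .storeNat 4 (.reg x) (.load 5 (.reg j)),
  .storeNat 5 (.reg j) (.reg x),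
  .storeNat 6 (.reg j) (.add (.load 6 (.reg j)) (.const 1))]

/-- Unless the key `r1` is present with a value of at most `v1`, create a live item with key `r1`
and value `v1` and link it to the block `r2`. -/
def addBody : Cmd :=
  .branch (.conj (.natLe (.const 1) (.load 2 (.reg 1)))
      (.valLe (.load 1 (.load 2 (.reg 1))) (.reg 1)))
    .skip
    (.block [
      .setNat 3 (.add (.load 1 (.const 2)) (.const 1)),
      .storeNat 1 (.const 2) (.reg 3),
      .storeNat 3 (.reg 3) (.reg 1),
      .storeVal 1 (.reg 3) (.reg 1),
      .storeNat 2 (.reg 1) (.reg 3),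
      linkCode 3 2])

/-- Copy the live items of the linked list with the first item `r2` to the work space from `r1` on,
and count them in `r0`. -/
def collectBody : Cmd := .block [
  .setNat 0 (.const 0),
  .loop (.natLe (.const 1) (.reg 2)) (.block [
    .branch (.conj (.natLe (.load 2 (.load 3 (.reg 2))) (.reg 2))
        (.natLe (.reg 2) (.load 2 (.load 3 (.reg 2)))))
      (.block [
        .storeNat 7 (.add (.reg 1) (.reg 0)) (.reg 2),
        .setNat 0 (.add (.reg 0) (.const 1))]) .skip,
    .setNat 2 (.load 4 (.reg 2))])]

/-- Distribute the `r0` items in the work space from `r10` on to two new blocks `r11` and `r11 + 1`,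
the half with the smaller values to the latter. -/
def splitBody : Cmd := .block [
  .setNat 1 (.reg 10),
  .setNat 2 (.reg 0),
  .setNat 3 (.half (.sub (.reg 0) (.const 1))),
  .call 0 [5] [],
  .setVal 1 (.load 1 (.reg 5)),
  .setNat 12 (.add (.reg 11) (.const 1)),
  .storeNat 5 (.reg 11) (.const 0),
  .storeNat 6 (.reg 11) (.const 0),
  .storeNat 5 (.reg 12) (.const 0),
  .storeNat 6 (.reg 12) (.const 0),
  .storeVal 2 (.reg 12) (.reg 1),
  .setNat 4 (.const 0),
  .loop (.natLe (.add (.reg 4) (.const 1)) (.reg 0)) (.block [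
    .setNat 6 (.load 7 (.add (.reg 10) (.reg 4))),
    .branch (.valLe (.load 1 (.reg 6)) (.reg 1)) (linkCode 6 12) (linkCode 6 11),
    .setNat 4 (.add (.reg 4) (.const 1))])]

/-- Of the `r10` items in the work space, link those with a value of at least `v0` to the block
`r11`, but none if `r10` is at most `M`. Remove the other ones and list their keys as output. -/
def outputBody : Cmd := .block [
  .setNat 0 (.const 0),
  .setNat 4 (.const 0),
  .loop (.natLe (.add (.reg 4) (.const 1)) (.reg 10)) (.block [
    .setNat 6 (.load 7 (.reg 4)),
    .branch (.conj (.natLe (.add (.load 1 (.const 0)) (.const 1)) (.reg 10))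
        (.valLe (.reg 0) (.load 1 (.reg 6))))
      (linkCode 6 11)
      (.block [
        .storeNat 0 (.reg 0) (.load 3 (.reg 6)),
        .storeNat 2 (.load 3 (.reg 6)) (.const 0),
        .setNat 0 (.add (.reg 0) (.const 1))]),
    .setNat 4 (.add (.reg 4) (.const 1))])]

/-- The common procedures. -/
def procTable : List Cmd :=
  [selectBody, bruteBody, filterBody lessTest, filterBody greaterTest, mediansBody, addBody,
    collectBody, splitBody, outputBody]

/-- The stack consists of the empty block `0`, whose bound is `B` from the start. -/
def initCode : Cmd := .block [
  .storeNat 1 (.const 0) (.reg 0),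
  .storeNat 1 (.const 1) (.const 1)]

/-- Binary search for the last block whose bound is at least the new value. -/
def insertCode : Cmd := .block [
  .setVal 1 (.reg 0),
  .setNat 1 (.reg 0),
  .setNat 2 (.const 0),
  .setNat 3 (.load 1 (.const 1)),
  .loop (.natLe (.add (.reg 2) (.const 2)) (.reg 3)) (.block [
    .setNat 4 (.half (.add (.reg 2) (.reg 3))),
    .branch (.valLe (.reg 1) (.load 2 (.reg 4))) (.setNat 2 (.reg 4)) (.setNat 3 (.reg 4))]),
  .call 5 [] []]

/-- Raise `v1` to the largest value of the batch. -/
def maxLoop : Cmd :=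
  .loop (.natLe (.add (.reg 1) (.const 1)) (.reg 0)) (.block [
    .branch (.valLe (.load 0 (.reg 1)) (.reg 1)) .skip (.setVal 1 (.load 0 (.reg 1))),
    .setNat 1 (.add (.reg 1) (.const 1))])

/-- Discard the blocks with bounds of at most `v1` from the top block `r2` on. -/
def discardLoop : Cmd :=
  .loop (.conj (.natLe (.const 1) (.reg 2)) (.valLe (.load 2 (.reg 2)) (.reg 1)))
    (.setNat 2 (.sub (.reg 2) (.const 1)))

/-- Add the pairs of the batch one by one to the block `r2`. -/
def addLoop : Cmd :=
  .loop (.natLe (.add (.reg 4) (.const 1)) (.reg 0)) (.block [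
    .setNat 1 (.load 0 (.reg 4)),
    .setVal 1 (.load 0 (.reg 4)),
    .call 5 [] [],
    .setNat 4 (.add (.reg 4) (.const 1))])

/-- The batch goes to the top block if that has fewer than `M` items, and otherwise to a new one whose
bound is the largest value of the batch. Blocks with bounds that do not exceed this value have no
live items and are discarded before. -/
def batchCode : Cmd := .branch (.natLe (.const 1) (.reg 0)) (.block [
  .setVal 1 (.load 0 (.const 0)),
  .setNat 1 (.const 1),
  maxLoop,
  .setNat 2 (.sub (.load 1 (.const 1)) (.const 1)),
  discardLoop,
  .branch (.natLe (.load 1 (.const 0)) (.load 6 (.reg 2)))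
    (.block [
      .setNat 2 (.add (.reg 2) (.const 1)),
      .storeNat 5 (.reg 2) (.const 0),
      .storeNat 6 (.reg 2) (.const 0),
      .storeVal 2 (.reg 2) (.reg 1)]) .skip,
  .storeNat 1 (.const 1) (.add (.reg 2) (.const 1)),
  .setNat 4 (.const 0),
  addLoop]) .skip

/-- Collect the live items of the next block in the work space. A block with more than `2M` of them
is halved instead, and the halves are put back. -/
def gatherBody : Cmd := .block [
  .setNat 11 (.sub (.reg 11) (.const 1)),
  .setNat 1 (.reg 10),
  .setNat 2 (.load 5 (.reg 11)),
  .call 6 [0] [],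
  .branch (.natLe (.reg 0) (.add (.load 1 (.const 0)) (.load 1 (.const 0))))
    (.setNat 10 (.add (.reg 10) (.reg 0)))
    (.block [.call 7 [] [], .setNat 11 (.add (.reg 11) (.const 2))])]

/-- If more than `M` items have been collected, put the value of the item of rank `M` into `v0`. -/
def boundCode : Cmd :=
  .branch (.natLe (.reg 10) (.load 1 (.const 0)))
    (.setVal 0 (.reg 1))
    (.block [
      .setNat 1 (.const 0),
      .setNat 2 (.reg 10),
      .setNat 3 (.load 1 (.const 0)),
      .call 0 [5] [],
      .setVal 0 (.load 1 (.reg 5))])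

/-- Take blocks from the top of the stack until more than `M` items have been collected. The items
that are not returned form the new top block. -/
def pullCode : Cmd := .block [
  .setNat 10 (.const 0),
  .setNat 11 (.load 1 (.const 1)),
  .loop (.conj (.natLe (.reg 10) (.load 1 (.const 0))) (.natLe (.const 1) (.reg 11))) gatherBody,
  boundCode,
  .storeNat 5 (.reg 11) (.const 0),
  .storeNat 6 (.reg 11) (.const 0),
  .call 8 [0] [],
  .storeNat 1 (.const 1) (.add (.reg 11) (.const 1))]

/-- The data structure. -/
def impl : Implementation where
  procs := procTable
  init := initCode
  insert := insertCode
  batchPrepend := batchCode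
  pull := pullCode

/-! ### Linear time selection -/

/-- The memories `m` and `m'` differ at most in the work space, the integer array `7`, and there
only in the cells from `d` on. -/
def Memory.SameBut {α : Type u} (d : ℕ) (m m' : Memory α) : Prop :=
  m'.val = m.val ∧ (∀ a, a ≠ 7 → m'.nat a = m.nat a) ∧ ∀ i < d, m'.nat 7 i = m.nat 7 i

theorem Memory.SameBut.refl {α : Type u} (d : ℕ) (m : Memory α) : m.SameBut d m :=
  ⟨rfl, fun _ _ => rfl, fun _ _ => rfl⟩

theorem Memory.SameBut.trans {α : Type u} {d d' : ℕ} {m m' m'' : Memory α} (h : m.SameBut d m')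
    (h' : m'.SameBut d' m'') (hd : d ≤ d') : m.SameBut d m'' :=
  ⟨h'.1.trans h.1, fun a ha => (h'.2.1 a ha).trans (h.2.1 a ha),
    fun i hi => (h'.2.2 i (hi.trans_le hd)).trans (h.2.2 i hi)⟩

theorem Memory.SameBut.setNat {α : Type u} {d : ℕ} {m m' : Memory α} (h : m.SameBut d m')
    {i : ℕ} (hi : d ≤ i) (x : ℕ) : m.SameBut d (m'.setNat 7 i x) := by
  refine ⟨h.1, fun a ha => by simp [ha, h.2.1 a ha], fun j hj => ?_⟩
  simp [h.2.2 j hj, (hj.trans_le hi).ne]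

theorem Memory.SameBut.seg_eq {α : Type u} {d : ℕ} {m m' : Memory α} (h : m.SameBut d m')
    {lo n : ℕ} (hn : lo + n ≤ d) : seg (m'.nat 7) lo n = seg (m.nat 7) lo n :=
  seg_congr fun i _ hi => h.2.2 i (by omega)

/-- The number of items in `l` with a smaller value than `x`. -/
def rank {α : Type u} [LinearOrder α] (v : ℕ → α) (l : List ℕ) (x : ℕ) : ℕ :=
  (l.filter (fun y => decide (v y < v x))).length

section
variable {α : Type u} [LinearOrder α]

theorem filterBody_spec {procs : List Cmd} {b : Test} (hc : b.cost = 5) (s₀ : State α)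
    (q : ℕ → Bool)
    (hb : ∀ s : State α, s.vreg = s₀.vreg → s.mem.val = s₀.mem.val → b.eval s = q (s.nreg 6))
    (hd : s₀.nreg 1 + s₀.nreg 2 ≤ s₀.nreg 7) :
    Runs procs (filterBody b) s₀ (fun s t =>
      s₀.mem.SameBut (s₀.nreg 7) s.mem ∧
      seg (s.mem.nat 7) (s₀.nreg 7) (s.nreg 0) =
        (seg (s₀.mem.nat 7) (s₀.nreg 1) (s₀.nreg 2)).filter q ∧
      s.nreg 0 = ((seg (s₀.mem.nat 7) (s₀.nreg 1) (s₀.nreg 2)).filter q).length ∧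
      t ≤ 40 * s₀.nreg 2 + 40) := by
  simp only [filterBody, runs_block_cons, runs_setNat]
  refine runs_loop (p := 40 * s₀.nreg 2) (fun s p => ∃ i ≤ s₀.nreg 2, s.nreg 1 = s₀.nreg 1 ∧
    s.nreg 2 = s₀.nreg 2 ∧ s.nreg 7 = s₀.nreg 7 ∧ s.nreg 4 = i ∧ s.vreg = s₀.vreg ∧
    s₀.mem.SameBut (s₀.nreg 7) s.mem ∧
    seg (s.mem.nat 7) (s₀.nreg 7) (s.nreg 0) =
        (seg (s₀.mem.nat 7) (s₀.nreg 1) i).filter q ∧ p = 40 * (s₀.nreg 2 - i)) ?_ ?_ ?_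
  · refine ⟨0, Nat.zero_le _, ?_⟩
    simp [Memory.SameBut.refl]
  · rintro s p ⟨i, hi, h1, h2, h7, h4, hv, hm, hs, rfl⟩ hlt
    simp [h2, h4] at hlt
    have hcell : s.mem.nat 7 (s₀.nreg 1 + i) = s₀.mem.nat 7 (s₀.nreg 1 + i) :=
      hm.2.2 _ (by omega)
    simp only [runs_block_cons, runs_setNat, runs_branch, runs_block_nil, runs_storeNat, runs_skip]
    refine ⟨fun h => ?_, fun h => ?_⟩
    · simp [hb, hv, hm.1, h1, h4, hcell] at h
      refine ⟨40 * (s₀.nreg 2 - (i + 1)), ⟨i + 1, hlt, ?_⟩, ?_⟩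
      · simp [h1, h2, h7, h4, hv, hcell, hm.setNat]
        rw [seg_succ, seg_succ, List.filter_append, ← hs]
        simp [h]
        apply seg_congr
        intro j _ _
        rw [Function.update_apply, if_neg (by omega)]
      · simp [hc]; omega
    · simp [hb, hv, hm.1, h1, h4, hcell] at h
      refine ⟨40 * (s₀.nreg 2 - (i + 1)), ⟨i + 1, hlt, ?_⟩, ?_⟩
      · simp [h1, h2, h7, h4, hv, hm]
        rw [seg_succ, List.filter_append, ← hs]
        simp [h]
      · simp [hc]; omega
  · rintro s t p ⟨i, hi, h1, h2, h7, h4, hv, hm, hs, rfl⟩ hlt ht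
    simp [h2, h4] at hlt
    obtain rfl : i = s₀.nreg 2 := by omega
    simp only [runs_block_nil]
    refine ⟨hm, hs, ?_, ?_⟩
    · rw [← hs, length_seg]
    · simp at ht ⊢; omega

theorem filterBody_lessTest_spec {procs : List Cmd} (s₀ : State α)
    (hd : s₀.nreg 1 + s₀.nreg 2 ≤ s₀.nreg 7) :
    Runs procs (filterBody lessTest) s₀ (fun s t =>
      s₀.mem.SameBut (s₀.nreg 7) s.mem ∧
      seg (s.mem.nat 7) (s₀.nreg 7) (s.nreg 0) = (seg (s₀.mem.nat 7) (s₀.nreg 1)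
        (s₀.nreg 2)).filter (fun y => decide (s₀.mem.val 1 y < s₀.vreg 1)) ∧
      s.nreg 0 = ((seg (s₀.mem.nat 7) (s₀.nreg 1)
        (s₀.nreg 2)).filter (fun y => decide (s₀.mem.val 1 y < s₀.vreg 1))).length ∧
      t ≤ 40 * s₀.nreg 2 + 40) :=
  filterBody_spec rfl s₀ _ (fun s hv hm => by
    rw [Bool.eq_iff_iff]; simp [lessTest, hv, hm]) hd

theorem filterBody_greaterTest_spec {procs : List Cmd} (s₀ : State α)
    (hd : s₀.nreg 1 + s₀.nreg 2 ≤ s₀.nreg 7) :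
    Runs procs (filterBody greaterTest) s₀ (fun s t =>
      s₀.mem.SameBut (s₀.nreg 7) s.mem ∧
      seg (s.mem.nat 7) (s₀.nreg 7) (s.nreg 0) = (seg (s₀.mem.nat 7) (s₀.nreg 1)
        (s₀.nreg 2)).filter (fun y => decide (s₀.vreg 1 < s₀.mem.val 1 y)) ∧
      s.nreg 0 = ((seg (s₀.mem.nat 7) (s₀.nreg 1)
        (s₀.nreg 2)).filter (fun y => decide (s₀.vreg 1 < s₀.mem.val 1 y))).length ∧
      t ≤ 40 * s₀.nreg 2 + 40) :=
  filterBody_spec rfl s₀ _ (fun s hv hm => by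
    rw [Bool.eq_iff_iff]; simp [greaterTest, hv, hm]) hd

theorem bruteBody_spec (s₀ : State α) (hd : s₀.nreg 1 + s₀.nreg 2 ≤ s₀.nreg 7)
    (hx : ∃ x ∈ seg (s₀.mem.nat 7) (s₀.nreg 1) (s₀.nreg 2),
      rank (s₀.mem.val 1) (seg (s₀.mem.nat 7) (s₀.nreg 1) (s₀.nreg 2)) x = s₀.nreg 3) :
    Runs procTable bruteBody s₀ (fun s t => s₀.mem.SameBut (s₀.nreg 7) s.mem ∧
      s.nreg 5 ∈ seg (s₀.mem.nat 7) (s₀.nreg 1) (s₀.nreg 2) ∧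
      rank (s₀.mem.val 1) (seg (s₀.mem.nat 7) (s₀.nreg 1) (s₀.nreg 2)) (s.nreg 5) = s₀.nreg 3 ∧
      t ≤ s₀.nreg 2 * (40 * s₀.nreg 2 + 100) + 100) := by
  set l := seg (s₀.mem.nat 7) (s₀.nreg 1) (s₀.nreg 2) with hl
  set c := 40 * s₀.nreg 2 + 100 with hc
  simp only [bruteBody, runs_block_cons, runs_setNat]
  refine runs_loop (p := s₀.nreg 2 * c) (fun s p => ∃ i ≤ s₀.nreg 2, s.nreg 1 = s₀.nreg 1 ∧
    s.nreg 2 = s₀.nreg 2 ∧ s.nreg 3 = s₀.nreg 3 ∧ s.nreg 7 = s₀.nreg 7 ∧ s.nreg 4 = i ∧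
    s₀.mem.SameBut (s₀.nreg 7) s.mem ∧
    ((∃ x ∈ seg (s₀.mem.nat 7) (s₀.nreg 1) i, rank (s₀.mem.val 1) l x = s₀.nreg 3) →
      s.nreg 5 ∈ seg (s₀.mem.nat 7) (s₀.nreg 1) i ∧
        rank (s₀.mem.val 1) l (s.nreg 5) = s₀.nreg 3) ∧
    p = (s₀.nreg 2 - i) * c) ?_ ?_ ?_
  · refine ⟨0, Nat.zero_le _, ?_⟩
    simp [Memory.SameBut.refl]
  · rintro s p ⟨i, hi, h1, h2, h3, h7, h4, hm, hs, rfl⟩ hlt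
    simp [h2, h4] at hlt
    have hcell : s.mem.nat 7 (s₀.nreg 1 + i) = s₀.mem.nat 7 (s₀.nreg 1 + i) :=
      hm.2.2 _ (by omega)
    have hp : (s₀.nreg 2 - i) * c = (s₀.nreg 2 - (i + 1)) * c + c := by
      rw [show s₀.nreg 2 - i = s₀.nreg 2 - (i + 1) + 1 by omega, Nat.succ_mul]
    simp only [runs_block_cons, runs_setNat, runs_setVal]
    refine runs_call_one rfl ((filterBody_lessTest_spec _
      (by simpa [Function.update_apply, h1, h2, h7] using hd)).mono ?_)
    rintro s' t ⟨hm', -, hr, ht⟩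
    simp [h1, h2, h4, h7, hcell, hm.1, hm.seg_eq hd] at hm' hr ht
    change s'.nreg 0 = rank _ l _ at hr
    simp only [runs_block_nil, runs_branch, runs_setNat, runs_skip]
    refine ⟨fun h => ?_, fun h => ?_⟩
    · simp [h3] at h
      refine ⟨(s₀.nreg 2 - (i + 1)) * c, ⟨i + 1, hlt, ?_⟩, ?_⟩
      · simp [h1, h2, h3, h7, h4, hcell, hm.trans hm' le_rfl]
        exact fun _ _ _ => ⟨by simp [seg_succ], by rw [← hr]; omega⟩
      · rw [hp]; simp; omega
    · simp [h3] at h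
      refine ⟨(s₀.nreg 2 - (i + 1)) * c, ⟨i + 1, hlt, ?_⟩, ?_⟩
      · simp [h1, h2, h3, h7, h4, hm.trans hm' le_rfl]
        intro x hx hxr
        rw [seg_succ, List.mem_append, List.mem_singleton] at hx
        have hx' : x ∈ seg (s₀.mem.nat 7) (s₀.nreg 1) i := by
          refine hx.resolve_right ?_
          rintro rfl
          omega
        have := hs ⟨x, hx', hxr⟩
        exact ⟨by simp [seg_succ, this.1], this.2⟩
      · rw [hp]; simp; omega
  · rintro s t p ⟨i, hi, h1, h2, h3, h7, h4, hm, hs, rfl⟩ hlt ht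
    simp [h2, h4] at hlt
    obtain rfl : i = s₀.nreg 2 := by omega
    simp only [runs_block_nil]
    obtain ⟨ha, hb⟩ := hs hx
    refine ⟨hm, ha, hb, ?_⟩
    simp at ht ⊢; omega

end

section
variable {α : Type u} [LinearOrder α] {v : ℕ → α} {l : List ℕ}

theorem countP_split {β : Type*} {p q r : β → Bool} (l : List β)
    (h : ∀ y ∈ l, p y = (q y || r y)) (h' : ∀ y ∈ l, q y = true → r y = true → False) :
    l.countP p = l.countP q + l.countP r := by
  induction l with
  | nil => rfl
  | cons a l ih =>
    have h1 := h a (by simp)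
    have h2 := h' a (by simp)
    rw [List.countP_cons, List.countP_cons, List.countP_cons,
      ih (fun y hy => h y (by simp [hy])) (fun y hy => h' y (by simp [hy]))]
    cases hq : q a <;> cases hr : r a <;> simp_all <;> omega

theorem rank_eq_countP (v : ℕ → α) (l : List ℕ) (x : ℕ) :
    rank v l x = l.countP (fun y => decide (v y < v x)) :=
  (List.countP_eq_length_filter ..).symm

theorem rank_lt_length {x : ℕ} (hx : x ∈ l) : rank v l x < l.length :=
  List.length_filter_lt_length_iff_exists.2 ⟨x, hx, by simp⟩

theorem countP_le_eq_rank_add_one (hl : (l.map v).Nodup) {x : ℕ} (hx : x ∈ l) :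
    l.countP (fun y => decide (v y ≤ v x)) = rank v l x + 1 := by
  have h1 : l.countP (fun y => decide (v y = v x)) = 1 := by
    rw [← List.count_eq_one_of_mem hl (List.mem_map_of_mem hx), List.count, List.countP_map]
    exact List.countP_congr fun y _ => by simp
  rw [rank_eq_countP, ← h1]
  refine countP_split l (fun y _ => ?_) (fun y _ => ?_)
  · rw [Bool.eq_iff_iff]; simp [le_iff_lt_or_eq]
  · simp only [decide_eq_true_eq]; exact fun h h' => h.ne h'

theorem rank_lt_rank {x y : ℕ} (hx : x ∈ l) (h : v x < v y) : rank v l x < rank v l y := by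
  have h1 : l.countP (fun z => decide (v z < v y)) =
      rank v l x + l.countP (fun z => decide (v x ≤ v z ∧ v z < v y)) := by
    rw [rank_eq_countP]
    refine countP_split l (fun z _ => ?_) (fun z _ => ?_)
    · rw [Bool.eq_iff_iff]
      simp only [decide_eq_true_eq, Bool.or_eq_true]
      constructor
      · exact fun hz => (lt_or_ge (v z) (v x)).imp id fun h' => ⟨h', hz⟩
      · rintro (hz | hz)
        exacts [hz.trans h, hz.2]
    · simp only [decide_eq_true_eq]; exact fun hz hz' => hz.not_ge hz'.1
  have h2 : 0 < l.countP (fun z => decide (v x ≤ v z ∧ v z < v y)) :=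
    List.countP_pos_iff.2 ⟨x, hx, by simp [h]⟩
  rw [rank_eq_countP v l y]; omega

theorem exists_rank_eq (hl : (l.map v).Nodup) {k : ℕ} (hk : k < l.length) :
    ∃ x ∈ l, rank v l x = k := by
  let f : Fin l.length → Fin l.length := fun i => ⟨rank v l l[i], rank_lt_length (by simp)⟩
  have hf : Function.Injective f := by
    intro i j hij
    have hr : rank v l l[i] = rank v l l[j] := congrArg Fin.val hij
    rcases lt_trichotomy (v l[i]) (v l[j]) with h | h | h
    · exact absurd hr (rank_lt_rank (by simp) h).ne
    · have h' : (l.map v)[i.1]'(by simp) = (l.map v)[j.1]'(by simp) := by simpa using h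
      exact Fin.ext ((hl.getElem_inj_iff).1 h')
    · exact absurd hr (rank_lt_rank (by simp) h).ne'
  obtain ⟨i, hi⟩ := Finite.injective_iff_surjective.1 hf ⟨k, hk⟩
  exact ⟨l[i], by simp, congrArg Fin.val hi⟩

theorem rank_filter_lt {b : α} {x : ℕ}
    (hx : x ∈ l.filter (fun y => decide (v y < b))) :
    rank v (l.filter (fun y => decide (v y < b))) x = rank v l x := by
  have hx' : v x < b := by simpa using (List.mem_filter.1 hx).2
  rw [rank, rank, List.filter_filter]
  congr 1
  refine List.filter_congr fun y _ => ?_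
  by_cases h : v y < v x
  · simp [h, h.trans hx']
  · simp [h]

theorem rank_filter_gt (hl : (l.map v).Nodup) {p x : ℕ} (hp : p ∈ l)
    (hx : x ∈ l.filter (fun y => decide (v p < v y))) :
    rank v l x = rank v (l.filter (fun y => decide (v p < v y))) x + (rank v l p + 1) := by
  have hx' : v p < v x := by simpa using (List.mem_filter.1 hx).2
  rw [← countP_le_eq_rank_add_one hl hp, rank_eq_countP, rank_eq_countP, List.countP_filter]
  refine countP_split l (fun y _ => ?_) (fun y _ => ?_)
  · rw [Bool.eq_iff_iff]
    simp only [decide_eq_true_eq, Bool.or_eq_true, Bool.and_eq_true]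
    constructor
    · exact fun hz => (le_or_gt (v y) (v p)).elim Or.inr fun h => Or.inl ⟨hz, h⟩
    · rintro (hz | hz)
      exacts [hz.1, hz.trans_lt hx']
  · simp only [decide_eq_true_eq, Bool.and_eq_true]
    exact fun hz hz' => hz.2.not_ge hz'

/-- `ms` lists the medians of consecutive groups of five that make up `l`. -/
inductive Medians (v : ℕ → α) : List ℕ → List ℕ → Prop
  | nil : Medians v [] []
  | snoc {l ms g : List ℕ} {x : ℕ} : Medians v l ms → g.length = 5 → x ∈ g → rank v g x = 2 →
      Medians v (l ++ g) (ms ++ [x])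

theorem Medians.length {ms : List ℕ} (h : Medians v l ms) : l.length = 5 * ms.length := by
  induction h with
  | nil => rfl
  | snoc _ hg _ _ ih => simp [ih, hg]; omega

theorem Medians.sublist {ms : List ℕ} (h : Medians v l ms) : ms.Sublist l := by
  induction h with
  | nil => simp
  | snoc _ hg hx _ ih => exact ih.append (List.singleton_sublist.2 hx)

/-- Three of the five items of a group do not exceed its median. -/
theorem Medians.countP_le {ms : List ℕ} (h : Medians v l ms) (b : α) :
    3 * ms.countP (fun y => decide (v y ≤ b)) ≤ l.countP (fun y => decide (v y ≤ b)) := by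
  induction h with
  | nil => simp
  | @snoc l ms g x _ hg hx hr ih =>
    rw [List.countP_append, List.countP_append, List.countP_singleton]
    split_ifs with hb
    · simp only [decide_eq_true_eq] at hb
      have h1 : g.countP (fun y => decide (v y ≤ v x)) =
          rank v g x + g.countP (fun y => decide (v y = v x)) := by
        rw [rank_eq_countP]
        refine countP_split g (fun y _ => ?_) (fun y _ => ?_)
        · rw [Bool.eq_iff_iff]; simp [le_iff_lt_or_eq]
        · simp only [decide_eq_true_eq]; exact fun h h' => h.ne h'
      have h2 : 0 < g.countP (fun y => decide (v y = v x)) :=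
        List.countP_pos_iff.2 ⟨x, hx, by simp⟩
      have h3 : g.countP (fun y => decide (v y ≤ v x)) ≤ g.countP (fun y => decide (v y ≤ b)) :=
        List.countP_mono_left fun y _ hy => by
          simp only [decide_eq_true_eq] at hy ⊢; exact hy.trans hb
      omega
    · omega

/-- Three of the five items of a group are at least its median. -/
theorem Medians.countP_ge {ms : List ℕ} (h : Medians v l ms) (b : α) :
    3 * ms.countP (fun y => decide (b ≤ v y)) ≤ l.countP (fun y => decide (b ≤ v y)) := by
  induction h with
  | nil => simp
  | @snoc l ms g x _ hg hx hr ih =>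
    rw [List.countP_append, List.countP_append, List.countP_singleton]
    split_ifs with hb
    · simp only [decide_eq_true_eq] at hb
      have h1 := g.length_eq_countP_add_countP (fun y => decide (v y < v x))
      rw [← rank_eq_countP] at h1
      have h3 : g.countP (fun y => decide ¬ decide (v y < v x) = true) ≤
          g.countP (fun y => decide (b ≤ v y)) :=
        List.countP_mono_left fun y _ hy => by
          simp only [decide_eq_true_eq, not_lt] at hy ⊢; exact hb.trans hy
      omega
    · omega

end

theorem nodup_map_seg {α : Type u} {v : ℕ → α} {W : ℕ → ℕ} {lo n i g : ℕ} (h : ((seg W lo n).map v).Nodup)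
    (hi : i + g ≤ n) : ((seg W (lo + i) g).map v).Nodup := by
  obtain ⟨c, rfl⟩ := Nat.exists_eq_add_of_le hi
  rw [seg_add, seg_add] at h
  simp only [List.map_append] at h
  exact (List.nodup_append.1 (List.nodup_append.1 h).1).2.1

section
variable {α : Type u} [LinearOrder α]

theorem mediansBody_spec (s₀ : State α)
    (hl : ((seg (s₀.mem.nat 7) (s₀.nreg 10) (s₀.nreg 11)).map (s₀.mem.val 1)).Nodup) :
    Runs procTable mediansBody s₀ (fun s t =>
      s₀.mem.SameBut (s₀.nreg 10 + s₀.nreg 11) s.mem ∧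
      (∃ i ≤ s₀.nreg 11, s₀.nreg 11 < i + 5 ∧
        Medians (s₀.mem.val 1) (seg (s₀.mem.nat 7) (s₀.nreg 10) i)
          (seg (s.mem.nat 7) (s₀.nreg 10 + s₀.nreg 11) (s.nreg 8))) ∧
      t ≤ 400 * s₀.nreg 11 + 400) := by
  set n := s₀.nreg 11 with hn
  set lo := s₀.nreg 10 with hlo
  simp only [mediansBody, runs_block_cons, runs_setNat]
  refine runs_loop (p := 400 * n) (fun s p => ∃ i ≤ n, s.nreg 10 = lo ∧ s.nreg 11 = n ∧
    s.nreg 2 = 5 ∧ s.nreg 3 = 2 ∧ s.nreg 9 = i ∧ s₀.mem.SameBut (lo + n) s.mem ∧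
    Medians (s₀.mem.val 1) (seg (s₀.mem.nat 7) lo i) (seg (s.mem.nat 7) (lo + n) (s.nreg 8)) ∧
    p = 400 * (n - i)) ?_ ?_ ?_
  · exact ⟨0, Nat.zero_le _, by simp [Memory.SameBut.refl, Medians.nil, ← hn, ← hlo]⟩
  · rintro s p ⟨i, hi, h10, h11, h2, h3, h9, hm, hM, rfl⟩ hlt
    simp [h9, h11] at hlt
    have hg : seg (s.mem.nat 7) (lo + i) 5 = seg (s₀.mem.nat 7) (lo + i) 5 :=
      hm.seg_eq (by omega)
    have hnd := nodup_map_seg hl hlt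
    simp only [runs_block_cons, runs_setNat]
    refine runs_call_one rfl ((bruteBody_spec _ ?_ ?_).mono ?_)
    · simp [h10, h11, h2, h9]; omega
    · simp [h10, h2, h3, h9, hm.1, hg]
      exact exists_rank_eq hnd (by simp)
    rintro s' t ⟨hm', hx, hr, ht⟩
    simp [h10, h11, h2, h3, h9, hm.1, hg] at hm' hx hr ht
    simp only [runs_block_nil, runs_storeNat]
    refine ⟨400 * (n - (i + 5)), ⟨i + 5, hlt, ?_⟩, ?_⟩
    · simp [h10, h11, h2, h3, h9]
      refine ⟨(hm.trans hm' (by omega)).setNat (by omega) _, ?_⟩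
      rw [seg_add, seg_succ (n := s.nreg 8), Function.update_self]
      rw [seg_congr (W := s.mem.nat 7) (lo := lo + n)]
      · exact hM.snoc (by simp) hx hr
      · intro j _ hj
        rw [Function.update_of_ne (by omega), hm'.2.2 _ hj]
    · simp; omega
  · rintro s t p ⟨i, hi, h10, h11, h2, h3, h9, hm, hM, rfl⟩ hlt ht
    simp [h9, h11] at hlt
    simp only [runs_block_nil]
    refine ⟨hm, ⟨i, hi, hlt, hM⟩, ?_⟩
    simp at ht ⊢; omega

set_option maxHeartbeats 400000 in
/-- The running time solves `T n ≤ T (n / 5) + T (7 n / 10 + 2) + O(n)`; segments of at most `100`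
items are handled by brute force. -/
theorem selectBody_spec (s₀ : State α)
    (hl : ((seg (s₀.mem.nat 7) (s₀.nreg 1) (s₀.nreg 2)).map (s₀.mem.val 1)).Nodup)
    (hk : s₀.nreg 3 < s₀.nreg 2) :
    Runs procTable selectBody s₀ (fun s t =>
      s₀.mem.SameBut (s₀.nreg 1 + s₀.nreg 2) s.mem ∧
      s.nreg 5 ∈ seg (s₀.mem.nat 7) (s₀.nreg 1) (s₀.nreg 2) ∧
      rank (s₀.mem.val 1) (seg (s₀.mem.nat 7) (s₀.nreg 1) (s₀.nreg 2)) (s.nreg 5) = s₀.nreg 3 ∧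
      t ≤ 10000 * s₀.nreg 2) := by
  induction hn : s₀.nreg 2 using Nat.strong_induction_on generalizing s₀ with
  | _ n ih =>
  subst hn
  set n := s₀.nreg 2 with hn
  set lo := s₀.nreg 1 with hlo
  set l := seg (s₀.mem.nat 7) lo n with hldef
  set v := s₀.mem.val 1 with hv
  simp only [selectBody, runs_block_cons, runs_setNat, runs_branch, runs_block_nil]
  refine ⟨fun h => ?_, fun h => ?_⟩
  · simp [← hn] at h
    refine runs_call_one rfl ((bruteBody_spec _ ?_ ?_).mono ?_)
    · simp [← hn, ← hlo]
    · simpa [Function.update_apply, ← hn, ← hlo] using exists_rank_eq hl (by rwa [length_seg])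
    rintro s t ⟨hm, hx, hr, ht⟩
    simp [← hn, ← hlo, ← hv] at hm hx hr ht
    refine ⟨by simpa using hm, by simpa using hx, by simpa using hr, ?_⟩
    simp
    have : n * (40 * n + 100) ≤ n * 4100 := Nat.mul_le_mul_left _ (by omega)
    omega
  · simp [← hn] at h
    refine runs_call_one rfl ((mediansBody_spec _ ?_).mono ?_)
    · simpa [Function.update_apply, ← hn, ← hlo] using hl
    rintro s₁ t₁ ⟨hm₁, ⟨i, hi, hi5, hM⟩, ht₁⟩
    simp [← hn, ← hlo, ← hv] at hm₁ hi hi5 hM ht₁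
    have hMl := hM.length
    simp only [length_seg] at hMl
    set g := s₁.nreg 8 with hg
    set ms := seg (s₁.mem.nat 7) (lo + n) g with hms
    have hpre : seg (s₀.mem.nat 7) lo i <+: l := by
      obtain ⟨c, hc⟩ := Nat.exists_eq_add_of_le hi
      rw [hldef, hc, seg_add]; exact List.prefix_append _ _
    have hmslen : ms.length = g := length_seg ..
    have hlen : l.length = n := length_seg ..
    have hmsl : ms.Sublist l := hM.sublist.trans hpre.sublist
    refine runs_call_one rfl ((ih g (by omega) _ ?_ ?_ ?_).mono ?_)
    · simpa [Function.update_apply, ← hn, ← hlo, ← hv, ← hg, hm₁.1] using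
        (hmsl.map v).nodup hl
    · simp; omega
    · simp
    rintro s₂ t₂ ⟨hm₂, hp, hr, ht₂⟩
    simp [← hn, ← hlo, ← hv, hm₁.1] at hm₂ hp hr ht₂
    change rank v ms (s₂.nreg 5) = g / 2 at hr
    set p := s₂.nreg 5 with hpdef
    have hm₁₂ := hm₁.trans hm₂ (by omega)
    have hpl : p ∈ l := hmsl.subset hp
    have hseg₂ : seg (s₂.mem.nat 7) lo n = l := hm₁₂.seg_eq (by omega)
    simp only [runs_setVal]
    refine runs_call_one rfl ((filterBody_lessTest_spec _ ?_).mono ?_)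
    · simp [← hn, ← hlo]
    rintro s₃ t₃ ⟨hm₃, hs₃, hc, ht₃⟩
    simp [← hn, ← hlo, ← hv, hm₁₂.1, hseg₂] at hm₃ hs₃ hc ht₃
    have hm₁₃ := hm₁₂.trans hm₃ (by omega)
    have hcr : s₃.nreg 0 = rank v l p := hc
    -- At least half of the medians, and with each of them two more items, are not below `p`.
    have hc1 : s₃.nreg 0 + 3 * (g - g / 2) ≤ n := by
      have h1 := ms.length_eq_countP_add_countP (fun y => decide (v y < v p))
      have h2 := l.length_eq_countP_add_countP (fun y => decide (v y < v p))
      have h3 := hM.countP_ge (v p)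
      have h4 := hpre.sublist.countP_le (p := fun y => decide (v p ≤ v y))
      rw [← rank_eq_countP] at h1 h2
      simp only [decide_eq_true_eq, not_lt] at h1 h2
      omega
    simp only [runs_skip]
    refine ⟨fun hlt => ?_, fun hge => ⟨fun heq => ?_, fun hgt => ?_⟩⟩
    · simp at hlt
      refine runs_call_one rfl ((ih (s₃.nreg 0) (by omega) _ ?_ ?_ ?_).mono ?_)
      · simp [← hn, ← hlo, ← hv, hm₁₃.1, hs₃]
        exact (List.filter_sublist.map v).nodup hl
      · simpa [Function.update_apply] using hlt
      · simp
      rintro s₄ t₄ ⟨hm₄, hx, hr₄, ht₄⟩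
      simp [← hn, ← hlo, ← hv, hm₁₃.1, hs₃] at hm₄ hx hr₄ ht₄
      rw [rank_filter_lt (by simpa using hx)] at hr₄
      refine ⟨hm₁₃.trans hm₄ (by omega), by simpa using hx.1, by simpa using hr₄, ?_⟩
      simp; omega
    · simp at hge heq
      refine ⟨hm₁₃, by simpa [Function.update_apply] using hpl, ?_, ?_⟩
      · simp; omega
      · simp; omega
    · simp at hgt
      refine runs_call_one rfl ((filterBody_greaterTest_spec _ ?_).mono ?_)
      · simp [← hn, ← hlo]
      rintro s₄ t₄ ⟨hm₄, hs₄, hc₄, ht₄⟩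
      have hseg₃ : seg (s₃.mem.nat 7) lo n = l := hm₁₃.seg_eq (by omega)
      simp [← hn, ← hlo, ← hv, hm₁₂.1, hm₁₃.1, hseg₃] at hm₄ hs₄ hc₄ ht₄
      have hm₁₄ := hm₁₃.trans hm₄ (by omega)
      have h2 := l.length_eq_countP_add_countP (fun y => decide (v y ≤ v p))
      have h2' := countP_le_eq_rank_add_one hl hpl
      simp only [decide_eq_true_eq, not_le] at h2
      rw [← List.countP_eq_length_filter] at hc₄
      -- At least half of the medians, and with each of them two more items, are not above `p`.
      have hc2 : s₄.nreg 0 + 3 * (g / 2 + 1) ≤ n := by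
        have h3 := hM.countP_le (v p)
        have h4 := hpre.sublist.countP_le (p := fun y => decide (v y ≤ v p))
        have h5 := countP_le_eq_rank_add_one ((hmsl.map v).nodup hl) hp
        omega
      have hcr' : s₄.nreg 0 + s₃.nreg 0 + 1 = n := by omega
      refine runs_call_one rfl ((ih (s₄.nreg 0) (by omega) _ ?_ ?_ ?_).mono ?_)
      · simp [← hn, ← hlo, ← hv, hm₁₄.1, hs₄]
        exact (List.filter_sublist.map v).nodup hl
      · simp; omega
      · simp
      rintro s₅ t₅ ⟨hm₅, hx, hr₅, ht₅⟩
      simp [← hn, ← hlo, ← hv, hm₁₄.1, hs₄] at hm₅ hx hr₅ ht₅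
      have hr₆ := rank_filter_gt hl hpl (x := s₅.nreg 5) (by simpa using hx)
      refine ⟨hm₁₄.trans hm₅ (by omega), by simpa using hx.1, ?_, ?_⟩
      · clear * - hr₆ hr₅ hcr hgt
        simp; omega
      · have key : 100 * (g + s₄.nreg 0) + 8 * n ≤ 100 * n := by
          clear * - hc2 h hMl hi5 hi
          omega
        clear * - ht₁ ht₂ ht₃ ht₄ ht₅ h key
        simp
        omega

end

/-! ### The stack of blocks -/

/-- The items of `l`, linked by `next`, form a list that starts at `h` and is terminated by `0`. -/
def IsList (next : ℕ → ℕ) : ℕ → List ℕ → Prop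
  | h, [] => h = 0
  | h, x :: l => h = x ∧ IsList next (next x) l

theorem IsList.update {next : ℕ → ℕ} {h : ℕ} {l : List ℕ} (hl : IsList next h l) {x : ℕ}
    (hx : x ∉ l) (y : ℕ) : IsList (Function.update next x y) h l := by
  induction l generalizing h with
  | nil => exact hl
  | cons z l ih =>
    simp only [List.mem_cons, not_or] at hx
    exact ⟨hl.1, by rw [Function.update_of_ne (Ne.symm hx.1)]; exact ih hl.2 hx.2⟩

section
variable {α : Type u}

/-- An item is live if it is the current item of its key. -/
def Memory.Live (m : Memory α) (x : ℕ) : Prop := m.nat 2 (m.nat 3 x) = x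

instance (m : Memory α) (x : ℕ) : Decidable (m.Live x) := inferInstanceAs (Decidable (_ = _))

variable [LinearOrder α]

/-- The memory `m` represents the content `D` by `k` blocks, where `Bl j` lists the items of block
`j`, and by the live items in `W`, which are in no block. Items are numbered from `1` to `F`. The
live items of block `j` have values of at most `m.val 2 j`, and those of the blocks before it have
larger values. Dead items may remain in the blocks, and the bounds say nothing about them. -/
structure Rep (B : α) (m : Memory α) (D : Content α) (k F : ℕ) (Bl : ℕ → List ℕ) (W : List ℕ) :
    Prop where
  hi_zero : m.val 2 0 = B
  hi_anti : ∀ i j, i ≤ j → j < k → m.val 2 j ≤ m.val 2 i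
  list : ∀ j < k, IsList (m.nat 4) (m.nat 5 j) (Bl j)
  cnt : ∀ j < k, m.nat 6 j = (Bl j).length
  nodup : ∀ j < k, (Bl j).Nodup
  disj : ∀ i < k, ∀ j < k, ∀ x ∈ Bl i, x ∈ Bl j → i = j
  bounds : ∀ j < k, ∀ x ∈ Bl j, 0 < x ∧ x ≤ F
  le_hi : ∀ j < k, ∀ x ∈ Bl j, m.Live x → m.val 1 x ≤ m.val 2 j
  hi_lt : ∀ i j, i < j → j < k → ∀ x ∈ Bl i, m.Live x → m.val 2 j < m.val 1 x
  work_nodup : W.Nodup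
  work : ∀ x ∈ W, 0 < x ∧ x ≤ F ∧ m.Live x ∧ ∀ j < k, x ∉ Bl j
  cover : ∀ a, m.nat 2 a ≠ 0 →
    m.nat 3 (m.nat 2 a) = a ∧ (m.nat 2 a ∈ W ∨ ∃ j < k, m.nat 2 a ∈ Bl j)
  content : ∀ a, D a = if m.nat 2 a = 0 then ⊤ else (m.val 1 (m.nat 2 a) : WithTop α)

namespace Rep

variable {B : α} {m : Memory α} {D : Content α} {k F : ℕ} {Bl : ℕ → List ℕ} {W : List ℕ}

theorem congr (h : Rep B m D k F Bl W) {m' : Memory α} (h1 : m'.val 1 = m.val 1)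
    (h2 : m'.val 2 = m.val 2) (hn : ∀ a, 2 ≤ a → a ≤ 6 → m'.nat a = m.nat a) :
    Rep B m' D k F Bl W := by
  have e2 := hn 2 (by omega) (by omega)
  have e3 := hn 3 (by omega) (by omega)
  have e4 := hn 4 (by omega) (by omega)
  have e5 := hn 5 (by omega) (by omega)
  have e6 := hn 6 (by omega) (by omega)
  have hL : m'.Live = m.Live := by funext x; simp [Memory.Live, e2, e3]
  constructor
  all_goals try simp only [h1, h2, e2, e3, e4, e5, e6, hL]
  exacts [h.hi_zero, h.hi_anti, h.list, h.cnt, h.nodup, h.disj, h.bounds, h.le_hi, h.hi_lt,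
    h.work_nodup, h.work, h.cover, h.content]

theorem sameBut (h : Rep B m D k F Bl W) {d : ℕ} {m' : Memory α} (hm : m.SameBut d m') :
    Rep B m' D k F Bl W :=
  h.congr (by rw [hm.1]) (by rw [hm.1]) fun a _ ha => hm.2.1 a (by omega)

theorem perm (h : Rep B m D k F Bl W) {W' : List ℕ} (hW : W.Perm W') : Rep B m D k F Bl W' :=
  { h with
    work_nodup := hW.nodup_iff.1 h.work_nodup
    work := fun x hx => h.work x (hW.mem_iff.2 hx)
    cover := fun a ha => ⟨(h.cover a ha).1, (h.cover a ha).2.imp hW.mem_iff.1 id⟩ }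

/-- The item `x` becomes the first item of block `j`. -/
theorem link {x j : ℕ} (h : Rep B m D k F Bl (x :: W)) (hj : j < k) (hle : m.val 1 x ≤ m.val 2 j)
    (hlt : ∀ i, j < i → i < k → m.val 2 i < m.val 1 x) :
    Rep B (((m.setNat 4 x (m.nat 5 j)).setNat 5 j x).setNat 6 j (m.nat 6 j + 1)) D k F
      (Function.update Bl j (x :: Bl j)) W := by
  obtain ⟨hx0, hxF, hxL, hxB⟩ := h.work x (by simp)
  have hxW := (List.nodup_cons.1 h.work_nodup).1
  have hL : ∀ y, Memory.Live (((m.setNat 4 x (m.nat 5 j)).setNat 5 j x).setNat 6 j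
    (m.nat 6 j + 1)) y ↔ m.Live y := fun y => by simp [Memory.Live]
  have hmem : ∀ i y, y ∈ Function.update Bl j (x :: Bl j) i ↔ (i = j ∧ y = x) ∨ y ∈ Bl i := by
    intro i y
    by_cases hi : i = j
    · subst hi; simp
    · simp [hi]
  constructor
  all_goals try simp only [hL, hmem]
  all_goals try simp only [Memory.setNat_val, Memory.setNat_nat, Nat.reduceEqDiff, if_true, if_false]
  · exact h.hi_zero
  · exact h.hi_anti
  · intro i hi
    by_cases hij : i = j
    · subst hij
      simp only [Function.update_self]
      exact ⟨rfl, by rw [Function.update_self]; exact (h.list i hi).update (hxB i hi) _⟩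
    · simp only [Function.update_of_ne hij]
      exact (h.list i hi).update (hxB i hi) _
  · intro i hi
    by_cases hij : i = j
    · subst hij
      simp [h.cnt i hi]
    · simp only [Function.update_of_ne hij]
      exact h.cnt i hi
  · intro i hi
    by_cases hij : i = j
    · subst hij
      simpa using ⟨hxB i hi, h.nodup i hi⟩
    · simpa [hij] using h.nodup i hi
  · rintro i hi i' hi' y (⟨rfl, rfl⟩ | hy) (⟨rfl, h'⟩ | hy')
    · rfl
    · exact absurd hy' (hxB _ hi')
    · subst h'; exact absurd hy (hxB _ hi)
    · exact h.disj i hi i' hi' y hy hy'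
  · rintro i hi y (⟨rfl, rfl⟩ | hy)
    exacts [⟨hx0, hxF⟩, h.bounds i hi y hy]
  · rintro i hi y (⟨rfl, rfl⟩ | hy) hy'
    exacts [hle, h.le_hi i hi y hy hy']
  · rintro i i' hii hi' y (⟨rfl, rfl⟩ | hy) hy'
    exacts [hlt i' hii hi', h.hi_lt i i' hii hi' y hy hy']
  · exact (List.nodup_cons.1 h.work_nodup).2
  · intro y hy
    obtain ⟨a, b, c, d⟩ := h.work y (by simp [hy])
    refine ⟨a, b, c, fun i hi => ?_⟩
    rintro (⟨rfl, rfl⟩ | hy')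
    exacts [hxW hy, d i hi hy']
  · intro a ha
    obtain ⟨h1, h2⟩ := h.cover a ha
    refine ⟨h1, ?_⟩
    rcases h2 with h2 | ⟨i, hi, h2⟩
    · rcases List.mem_cons.1 h2 with h2 | h2
      · exact Or.inr ⟨j, hj, Or.inl ⟨rfl, h2⟩⟩
      · exact Or.inl h2
    · exact Or.inr ⟨i, hi, Or.inr h2⟩
  · exact h.content

/-- A new item for the key `a`, which makes the previous one stale. -/
theorem alloc (h : Rep B m D k F Bl []) {a : ℕ} {b : α}
    (hab : m.nat 2 a ≠ 0 → ¬ m.val 1 (m.nat 2 a) ≤ b) :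
    Rep B (((m.setNat 3 (F + 1) a).setVal 1 (F + 1) b).setNat 2 a (F + 1)) (D.add (a, b)) k (F + 1)
      Bl [F + 1] := by
  set m' := (((m.setNat 3 (F + 1) a).setVal 1 (F + 1) b).setNat 2 a (F + 1)) with hm'
  have e2 : m'.nat 2 = Function.update (m.nat 2) a (F + 1) := by simp [hm']
  have e3 : m'.nat 3 = Function.update (m.nat 3) (F + 1) a := by simp [hm']
  have e4 : m'.nat 4 = m.nat 4 := by simp [hm']
  have e5 : m'.nat 5 = m.nat 5 := by simp [hm']
  have e6 : m'.nat 6 = m.nat 6 := by simp [hm']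
  have v1 : m'.val 1 = Function.update (m.val 1) (F + 1) b := by simp [hm']
  have v2 : m'.val 2 = m.val 2 := by simp [hm']
  have hne : ∀ i < k, ∀ y ∈ Bl i, y ≠ F + 1 := fun i hi y hy => by
    have := (h.bounds i hi y hy).2; omega
  have hL : ∀ i < k, ∀ y ∈ Bl i, m'.Live y → m.Live y := by
    intro i hi y hy hl
    simp only [Memory.Live, e2, e3, Function.update_of_ne (hne i hi y hy)] at hl ⊢
    by_cases hk : m.nat 3 y = a
    · rw [hk, Function.update_self] at hl
      exact absurd hl.symm (hne i hi y hy)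
    · rwa [Function.update_of_ne hk] at hl
  have hcur : ∀ c, m.nat 2 c ≠ 0 → m.nat 2 c ≠ F + 1 := by
    intro c hc
    obtain ⟨_, h2 | ⟨i, hi, h2⟩⟩ := h.cover c hc
    · simp at h2
    · exact hne i hi _ h2
  constructor
  all_goals try simp only [e2, e3, e4, e5, e6, v1, v2]
  · exact h.hi_zero
  · exact h.hi_anti
  · exact h.list
  · exact h.cnt
  · exact h.nodup
  · exact h.disj
  · intro i hi y hy
    exact ⟨(h.bounds i hi y hy).1, by have := (h.bounds i hi y hy).2; omega⟩
  · intro i hi y hy hl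
    rw [Function.update_of_ne (hne i hi y hy)]
    exact h.le_hi i hi y hy (hL i hi y hy hl)
  · intro i j hij hj y hy hl
    rw [Function.update_of_ne (hne i (hij.trans hj) y hy)]
    exact h.hi_lt i j hij hj y hy (hL i (hij.trans hj) y hy hl)
  · simp
  · intro x hx
    obtain rfl := List.mem_singleton.1 hx
    exact ⟨by omega, le_rfl, by simp [Memory.Live, e2, e3], fun j hj hx => hne j hj _ hx rfl⟩
  · intro c hc
    by_cases hca : c = a
    · subst hca; simp
    · rw [Function.update_of_ne hca] at hc ⊢
      obtain ⟨h1, h2 | h2⟩ := h.cover c hc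
      · simp at h2
      · exact ⟨by rwa [Function.update_of_ne (hcur c hc)], Or.inr h2⟩
  · intro c
    by_cases hca : c = a
    · subst hca
      simp only [Content.add, Function.update_self, Nat.add_eq_zero_iff, one_ne_zero, and_false,
        if_false]
      rw [h.content c]
      split_ifs with h0
      · simp
      · exact min_eq_right (WithTop.coe_le_coe.2 (not_le.1 (hab h0)).le)
    · simp only [Content.add, Function.update_of_ne hca, h.content c]
      split_ifs with h0
      · rfl
      · rw [Function.update_of_ne (hcur c h0)]

theorem add_eq_self (h : Rep B m D k F Bl W) {a : ℕ} {b : α} (h0 : m.nat 2 a ≠ 0)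
    (hab : m.val 1 (m.nat 2 a) ≤ b) : D.add (a, b) = D := by
  rw [Content.add, Function.update_eq_self_iff, h.content a, if_neg h0]
  exact min_eq_left (WithTop.coe_le_coe.2 hab)

/-- Add an empty block on top. -/
theorem push (h : Rep B m D k F Bl W) {m' : Memory α} (e2 : m'.nat 2 = m.nat 2)
    (e3 : m'.nat 3 = m.nat 3) (e4 : m'.nat 4 = m.nat 4) (v1 : m'.val 1 = m.val 1)
    (e5 : ∀ j < k, m'.nat 5 j = m.nat 5 j) (e6 : ∀ j < k, m'.nat 6 j = m.nat 6 j)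
    (v2 : ∀ j < k, m'.val 2 j = m.val 2 j) (f5 : m'.nat 5 k = 0) (f6 : m'.nat 6 k = 0)
    (h0 : m'.val 2 0 = B) (hle : ∀ j < k, m'.val 2 k ≤ m.val 2 j)
    (hlt : ∀ j < k, ∀ x ∈ Bl j, m.Live x → m'.val 2 k < m.val 1 x) :
    Rep B m' D (k + 1) F (Function.update Bl k []) W := by
  have hL : ∀ y, m'.Live y ↔ m.Live y := fun y => by simp [Memory.Live, e2, e3]
  have hmem : ∀ i y, y ∈ Function.update Bl k [] i ↔ i ≠ k ∧ y ∈ Bl i := by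
    intro i y
    by_cases hi : i = k
    · subst hi; simp
    · simp [hi]
  have hlt' : ∀ {i}, i < k + 1 → i ≠ k → i < k := by omega
  constructor
  all_goals try simp only [hL, hmem, e2, e3, e4, v1]
  · exact h0
  · intro i j hij hj
    by_cases hjk : j = k
    · subst hjk
      by_cases hi : i = j
      · rw [hi]
      · rw [v2 i (by omega)]; exact hle i (by omega)
    · rw [v2 i (by omega), v2 j (by omega)]
      exact h.hi_anti i j hij (by omega)
  · intro j hj
    by_cases hjk : j = k
    · subst hjk; simpa [IsList] using f5
    · rw [Function.update_of_ne hjk, e5 j (by omega)]; exact h.list j (by omega)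
  · intro j hj
    by_cases hjk : j = k
    · subst hjk; simpa using f6
    · rw [Function.update_of_ne hjk, e6 j (by omega)]; exact h.cnt j (by omega)
  · intro j hj
    by_cases hjk : j = k
    · subst hjk; simp
    · rw [Function.update_of_ne hjk]; exact h.nodup j (by omega)
  · rintro i hi j hj x ⟨hik, hx⟩ ⟨hjk, hx'⟩
    exact h.disj i (hlt' hi hik) j (hlt' hj hjk) x hx hx'
  · rintro j hj x ⟨hjk, hx⟩
    exact h.bounds j (hlt' hj hjk) x hx
  · rintro j hj x ⟨hjk, hx⟩ hl
    rw [v2 j (hlt' hj hjk)]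
    exact h.le_hi j (hlt' hj hjk) x hx hl
  · rintro i j hij hj x ⟨hik, hx⟩ hl
    by_cases hjk : j = k
    · subst hjk; exact hlt i hij x hx hl
    · rw [v2 j (hlt' hj hjk)]
      exact h.hi_lt i j hij (hlt' hj hjk) x hx hl
  · exact h.work_nodup
  · intro x hx
    obtain ⟨a, b, c, d⟩ := h.work x hx
    exact ⟨a, b, c, fun j hj hx' => d j (hlt' hj hx'.1) hx'.2⟩
  · intro a ha
    refine ⟨(h.cover a ha).1, (h.cover a ha).2.imp id ?_⟩
    rintro ⟨j, hj, hx⟩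
    exact ⟨j, by omega, by omega, hx⟩
  · exact h.content

/-- Remove the top block and keep its live items. -/
theorem pop (h : Rep B m D (k + 1) F Bl W) :
    Rep B m D k F Bl (W ++ (Bl k).filter (fun x => decide (m.Live x))) where
  hi_zero := h.hi_zero
  hi_anti i j hij hj := h.hi_anti i j hij (by omega)
  list j hj := h.list j (by omega)
  cnt j hj := h.cnt j (by omega)
  nodup j hj := h.nodup j (by omega)
  disj i hi j hj := h.disj i (by omega) j (by omega)
  bounds j hj := h.bounds j (by omega)
  le_hi j hj := h.le_hi j (by omega)
  hi_lt i j hij hj := h.hi_lt i j hij (by omega)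
  work_nodup := by
    refine List.nodup_append.2 ⟨h.work_nodup, (h.nodup k (by omega)).filter _, ?_⟩
    rintro x hx y hy rfl
    exact (h.work x hx).2.2.2 k (by omega) (List.mem_filter.1 hy).1
  work x hx := by
    rcases List.mem_append.1 hx with hx | hx
    · obtain ⟨a, b, c, d⟩ := h.work x hx
      exact ⟨a, b, c, fun j hj => d j (by omega)⟩
    · obtain ⟨hx, hl⟩ := List.mem_filter.1 hx
      obtain ⟨a, b⟩ := h.bounds k (by omega) x hx
      refine ⟨a, b, by simpa using hl, fun j hj hx' => ?_⟩
      have := h.disj k (by omega) j (by omega) x hx hx'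
      omega
  cover a ha := by
    obtain ⟨h1, h2⟩ := h.cover a ha
    refine ⟨h1, ?_⟩
    rcases h2 with h2 | ⟨j, hj, h2⟩
    · exact Or.inl (List.mem_append_left _ h2)
    · by_cases hjk : j = k
      · subst hjk
        exact Or.inl (List.mem_append_right _ (List.mem_filter.2 ⟨h2, by simp [Memory.Live, h1]⟩))
      · exact Or.inr ⟨j, by omega, h2⟩
  content := h.content

/-- Remove a live item that is in no block. -/
theorem remove {x : ℕ} (h : Rep B m D k F Bl (x :: W)) :
    Rep B (m.setNat 2 (m.nat 3 x) 0) (D.remove {m.nat 3 x}) k F Bl W := by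
  obtain ⟨hx0, hxF, hxL, hxB⟩ := h.work x (by simp)
  obtain ⟨hxW, hW⟩ := List.nodup_cons.1 h.work_nodup
  have hL : ∀ y, y ≠ 0 → (Memory.Live (m.setNat 2 (m.nat 3 x) 0) y ↔ m.Live y ∧ y ≠ x) := by
    intro y hy
    simp only [Memory.Live, Memory.setNat_nat, if_true, Nat.reduceEqDiff, if_false]
    by_cases hk : m.nat 3 y = m.nat 3 x
    · rw [hk, Function.update_self]
      refine iff_of_false (fun h => hy h.symm) ?_
      rintro ⟨h1, h2⟩
      exact h2 (h1.symm.trans hxL)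
    · rw [Function.update_of_ne hk]
      exact ⟨fun h => ⟨h, fun e => hk (by rw [e])⟩, fun h => h.1⟩
  have hL' : ∀ j < k, ∀ y ∈ Bl j, Memory.Live (m.setNat 2 (m.nat 3 x) 0) y → m.Live y :=
    fun j hj y hy hl => ((hL y (h.bounds j hj y hy).1.ne').1 hl).1
  constructor
  all_goals try simp only [Memory.setNat_val, Memory.setNat_nat, Nat.reduceEqDiff, if_true, if_false]
  · exact h.hi_zero
  · exact h.hi_anti
  · exact h.list
  · exact h.cnt
  · exact h.nodup
  · exact h.disj
  · exact h.bounds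
  · exact fun j hj y hy hl => h.le_hi j hj y hy (hL' j hj y hy hl)
  · exact fun i j hij hj y hy hl => h.hi_lt i j hij hj y hy (hL' i (hij.trans hj) y hy hl)
  · exact hW
  · intro y hy
    obtain ⟨a, b, c, d⟩ := h.work y (by simp [hy])
    exact ⟨a, b, (hL y a.ne').2 ⟨c, fun e => hxW (e ▸ hy)⟩, d⟩
  · intro a ha
    by_cases hax : a = m.nat 3 x
    · subst hax; simp at ha
    · rw [Function.update_of_ne hax] at ha ⊢
      obtain ⟨h1, h2⟩ := h.cover a ha
      refine ⟨h1, h2.imp_left fun h2 => ?_⟩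
      rcases List.mem_cons.1 h2 with h2 | h2
      · exact absurd (h2 ▸ h1).symm hax
      · exact h2
  · intro a
    by_cases hax : a = m.nat 3 x
    · subst hax; simp [Content.remove]
    · simp [Content.remove, hax, h.content a]

theorem content_key (h : Rep B m D k F Bl W) {x : ℕ} (hx : 0 < x) (hl : m.Live x) :
    D (m.nat 3 x) = m.val 1 x := by
  rw [h.content, hl, if_neg hx.ne']

theorem injOn_val (h : Rep B m D k F Bl W) (hD : D.DistinctValues) {x y : ℕ} (hx : 0 < x)
    (hlx : m.Live x) (hy : 0 < y) (hly : m.Live y) (hxy : m.val 1 x = m.val 1 y) : x = y := by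
  have h1 := h.content_key hx hlx
  have h2 := h.content_key hy hly
  have := hD (m.nat 3 x) (by simp [Content.keys, h1]) (m.nat 3 y) (by simp [Content.keys, h2])
    (by rw [h1, h2, hxy])
  rw [← hlx, ← hly, this]

theorem nodup_map_val (h : Rep B m D k F Bl W) (hD : D.DistinctValues) :
    (W.map (m.val 1)).Nodup := by
  refine h.work_nodup.map_on fun x hx y hy hxy => ?_
  obtain ⟨a, _, b, _⟩ := h.work x hx
  obtain ⟨c, _, d, _⟩ := h.work y hy
  exact h.injOn_val hD a b c d hxy

/-- All blocks together have at most as many items as have been created. -/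
theorem sum_length_le (h : Rep B m D k F Bl W) : ∑ j ∈ Finset.range k, (Bl j).length ≤ F := by
  have hd : ((Finset.range k : Finset ℕ) : Set ℕ).PairwiseDisjoint fun j => (Bl j).toFinset := by
    intro i hi j hj hij
    simp only [Finset.coe_range, Set.mem_Iio] at hi hj
    refine Finset.disjoint_left.2 fun x hx hx' => hij ?_
    exact h.disj i hi j hj x (List.mem_toFinset.1 hx) (List.mem_toFinset.1 hx')
  calc ∑ j ∈ Finset.range k, (Bl j).length
      = ∑ j ∈ Finset.range k, (Bl j).toFinset.card := Finset.sum_congr rfl fun j hj =>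
        (List.toFinset_card_of_nodup (h.nodup j (Finset.mem_range.1 hj))).symm
    _ = ((Finset.range k).biUnion fun j => (Bl j).toFinset).card := (Finset.card_biUnion hd).symm
    _ ≤ (Finset.Icc 1 F).card := Finset.card_le_card fun x hx => by
        simp only [Finset.mem_biUnion, Finset.mem_range, List.mem_toFinset] at hx
        obtain ⟨j, hj, hx⟩ := hx
        exact Finset.mem_Icc.2 (h.bounds j hj x hx)
    _ = F := by simp

end Rep

end

/-! ### The potential -/

/-- The number of halvings that bring the size `s` down to at most `M`. -/
def level (M s : ℕ) : ℕ := Nat.clog 2 ((s + M - 1) / M)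

section
variable {M : ℕ}

theorem level_le_iff (hM : 0 < M) {s i : ℕ} : level M s ≤ i ↔ s ≤ 2 ^ i * M := by
  rw [level, Nat.clog_le_iff_le_pow (by norm_num), ← Nat.lt_succ_iff, Nat.div_lt_iff_lt_mul hM,
    Nat.succ_mul]
  omega

theorem le_pow_level (hM : 0 < M) (s : ℕ) : s ≤ 2 ^ level M s * M := (level_le_iff hM).1 le_rfl

theorem level_mono (hM : 0 < M) {s s' : ℕ} (h : s ≤ s') : level M s ≤ level M s' :=
  (level_le_iff hM).2 (h.trans (le_pow_level hM s'))

theorem level_half (hM : 0 < M) {s : ℕ} (hs : M < s) : level M ((s + 1) / 2) + 1 ≤ level M s := by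
  have h := le_pow_level hM s
  rcases hi : level M s with _ | i
  · rw [hi] at h; omega
  · rw [hi, pow_succ, mul_right_comm] at h
    exact Nat.succ_le_succ ((level_le_iff hM).2 (by omega))

theorem level_mul_le (hM : 0 < M) (r s : ℕ) : level M (r * s) ≤ r + level M s := by
  rw [level_le_iff hM, pow_add, mul_assoc]
  exact Nat.mul_le_mul Nat.lt_two_pow_self.le (le_pow_level hM s)

theorem level_two_mul_le (hM : 0 < M) (s : ℕ) : level M (2 * s) ≤ 1 + level M s := by
  rw [level_le_iff hM, pow_add, mul_assoc, pow_one]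
  exact Nat.mul_le_mul_left _ (le_pow_level hM s)

theorem level_self_add_le (hM : 0 < M) (s : ℕ) : level M (M + s) ≤ 1 + level M s := by
  rw [level_le_iff hM, pow_add, mul_assoc, pow_one]
  have h := le_pow_level hM s
  have : 1 * M ≤ 2 ^ level M s * M := Nat.mul_le_mul_right _ Nat.one_le_two_pow
  omega

theorem clog_le_level (hM : 0 < M) {k F : ℕ} (h : (k - 1) * M ≤ F) :
    Nat.clog 2 k ≤ level M F + 1 := by
  rw [Nat.clog_le_iff_le_pow (by norm_num), pow_succ]
  have h1 := Nat.le_of_mul_le_mul_right (h.trans (le_pow_level hM F)) hM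
  have := Nat.one_le_two_pow (n := level M F)
  omega

theorem level_le_logb (hM : 0 < M) (s : ℕ) :
    (level M s : ℝ) ≤ 2 * max 1 (Real.logb 2 ((s : ℝ) / M)) := by
  have hM' : (0 : ℝ) < M := by exact_mod_cast hM
  rcases h : level M s with _ | i
  · simp
  · have h1 : ¬ s ≤ 2 ^ i * M := fun h' => by
      have := (level_le_iff hM).2 h'; omega
    have h2 : (2 : ℝ) ^ (i : ℝ) ≤ (s : ℝ) / M := by
      rw [le_div_iff₀ hM', Real.rpow_natCast]
      exact_mod_cast (not_le.1 h1).le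
    have h3 : (i : ℝ) ≤ Real.logb 2 ((s : ℝ) / M) :=
      (Real.le_logb_iff_rpow_le (by norm_num) (lt_of_lt_of_le (by positivity) h2)).2 h2
    push_cast
    linarith [le_max_left 1 (Real.logb 2 ((s : ℝ) / M)),
      le_max_right 1 (Real.logb 2 ((s : ℝ) / M))]

/-- The inequality behind the amortization: if the `n` inserted items are few among all `n + T`
items, the batches pay for the difference. -/
theorem mul_level_add_le (hM : 0 < M) {n N : ℕ} (hn : n ≤ N) (T : ℕ) :
    n * level M (n + T) ≤ n * (level M N + 1) + 2 * T := by
  rcases Nat.eq_zero_or_pos n with rfl | hn0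
  · simp
  have h1 := level_mono hM hn
  rcases le_total T n with h | h
  · have h2 := (level_mono hM (show n + T ≤ 2 * n by omega)).trans (level_two_mul_le hM n)
    have := Nat.mul_le_mul_left n (h2.trans (show 1 + level M n ≤ level M N + 1 by omega))
    omega
  · have h3 : n + T ≤ (T / n + 2) * n := by
      have := Nat.div_add_mod T n
      have := Nat.mod_lt T hn0
      rw [Nat.add_mul, mul_comm (T / n)]
      omega
    have h4 := (level_mono hM h3).trans (level_mul_le hM _ n)
    have h5 : 1 ≤ T / n := (Nat.one_le_div_iff hn0).2 h
    have h6 : T / n * n ≤ T := Nat.div_mul_le_self T n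
    calc n * level M (n + T) ≤ n * (level M N + 1 + (T / n + 1)) :=
          Nat.mul_le_mul_left _ (by omega)
      _ ≤ n * (level M N + 1 + 2 * (T / n)) := Nat.mul_le_mul_left _ (by omega)
      _ = n * (level M N + 1) + 2 * (T / n * n) := by ring
      _ ≤ _ := by omega

/-- The sum of the levels of `1, …, s`, a discrete version of `s * log (s / M)`. -/
def levelSum (M s : ℕ) : ℕ := ∑ i ∈ Finset.range s, level M (i + 1)

theorem levelSum_succ (M s : ℕ) : levelSum M (s + 1) = levelSum M s + level M (s + 1) :=
  Finset.sum_range_succ ..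

theorem levelSum_mono {s s' : ℕ} (h : s ≤ s') : levelSum M s ≤ levelSum M s' :=
  Finset.sum_le_sum_of_subset (by simpa using h)

/-- Halving a block of size `s` releases `s - M` units. -/
theorem levelSum_half (hM : 0 < M) (s : ℕ) :
    levelSum M ((s + 1) / 2) + levelSum M (s / 2) + (s - M) ≤ levelSum M s := by
  induction s with
  | zero => simp [levelSum]
  | succ s ih =>
    have h1 : levelSum M ((s + 1 + 1) / 2) + levelSum M ((s + 1) / 2) =
        levelSum M ((s + 1) / 2) + levelSum M (s / 2) + level M ((s + 1 + 1) / 2) := by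
      rw [show (s + 1 + 1) / 2 = s / 2 + 1 by omega, levelSum_succ]
      omega
    have h2 : level M ((s + 1 + 1) / 2) ≤ level M (s + 1) := level_mono hM (by omega)
    rw [h1, levelSum_succ]
    rcases Nat.lt_or_ge M (s + 1) with h | h
    · have := level_half hM h
      omega
    · omega

theorem levelSum_le (hM : 0 < M) {s : ℕ} (hs : s ≤ 2 * M) : levelSum M s ≤ s := by
  calc levelSum M s ≤ ∑ i ∈ Finset.range s, 1 := Finset.sum_le_sum fun i hi =>
        (level_le_iff hM).2 (by have := Finset.mem_range.1 hi; omega)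
    _ = s := by simp

/-- The potential of a block of size `s`. The coefficient of `levelSum` is large enough for
`levelSum_half` to pay for a selection, which takes `10000 * s` units; the other terms pay for
walking through the block and for discarding it. -/
def blockPot (M s : ℕ) : ℕ := 40000 * levelSum M s + 1000 * s + 1000

/-- The potential of the first `k` blocks. -/
def pot (M k : ℕ) (Bl : ℕ → List ℕ) : ℕ := ∑ j ∈ Finset.range k, blockPot M (Bl j).length

theorem pot_succ (M k : ℕ) (Bl : ℕ → List ℕ) :
    pot M (k + 1) Bl = pot M k Bl + blockPot M (Bl k).length := Finset.sum_range_succ ..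

theorem pot_congr {k : ℕ} {Bl Bl' : ℕ → List ℕ} (h : ∀ j < k, Bl' j = Bl j) :
    pot M k Bl' = pot M k Bl :=
  Finset.sum_congr rfl fun j hj => by rw [h j (Finset.mem_range.1 hj)]

theorem pot_update_cons {k j : ℕ} (hj : j < k) (Bl : ℕ → List ℕ) (x : ℕ) :
    pot M k (Function.update Bl j (x :: Bl j)) =
      pot M k Bl + (40000 * level M ((Bl j).length + 1) + 1000) := by
  have h1 : ∀ l : List ℕ, pot M k (Function.update Bl j l) = blockPot M l.length +
      ∑ i ∈ Finset.range k \ {j}, blockPot M (Bl i).length := by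
    intro l
    rw [pot, ← Finset.sum_update_of_mem (Finset.mem_range.2 hj)]
    refine Finset.sum_congr rfl fun i _ => ?_
    by_cases hi : i = j
    · subst hi; simp
    · simp [hi]
  have h2 := h1 (Bl j)
  rw [Function.update_eq_self] at h2
  rw [h1, h2, List.length_cons, blockPot, blockPot, levelSum_succ]
  ring

end

/-! ### Initialization and insertion -/

section
variable {α : Type u} [LinearOrder α]

theorem length_le_of_rep {B : α} {m : Memory α} {D : Content α} {k F : ℕ} {Bl : ℕ → List ℕ}
    {W : List ℕ} (h : Rep B m D k F Bl W) {j : ℕ} (hj : j < k) : (Bl j).length ≤ F :=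
  (Finset.single_le_sum (f := fun j => (Bl j).length) (fun _ _ => Nat.zero_le _)
    (Finset.mem_range.2 hj)).trans h.sum_length_le

theorem addBody_spec {B : α} {D : Content α} {k F M : ℕ} {Bl : ℕ → List ℕ} (s₀ : State α)
    (h : Rep B s₀.mem D k F Bl []) (hF : s₀.mem.nat 1 2 = F) (hj : s₀.nreg 2 < k)
    (hle : s₀.vreg 1 ≤ s₀.mem.val 2 (s₀.nreg 2))
    (hlt : ∀ i, s₀.nreg 2 < i → i < k → s₀.mem.val 2 i < s₀.vreg 1) :
    Runs procTable addBody s₀ (fun s t => ∃ F' Bl',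
      Rep B s.mem (D.add (s₀.nreg 1, s₀.vreg 1)) k F' Bl' [] ∧ F' ≤ F + 1 ∧ s.mem.nat 1 2 = F' ∧
      s.mem.nat 1 0 = s₀.mem.nat 1 0 ∧ s.mem.nat 1 1 = s₀.mem.nat 1 1 ∧
      s.mem.nat 0 = s₀.mem.nat 0 ∧ s.mem.val 0 = s₀.mem.val 0 ∧ s.mem.val 2 = s₀.mem.val 2 ∧
      (∀ i < k, (Bl i).length ≤ (Bl' i).length) ∧
      (Bl' (s₀.nreg 2)).length ≤ (Bl (s₀.nreg 2)).length + 1 ∧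
      pot M k Bl' ≤ pot M k Bl + (40000 * level M ((Bl (s₀.nreg 2)).length + 1) + 1000) ∧
      t ≤ 100) := by
  simp only [addBody, runs_branch, runs_skip]
  refine ⟨fun hb => ?_, fun hb => ?_⟩
  · simp at hb
    refine ⟨F, Bl, ?_, by omega, hF, trivial, trivial, trivial, trivial, trivial,
      fun _ _ => le_rfl, Nat.le_succ _, Nat.le_add_right _ _, by simp⟩
    rw [h.add_eq_self (by omega) hb.2]
    exact h
  · simp at hb
    have h1 := h.alloc (a := s₀.nreg 1) (b := s₀.vreg 1) (fun h0 => not_le.2 (hb.resolve_left h0))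
    have h2 := h1.link (j := s₀.nreg 2) hj (by simpa using hle) (by simpa using hlt)
    simp only [linkCode, runs_block_cons, runs_block_nil, runs_setNat, runs_storeNat, runs_storeVal]
    refine ⟨F + 1, _, h2.congr ?_ ?_ ?_, le_rfl, by simp [hF], by simp, by simp, by simp, by simp,
      by simp, ?_, ?_, (pot_update_cons hj Bl (F + 1)).le, by simp⟩
    · simp [hF]
    · simp
    · intro a ha1 ha2
      interval_cases a <;> simp [hF]
    · intro i hi
      by_cases hij : i = s₀.nreg 2
      · subst hij; simp
      · simp [hij]
    · simp

/-- What holds between operations: the memory `m` represents the content `D`, at most `F` items have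
been created, every block but the top one has at least `M` items, and the potential
is `p`. -/
def Inv (M : ℕ) (B : α) (m : Memory α) (D : Content α) (F p : ℕ) : Prop :=
  ∃ k Bl, 0 < k ∧ Rep B m D k F Bl [] ∧ m.nat 1 0 = M ∧ m.nat 1 1 = k ∧ m.nat 1 2 = F ∧
    (∀ j, j + 1 < k → M ≤ (Bl j).length) ∧ p = pot M k Bl

theorem initCode_spec (M : ℕ) (B : α) :
    Runs procTable initCode (State.entry B M B (Memory.blank B)) (fun s t =>
      ∃ p, Inv M B s.mem (fun _ => ⊤) 0 p ∧ t + p ≤ 2000) := by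
  simp [initCode, State.entry]
  refine ⟨_, ⟨1, fun _ => [], one_pos, ?_, by simp, by simp, ?_, by simp, rfl⟩, ?_⟩
  · constructor <;> simp [Memory.blank, IsList]
  · simp [Memory.blank]
  · simp [pot, blockPot, levelSum]

/-- The binary search takes time `O(log k)` for `k` blocks, and `(k - 1) * M ≤ F`. -/
theorem insertCode_spec {M : ℕ} {B : α} {m : Memory α} {D : Content α} {F p : ℕ} (hM : 0 < M)
    (h : Inv M B m D F p) (a : ℕ) {b : α} (hb : b ≤ B) :
    Runs procTable insertCode (State.entry B a b m) (fun s t => ∃ F' p',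
      Inv M B s.mem (D.add (a, b)) F' p' ∧ F' ≤ F + 1 ∧
        t + p' ≤ p + 50000 * (1 + level M (F + 1))) := by
  obtain ⟨k, Bl, hk, h, hm0, hm1, hm2, hbig, rfl⟩ := h
  simp only [insertCode, runs_block_cons, runs_setVal, runs_setNat]
  -- The block is at least `r2` and less than `r3`.
  refine runs_loop (p := 30 * Nat.clog 2 k) (fun s p => s.mem = m ∧ s.nreg 1 = a ∧ s.vreg 1 = b ∧
    s.nreg 2 < s.nreg 3 ∧ s.nreg 3 ≤ k ∧ b ≤ m.val 2 (s.nreg 2) ∧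
    (∀ i, s.nreg 3 ≤ i → i < k → m.val 2 i < b) ∧
    p = 30 * Nat.clog 2 (s.nreg 3 - s.nreg 2)) ?_ ?_ ?_
  · simp [State.entry, hm1, hk, h.hi_zero, hb]
    omega
  · rintro s p ⟨rfl, ha, hb, h23, h3k, hle, hlt, rfl⟩ ht
    simp at ht
    have hclog : ∀ d, d ≤ (s.nreg 3 - s.nreg 2 + 1) / 2 →
        Nat.clog 2 d + 1 ≤ Nat.clog 2 (s.nreg 3 - s.nreg 2) := by
      intro d hd
      rw [Nat.clog_of_two_le (n := s.nreg 3 - s.nreg 2) (by norm_num) (by omega)]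
      exact Nat.succ_le_succ (Nat.clog_mono_right 2 (by omega))
    simp only [runs_block_cons, runs_setNat, runs_branch, runs_block_nil]
    refine ⟨fun h' => ?_, fun h' => ?_⟩
    · simp [hb] at h'
      refine ⟨30 * Nat.clog 2 (s.nreg 3 - (s.nreg 2 + s.nreg 3) / 2), ?_, ?_⟩
      · simp [ha, hb, h3k, h']
        exact ⟨by omega, hlt⟩
      · have := hclog (s.nreg 3 - (s.nreg 2 + s.nreg 3) / 2) (by omega)
        simp; omega
    · simp [hb] at h'
      refine ⟨30 * Nat.clog 2 ((s.nreg 2 + s.nreg 3) / 2 - s.nreg 2), ?_, ?_⟩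
      · simp [ha, hb, hle]
        refine ⟨by omega, by omega, fun i hi hik => (h.hi_anti _ _ hi hik).trans_lt h'⟩
      · have := hclog ((s.nreg 2 + s.nreg 3) / 2 - s.nreg 2) (by omega)
        simp; omega
  · rintro s t p ⟨rfl, ha, hb, h23, h3k, hle, hlt, rfl⟩ ht htp
    simp at ht
    have h3 : s.nreg 3 = s.nreg 2 + 1 := by omega
    simp only [runs_block_nil]
    refine runs_call_none rfl ((addBody_spec (M := M) s h hm2 (by omega) (hb ▸ hle)
      (fun i hi hik => hb ▸ hlt i (by omega) hik)).mono ?_)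
    rintro s' t' ⟨F', Bl', hR, hF', e2, e0, e1, -, -, -, hlen, -, hpot, ht'⟩
    rw [ha, hb] at hR
    refine ⟨F', pot M k Bl', ⟨k, Bl', hk, hR, e0.trans hm0, e1.trans hm1, e2, ?_, rfl⟩, hF', ?_⟩
    · exact fun j hj => (hbig j hj).trans (hlen j (by omega))
    · have h1 : level M ((Bl (s.nreg 2)).length + 1) ≤ level M (F + 1) :=
        level_mono hM (Nat.succ_le_succ (length_le_of_rep h (by omega)))
      have h2 : (k - 1) * M ≤ F + 1 := by
        obtain ⟨k', rfl⟩ := Nat.exists_eq_add_of_lt hk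
        have h4 : ∑ j ∈ Finset.range k', M ≤ ∑ j ∈ Finset.range k', (Bl j).length :=
          Finset.sum_le_sum fun j hj =>
            hbig j (by have := Finset.mem_range.1 hj; omega)
        have h5 := h.sum_length_le
        rw [show 0 + k' + 1 = k' + 1 by omega, Finset.sum_range_succ] at h5
        simp only [Finset.sum_const, Finset.card_range, smul_eq_mul] at h4
        simp only [zero_add, Nat.add_sub_cancel]
        omega
      have h3 := clog_le_level hM h2
      simp only [Test.cost, NExp.cost, VExp.cost] at htp ⊢
      omega

end

/-! ### Batches -/

section
variable {α : Type u} [LinearOrder α]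

theorem maxLoop_spec {procs : List Cmd} (s₀ : State α) (L : List (ℕ × α))
    (h0 : s₀.nreg 0 = L.length) (h1 : s₀.nreg 1 = 1) (hL : 0 < L.length)
    (hv : s₀.vreg 1 = (L[0]).2) (hc : ∀ i (hi : i < L.length), s₀.mem.val 0 i = (L[i]).2) :
    Runs procs maxLoop s₀ (fun s t => s.mem = s₀.mem ∧ s.nreg 0 = L.length ∧
      (∃ q ∈ L, s.vreg 1 = q.2) ∧ (∀ q ∈ L, q.2 ≤ s.vreg 1) ∧ t ≤ 40 * L.length) := by
  refine runs_loop (p := 40 * (L.length - 1)) (fun s p => ∃ i, 1 ≤ i ∧ i ≤ L.length ∧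
    s.mem = s₀.mem ∧ s.nreg 0 = L.length ∧ s.nreg 1 = i ∧ (∃ q ∈ L, s.vreg 1 = q.2) ∧
    (∀ j (hj : j < L.length), j < i → (L[j]).2 ≤ s.vreg 1) ∧ p = 40 * (L.length - i)) ?_ ?_ ?_
  · refine ⟨1, le_rfl, hL, rfl, h0, h1, ⟨L[0], by simp, hv⟩, fun j hj hj1 => ?_, rfl⟩
    obtain rfl : j = 0 := by omega
    rw [hv]
  · rintro s p ⟨i, hi1, hi, hm, h0, h1, hq, hle, rfl⟩ ht
    simp [h0, h1] at ht
    have hlast : ∀ v, (∀ j (hj : j < L.length), j < i → (L[j]).2 ≤ v) → (L[i]).2 ≤ v →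
        ∀ j (hj : j < L.length), j < i + 1 → (L[j]).2 ≤ v := by
      intro v h h' j hj hji
      rcases Nat.lt_succ_iff_lt_or_eq.1 hji with hji | rfl
      exacts [h j hj hji, h']
    simp only [runs_block_cons, runs_block_nil, runs_branch, runs_setVal, runs_setNat, runs_skip]
    refine ⟨fun h => ?_, fun h => ?_⟩
    · simp [hm, h1, hc i ht] at h
      refine ⟨40 * (L.length - (i + 1)), ⟨i + 1, by omega, ht, hm, ?_, ?_, hq,
        hlast _ hle h, rfl⟩, ?_⟩
      · simpa using h0
      · simpa using h1
      · simp; omega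
    · simp [hm, h1, hc i ht] at h
      refine ⟨40 * (L.length - (i + 1)), ⟨i + 1, by omega, ht, hm, ?_, ?_, ?_, ?_, rfl⟩, ?_⟩
      · simpa using h0
      · simpa using h1
      · exact ⟨L[i], by simp, by simp [hm, h1, hc i ht]⟩
      · refine hlast _ (fun j hj hji => (hle j hj hji).trans ?_) ?_
        · simpa [hm, h1, hc i ht] using h.le
        · simp [hm, h1, hc i ht]
      · simp; omega
  · rintro s t p ⟨i, hi1, hi, hm, h0, h1, hq, hle, rfl⟩ ht htp
    simp [h0, h1] at ht
    refine ⟨hm, h0, hq, fun q hqL => ?_, ?_⟩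
    · obtain ⟨j, hj, rfl⟩ := List.getElem_of_mem hqL
      exact hle j hj (by omega)
    · simp at htp; omega

/-- The discarded blocks have no live items, and their potential pays for discarding them. -/
theorem discardLoop_spec {procs : List Cmd} {M : ℕ} {B : α} {D : Content α} {F : ℕ}
    {Bl : ℕ → List ℕ} (s₀ : State α) (h : Rep B s₀.mem D (s₀.nreg 2 + 1) F Bl [])
    (hv : ∀ l ∈ D.keys, (s₀.vreg 1 : WithTop α) < D l) :
    Runs procs discardLoop s₀ (fun s t => s.mem = s₀.mem ∧ s.nreg 0 = s₀.nreg 0 ∧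
      s.vreg = s₀.vreg ∧ s.nreg 2 ≤ s₀.nreg 2 ∧ Rep B s.mem D (s.nreg 2 + 1) F Bl [] ∧
      (s.nreg 2 = 0 ∨ s.vreg 1 < s.mem.val 2 (s.nreg 2)) ∧
      t + pot M (s.nreg 2 + 1) Bl ≤ pot M (s₀.nreg 2 + 1) Bl + 20) := by
  refine runs_loop (p := pot M (s₀.nreg 2 + 1) Bl) (fun s p => s.mem = s₀.mem ∧
    s.nreg 0 = s₀.nreg 0 ∧ s.vreg = s₀.vreg ∧ s.nreg 2 ≤ s₀.nreg 2 ∧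
    Rep B s.mem D (s.nreg 2 + 1) F Bl [] ∧ p = pot M (s.nreg 2 + 1) Bl) ?_ ?_ ?_
  · exact ⟨rfl, rfl, rfl, le_rfl, h, rfl⟩
  · rintro s p ⟨hm, h0, hvr, h2, hR, rfl⟩ ht
    simp at ht
    obtain ⟨j, hj⟩ := Nat.exists_eq_succ_of_ne_zero (show s.nreg 2 ≠ 0 by omega)
    rw [hj] at hR ht
    -- A live item of the discarded block would have a value of at most `v1`.
    have hstale : (Bl (j + 1)).filter (fun x => decide (s.mem.Live x)) = [] := by
      refine List.filter_eq_nil_iff.2 fun x hx hl => ?_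
      simp only [decide_eq_true_eq] at hl
      have h1 := hR.content_key (hR.bounds _ (by omega) x hx).1 hl
      have h2 := hv (s.mem.nat 3 x) (by simp [Content.keys, h1])
      rw [h1, WithTop.coe_lt_coe, ← hvr] at h2
      exact absurd (((hR.le_hi _ (by omega) x hx hl).trans ht.2).trans_lt h2) (lt_irrefl _)
    have hR' := hR.pop
    rw [hstale, List.append_nil] at hR'
    rw [runs_setNat]
    refine ⟨pot M (j + 1) Bl, ?_, ?_⟩
    · simp [hm, h0, hvr, hj] at hR' ⊢
      exact ⟨by omega, hR'⟩
    · rw [hj, pot_succ M (j + 1), blockPot]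
      simp; omega
  · rintro s t p ⟨hm, h0, hvr, h2, hR, rfl⟩ ht htp
    simp at ht
    refine ⟨hm, h0, hvr, h2, hR, ?_, ?_⟩
    · exact ht.imp_left fun h => by omega
    · simpa using htp.trans (by simp)

/-- The block has at most `M + L.length` items all the time, so that its level is at most
`1 + level M L.length`. -/
theorem addLoop_spec {M : ℕ} {B : α} {D : Content α} {j F : ℕ} {Bl : ℕ → List ℕ} (s₀ : State α)
    (L : List (ℕ × α)) (hM : 0 < M) (h : Rep B s₀.mem D (j + 1) F Bl [])
    (hF : s₀.mem.nat 1 2 = F) (h0 : s₀.nreg 0 = L.length) (h2 : s₀.nreg 2 = j)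
    (h4 : s₀.nreg 4 = 0) (hc : ∀ i (hi : i < L.length), s₀.mem.nat 0 i = (L[i]).1 ∧
      s₀.mem.val 0 i = (L[i]).2) (hle : ∀ q ∈ L, q.2 ≤ s₀.mem.val 2 j)
    (hlen : (Bl j).length ≤ M) :
    Runs procTable addLoop s₀ (fun s t => ∃ F' Bl', Rep B s.mem (L.foldl Content.add D) (j + 1) F'
      Bl' [] ∧ F' ≤ F + L.length ∧ s.mem.nat 1 2 = F' ∧ s.mem.nat 1 0 = s₀.mem.nat 1 0 ∧
      s.mem.nat 1 1 = s₀.mem.nat 1 1 ∧ (∀ i < j + 1, (Bl i).length ≤ (Bl' i).length) ∧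
      t + pot M (j + 1) Bl' ≤
        pot M (j + 1) Bl + L.length * (42000 * (1 + level M L.length)) + 20) := by
  set c := 40000 * (1 + level M L.length) + 1000 with hcdef
  refine runs_loop (p := 200 * L.length) (fun s p => ∃ i ≤ L.length, ∃ F' Bl',
    Rep B s.mem ((L.take i).foldl Content.add D) (j + 1) F' Bl' [] ∧ F' ≤ F + i ∧
    s.mem.nat 1 2 = F' ∧ s.mem.nat 1 0 = s₀.mem.nat 1 0 ∧ s.mem.nat 1 1 = s₀.mem.nat 1 1 ∧
    (∀ i < j + 1, (Bl i).length ≤ (Bl' i).length) ∧ (Bl' j).length ≤ M + i ∧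
    pot M (j + 1) Bl' ≤ pot M (j + 1) Bl + i * c ∧ s.nreg 0 = L.length ∧ s.nreg 2 = j ∧
    s.nreg 4 = i ∧ s.mem.nat 0 = s₀.mem.nat 0 ∧ s.mem.val 0 = s₀.mem.val 0 ∧
    s.mem.val 2 = s₀.mem.val 2 ∧ p = 200 * (L.length - i)) ?_ ?_ ?_
  · exact ⟨0, Nat.zero_le _, F, Bl, by simpa using h, by simp, hF, rfl, rfl, fun _ _ => le_rfl,
      by omega, by simp, h0, h2, h4, rfl, rfl, rfl, by simp⟩
  · rintro s p ⟨i, hi, F', Bl', hR, hF', e2, e0, e1, hmono, hlen', hpot, h0, h2, h4, a0, b0, b2,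
      rfl⟩ ht
    simp [h0, h4] at ht
    obtain ⟨hc1, hc2⟩ := hc i ht
    simp only [runs_block_cons, runs_setNat, runs_setVal]
    refine runs_call_none rfl ((addBody_spec (M := M) (k := j + 1) (D := (L.take i).foldl
      Content.add D) (B := B) (F := F') (Bl := Bl') _ ?_ ?_ ?_ ?_ ?_).mono ?_)
    · exact hR
    · exact e2
    · simp [h2]
    · simpa [Function.update_apply, h2, h4, b0, b2, hc2] using hle (L[i]) (by simp)
    · simp [h2]
      omega
    rintro s' t' ⟨F'', Bl'', hR', hF'', f2, f0, f1, a0', b0', b2', hmono', hlen'', hpot', ht'⟩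
    simp [h2, h4, a0, b0, hc1, hc2] at hR' f0 f1 a0' b0' b2' hlen'' hpot'
    simp only [runs_block_nil]
    refine ⟨200 * (L.length - (i + 1)), ⟨i + 1, ht, F'', Bl'', ?_, by omega, f2, f0.trans e0,
      f1.trans e1, fun i hi => (hmono i hi).trans (hmono' i hi), by omega, ?_, ?_, ?_, ?_, a0',
      b0', b2'.trans b2, rfl⟩, ?_⟩
    · rw [← List.take_append_getElem ht, List.foldl_append]
      exact hR'
    · have h1 : level M ((Bl' j).length + 1) ≤ 1 + level M L.length :=
        (level_mono hM (show (Bl' j).length + 1 ≤ M + L.length by omega)).trans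
          (level_self_add_le hM _)
      have h3 : 40000 * level M ((Bl' j).length + 1) + 1000 ≤ c :=
        Nat.add_le_add_right (Nat.mul_le_mul_left _ h1) _
      rw [Nat.succ_mul, ← Nat.add_assoc]
      exact hpot'.trans (Nat.add_le_add hpot h3)
    · simpa [Function.update_apply] using h0
    · simpa [Function.update_apply] using h2
    · simp [h4]
    · simp; omega
  · rintro s t p ⟨i, hi, F', Bl', hR, hF', e2, e0, e1, hmono, hlen', hpot, h0, h2, h4, a0, b0, b2,
      rfl⟩ ht htp
    simp [h0, h4] at ht
    obtain rfl : i = L.length := by omega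
    rw [List.take_length] at hR
    refine ⟨F', Bl', hR, hF', e2, e0, e1, hmono, ?_⟩
    have : L.length * (c + 200) ≤ L.length * (42000 * (1 + level M L.length)) :=
      Nat.mul_le_mul_left _ (by omega)
    rw [Nat.mul_add] at this
    simp at htp
    omega

theorem batchCode_spec {M : ℕ} {B : α} {m : Memory α} {D : Content α} {F p : ℕ} (hM : 0 < M)
    (h : Inv M B m D F p) (L : List (ℕ × α))
    (hL : ∀ q ∈ L, q.2 ≤ B ∧ ∀ k ∈ D.keys, (q.2 : WithTop α) < D k) :
    Runs procTable batchCode (State.entry B L.length B (m.write L)) (fun s t => ∃ F' p',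
      Inv M B s.mem (L.foldl Content.add D) F' p' ∧ F' ≤ F + L.length ∧
        t + p' ≤ p + 50000 * (max 1 L.length * (1 + level M L.length))) := by
  obtain ⟨k, Bl, hk, h, hm0, hm1, hm2, hbig, rfl⟩ := h
  have hR : Rep B (m.write L) D k F Bl [] := by
    refine h.congr ?_ ?_ fun a ha _ => ?_
    · simp [Memory.write]
    · simp [Memory.write]
    · simp [Memory.write, show a ≠ 0 by omega]
  have hw1 : (m.write L).nat 1 = m.nat 1 := by simp [Memory.write]
  have hcell : ∀ i (hi : i < L.length), (m.write L).nat 0 i = (L[i]).1 ∧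
      (m.write L).val 0 i = (L[i]).2 := by
    intro i hi
    simp [Memory.write, hi]
  generalize m.write L = m' at hR hw1 hcell
  rw [← hw1] at hm0 hm1 hm2
  simp only [batchCode, runs_branch, runs_skip]
  refine ⟨fun hpos => ?_, fun hpos => ?_⟩
  · simp [State.entry] at hpos
    simp only [runs_block_cons, runs_setVal, runs_setNat]
    refine (maxLoop_spec _ L ?_ ?_ hpos ?_ fun i hi => ?_).mono ?_
    · simp [State.entry]
    · simp
    · exact (hcell 0 hpos).2
    · exact (hcell i hi).2
    rintro s₁ t₁ ⟨m₁, r0, ⟨q, hq, hqv⟩, hmax, ht₁⟩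
    replace m₁ : s₁.mem = m' := m₁
    have hvB : s₁.vreg 1 ≤ B := hqv ▸ (hL q hq).1
    have hvD : ∀ l ∈ D.keys, (s₁.vreg 1 : WithTop α) < D l := hqv ▸ (hL q hq).2
    refine (discardLoop_spec (M := M) (F := F) (Bl := Bl) (B := B) (D := D) _ ?_ ?_).mono ?_
    · simpa [m₁, hm1, Nat.sub_add_cancel hk] using hR
    · simpa using hvD
    rintro s₂ t₂ ⟨m₂, r0', v₂, hle₂, hR₂, htop, ht₂⟩
    simp [m₁, hm1, Nat.sub_add_cancel hk] at m₂ r0' v₂ hle₂ ht₂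
    rw [m₂] at hR₂ htop
    rw [v₂] at htop
    set j := s₂.nreg 2 with hj
    have hvj : s₁.vreg 1 ≤ m'.val 2 j := by
      rcases htop with h | h
      · rw [h, hR₂.hi_zero]; exact hvB
      · exact h.le
    have hcalc : ∀ T P, T + P ≤ pot M k Bl + 100 + 40 * L.length + 1000 +
        (L.length * (42000 * (1 + level M L.length)) + 20) →
        T + P ≤ pot M k Bl + 50000 * (max 1 L.length * (1 + level M L.length)) := by
      intro T P hTP
      rw [max_eq_right hpos]
      have : L.length * 1 ≤ L.length * (1 + level M L.length) := Nat.mul_le_mul_left _ (by omega)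
      rw [show L.length * (42000 * (1 + level M L.length)) =
        42000 * (L.length * (1 + level M L.length)) by ring] at hTP
      omega
    simp only [runs_branch, runs_block_cons, runs_block_nil, runs_setNat, runs_storeNat,
      runs_storeVal, runs_skip]
    refine ⟨fun hsize => ?_, fun hsize => ?_⟩
    · simp [m₂, hm0, ← hj, hR₂.cnt j (by omega)] at hsize
      have hR₃ := hR₂.push (m' := ((((m'.setNat 5 (j + 1) 0).setNat 6 (j + 1) 0).setVal 2 (j + 1)
        (s₁.vreg 1)).setNat 1 1 (j + 2))) (by simp) (by simp) (by simp) (by simp)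
        (fun i hi => by simp [hi.ne])
        (fun i hi => by simp [hi.ne])
        (fun i hi => by simp [hi.ne])
        (by simp) (by simp) (by simpa using hR₂.hi_zero)
        (fun i hi => by simpa using hvj.trans (hR₂.hi_anti i j (by omega) (by omega)))
        (fun i hi x hx hl => by
          have h1 := hR₂.content_key (hR₂.bounds i hi x hx).1 hl
          have h2 := hvD (m'.nat 3 x) (by simp [Content.keys, h1])
          simpa [h1] using h2)
      have hpot : pot M (j + 1 + 1) (Function.update Bl (j + 1) []) = pot M (j + 1) Bl + 1000 := by
        rw [pot_succ, pot_congr (Bl := Bl) fun i hi => Function.update_of_ne (by omega) _ _]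
        simp [blockPot, levelSum]
      refine (addLoop_spec (M := M) (j := j + 1) (F := F) (D := D) (B := B) _ L hM
        (hR₃.congr ?_ ?_ ?_) ?_ ?_ ?_ ?_ ?_ ?_ ?_).mono ?_
      · simp [m₂]
      · simp [m₂, v₂]
        rfl
      · intro a ha ha'
        interval_cases a <;> simp [m₂, ← hj]
      · simp [m₂, hm2]
      · simp [r0', r0]
      · simp [hj]
      · simp
      · simpa [m₂] using hcell
      · simpa [m₂, v₂, ← hj] using fun a b hab => hmax (a, b) hab
      · simp
      rintro s t ⟨F', Bl', hR', hF', e2, e0, e1, hmono, ht⟩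
      simp [m₂, ← hj] at e0 e1
      rw [hpot] at ht
      refine ⟨F', _, ⟨j + 1 + 1, Bl', by omega, hR', e0.trans hm0, e1, e2, ?_, rfl⟩, hF', ?_⟩
      · intro i hi
        refine le_trans ?_ (hmono i (by omega))
        rw [Function.update_of_ne (by omega)]
        by_cases hij : i = j
        · rw [hij]; exact hsize
        · exact hbig i (by omega)
      · apply hcalc
        simp
        omega
    · simp [m₂, hm0, ← hj, hR₂.cnt j (by omega)] at hsize
      refine (addLoop_spec (M := M) (j := j) (F := F) (D := D) (B := B) (Bl := Bl) _ L hM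
        (hR₂.congr ?_ ?_ ?_) ?_ ?_ ?_ ?_ ?_ ?_ ?_).mono ?_
      · simp [m₂]
      · simp [m₂]
      · intro a ha ha'
        simp [m₂, show a ≠ 1 by omega]
      · simp [m₂, hm2]
      · simp [r0', r0]
      · simp [hj]
      · simp
      · simpa [m₂] using hcell
      · simpa [m₂] using fun a b hab => (hmax (a, b) hab).trans hvj
      · exact hsize.le
      rintro s t ⟨F', Bl', hR', hF', e2, e0, e1, hmono, ht⟩
      simp [m₂, ← hj] at e0 e1
      refine ⟨F', _, ⟨j + 1, Bl', by omega, hR', e0.trans hm0, e1, e2, ?_, rfl⟩, hF', ?_⟩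
      · exact fun i hi => (hbig i (by omega)).trans (hmono i (by omega))
      · apply hcalc
        simp
        omega
  · simp [State.entry] at hpos
    subst hpos
    refine ⟨F, _, ⟨k, Bl, hk, ?_, hm0, hm1, hm2, hbig, rfl⟩, by simp, ?_⟩
    · exact hR
    · simp; omega

end

/-! ### Collecting, splitting and removing items -/

section
variable {α : Type u} [LinearOrder α]

theorem seg_eq_cons (W : ℕ → ℕ) (lo n : ℕ) : seg W lo (n + 1) = W lo :: seg W (lo + 1) n := by
  rw [Nat.add_comm n 1, seg_add]
  simp [seg]

theorem collectBody_spec {procs : List Cmd} (s₀ : State α) (l : List ℕ)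
    (hl : IsList (s₀.mem.nat 4) (s₀.nreg 2) l) (hpos : ∀ x ∈ l, 0 < x) :
    Runs procs collectBody s₀ (fun s t => s₀.mem.SameBut (s₀.nreg 1) s.mem ∧
      seg (s.mem.nat 7) (s₀.nreg 1) (s.nreg 0) = l.filter (fun x => decide (s₀.mem.Live x)) ∧
      t ≤ 60 * l.length + 20) := by
  simp only [collectBody, runs_block_cons, runs_setNat]
  refine runs_loop (p := 60 * l.length) (fun s p => ∃ l₁ l₂, l = l₁ ++ l₂ ∧
    IsList (s₀.mem.nat 4) (s.nreg 2) l₂ ∧ s.nreg 1 = s₀.nreg 1 ∧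
    s₀.mem.SameBut (s₀.nreg 1) s.mem ∧ seg (s.mem.nat 7) (s₀.nreg 1) (s.nreg 0) =
      l₁.filter (fun x => decide (s₀.mem.Live x)) ∧ p = 60 * l₂.length) ?_ ?_ ?_
  · exact ⟨[], l, by simp, by simpa using hl, by simp, by simp [Memory.SameBut.refl], by simp, rfl⟩
  · rintro s p ⟨l₁, l₂, rfl, hl₂, h1, hm, hs, rfl⟩ ht
    simp at ht
    rcases l₂ with _ | ⟨x, l₂⟩
    · have : s.nreg 2 = 0 := hl₂
      omega
    obtain ⟨hx, hl₂⟩ := hl₂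
    have e2 := hm.2.1 2 (by omega)
    have e3 := hm.2.1 3 (by omega)
    have e4 := hm.2.1 4 (by omega)
    simp only [runs_block_cons, runs_block_nil, runs_branch, runs_storeNat, runs_setNat, runs_skip]
    refine ⟨fun h => ?_, fun h => ?_⟩
    · simp [hx, e2, e3] at h
      have hlive : s₀.mem.Live x := le_antisymm h.1 h.2
      refine ⟨60 * l₂.length, ⟨l₁ ++ [x], l₂, by simp, ?_, ?_, ?_, ?_, rfl⟩, ?_⟩
      · simpa [Function.update_apply, hx, e4] using hl₂
      · simpa using h1
      · simpa [h1] using hm.setNat (Nat.le_add_right _ _) _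
      · simp
        rw [seg_succ, ← hs, h1]
        simp [hlive, hx]
        refine seg_congr fun i _ hi => Function.update_of_ne (by omega) _ _
      · simp; omega
    · simp [hx, e2, e3] at h
      have hlive : ¬ s₀.mem.Live x := fun h' => by
        rw [Memory.Live] at h'; omega
      refine ⟨60 * l₂.length, ⟨l₁ ++ [x], l₂, by simp, ?_, ?_, hm, ?_, rfl⟩, ?_⟩
      · simpa [hx, e4] using hl₂
      · simpa using h1
      · simpa [hlive] using hs
      · simp; omega
  · rintro s t p ⟨l₁, l₂, rfl, hl₂, h1, hm, hs, rfl⟩ ht htp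
    simp at ht
    rcases l₂ with _ | ⟨x, l₂⟩
    · simp only [runs_block_nil]
      refine ⟨hm, by simpa using hs, ?_⟩
      simp at htp ⊢; omega
    · have := hpos x (by simp)
      have := hl₂.1
      omega

theorem splitBody_spec {B : α} {D : Content α} {F w n k : ℕ} {Bl : ℕ → List ℕ}
    (s₀ : State α) (hD : D.DistinctValues) (hw : s₀.nreg 10 = w) (hn : s₀.nreg 0 = n)
    (hk : s₀.nreg 11 = k) (hn0 : 0 < n)
    (h : Rep B s₀.mem D k F Bl (seg (s₀.mem.nat 7) 0 (w + n)))
    (hle : ∀ x ∈ seg (s₀.mem.nat 7) w n, s₀.mem.val 1 x ≤ s₀.mem.val 2 k)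
    (hanti : ∀ j < k, s₀.mem.val 2 k ≤ s₀.mem.val 2 j)
    (hlt : ∀ j < k, ∀ x ∈ Bl j, s₀.mem.Live x → s₀.mem.val 2 k < s₀.mem.val 1 x) :
    Runs procTable splitBody s₀ (fun s t => ∃ Bl', Rep B s.mem D (k + 2) F Bl' (seg (s.mem.nat 7) 0 w)
      ∧ (∀ i < w, s.mem.nat 7 i = s₀.mem.nat 7 i) ∧ s.mem.nat 1 = s₀.mem.nat 1 ∧
      s.mem.val 1 = s₀.mem.val 1 ∧ (∀ j < k + 1, s.mem.val 2 j = s₀.mem.val 2 j) ∧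
      (∃ x ∈ seg (s₀.mem.nat 7) w n, s.mem.val 2 (k + 1) = s₀.mem.val 1 x) ∧
      s.mem.Live = s₀.mem.Live ∧ (∀ j < k, Bl' j = Bl j) ∧
      (∀ x, x ∈ Bl' k ∨ x ∈ Bl' (k + 1) → x ∈ seg (s₀.mem.nat 7) w n) ∧
      (Bl' k).length = n / 2 ∧ (Bl' (k + 1)).length = (n + 1) / 2 ∧ t ≤ 10200 * n + 200) := by
  set l := seg (s₀.mem.nat 7) w n with hl
  set v := s₀.mem.val 1 with hv
  have hnd : (l.map v).Nodup := by
    have := h.nodup_map_val hD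
    rw [seg_add, Nat.zero_add, List.map_append] at this
    exact (List.nodup_append.1 this).2.1
  simp only [splitBody, runs_block_cons, runs_setNat]
  refine runs_call_one rfl ((selectBody_spec _ ?_ ?_).mono ?_)
  · simpa [Function.update_apply, hw, hn] using hnd
  · simp [hn]; omega
  rintro s₁ t₁ ⟨hm₁, hp, hr, ht₁⟩
  simp [hw, hn] at hm₁ hp hr ht₁
  change s₁.nreg 5 ∈ l at hp
  change rank v l (s₁.nreg 5) = (n - 1) / 2 at hr
  set p := s₁.nreg 5 with hpdef
  simp only [runs_setVal, runs_storeNat, runs_storeVal]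
  have hR₁ : Rep B s₁.mem D k F Bl (seg (s₀.mem.nat 7) 0 (w + n)) := h.sameBut hm₁
  have e7 : ∀ i < w + n, s₁.mem.nat 7 i = s₀.mem.nat 7 i := hm₁.2.2
  have e1 := hm₁.2.1 1 (by omega)
  have e2 := hm₁.2.1 2 (by omega)
  have e3 := hm₁.2.1 3 (by omega)
  have hL₁ : ∀ x, s₁.mem.Live x ↔ s₀.mem.Live x := fun x => by simp [Memory.Live, e2, e3]
  have hvle : ∀ x ∈ l, v x ≤ s₁.mem.val 2 k := by rw [hm₁.1]; exact hle
  have hR₂ := hR₁.push (m' := (s₁.mem.setNat 5 k 0).setNat 6 k 0) (by simp) (by simp) (by simp)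
    (by simp) (fun i hi => by simp [hi.ne]) (fun i hi => by simp [hi.ne]) (fun i hi => by simp)
    (by simp) (by simp) (by simpa using hR₁.hi_zero)
    (by simpa [hm₁.1] using hanti) (by simpa [hm₁.1, hL₁] using hlt)
  have hR₃ := hR₂.push
    (m' := ((((s₁.mem.setNat 5 k 0).setNat 6 k 0).setNat 5 (k + 1) 0).setNat 6 (k + 1) 0).setVal 2
      (k + 1) (v p)) (by simp) (by simp) (by simp) (by simp)
    (fun i hi => by simp [hi.ne]) (fun i hi => by simp [hi.ne])
    (fun i hi => by simp [hi.ne]) (by simp) (by simp) (by simpa using hR₁.hi_zero)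
    (fun i hi => by
      have : s₁.mem.val 2 k ≤ s₁.mem.val 2 i := by
        rcases Nat.lt_succ_iff_lt_or_eq.1 hi with hi | rfl
        · rw [hm₁.1]; exact hanti i hi
        · exact le_rfl
      simpa using (hvle p hp).trans this)
    (fun i hi x hx hl => by
      rcases Nat.lt_succ_iff_lt_or_eq.1 hi with hi | rfl
      · rw [Function.update_of_ne hi.ne] at hx
        have h1 := hlt i hi x hx ((hL₁ x).1 (by simpa [Memory.Live] using hl))
        have h2 := hvle p hp
        simp only [hm₁.1] at h2
        simpa [hm₁.1] using h2.trans_lt h1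
      · simp at hx)
  refine runs_loop (p := 100 * n) (fun s q => ∃ i ≤ n, ∃ Bl', Rep B s.mem D (k + 2) F Bl'
      (seg (s₀.mem.nat 7) 0 w ++ seg (s₀.mem.nat 7) (w + i) (n - i)) ∧
      s.mem.nat 7 = s₁.mem.nat 7 ∧ s.mem.nat 1 = s₀.mem.nat 1 ∧
      s.mem.val 1 = v ∧ s.mem.val 2 = Function.update (s₁.mem.val 2) (k + 1) (v p) ∧
      s.mem.nat 2 = s₀.mem.nat 2 ∧ s.mem.nat 3 = s₀.mem.nat 3 ∧ (∀ j < k, Bl' j = Bl j) ∧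
      (∀ x, x ∈ Bl' k ∨ x ∈ Bl' (k + 1) → x ∈ l) ∧
      (Bl' k).length = (seg (s₀.mem.nat 7) w i).countP (fun x => decide ¬ v x ≤ v p) ∧
      (Bl' (k + 1)).length = (seg (s₀.mem.nat 7) w i).countP (fun x => decide (v x ≤ v p)) ∧
      s.nreg 10 = w ∧ s.nreg 0 = n ∧ s.nreg 4 = i ∧ s.nreg 11 = k ∧ s.nreg 12 = k + 1 ∧
      s.vreg 1 = v p ∧ q = 100 * (n - i)) ?_ ?_ ?_
  · refine ⟨0, Nat.zero_le _, _, (hR₃.congr ?_ ?_ ?_).perm ?_, ?_, ?_, ?_, ?_, ?_, ?_, ?_, ?_, ?_, ?_,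
      ?_, ?_, ?_, ?_, ?_, ?_, rfl⟩
    · simp
    · simp [hk, hm₁.1]
      rfl
    · intro a ha ha'
      interval_cases a <;> simp [hk]
    · rw [seg_add]; simp
    · simp
    · simp [e1]
    · simp [hm₁.1]; rfl
    · simp [hm₁.1, hk]; rfl
    · simp [e2]
    · simp [e3]
    · intro j hj
      rw [Function.update_of_ne (by omega), Function.update_of_ne (by omega)]
    · simp
    · simp
    · simp
    · simpa [Function.update_apply] using hw
    · simpa [Function.update_apply] using hn
    · simp
    · simpa [Function.update_apply] using hk
    · simpa [Function.update_apply] using hk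
    · simp [hm₁.1]; rfl
  · rintro s q ⟨i, hi, Bl', hR, f7, f1, fv1, fv2, f2, f3, hBl, hmem, hlk, hlk1, r10, r0, r4, r11,
      r12, rv, rfl⟩ ht
    simp [r0, r4] at ht
    have hcell : s.mem.nat 7 (w + i) = s₀.mem.nat 7 (w + i) := by rw [f7]; exact e7 _ (by omega)
    set x := s₀.mem.nat 7 (w + i) with hx
    have hxl : x ∈ l := mem_seg.2 ⟨i, ht, rfl⟩
    have hR' := hR
    rw [show n - i = n - (i + 1) + 1 by omega, seg_eq_cons] at hR'
    replace hR' := hR'.perm List.perm_middle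
    simp only [runs_block_cons, runs_block_nil, runs_branch, runs_setNat, linkCode, runs_storeNat]
    refine ⟨fun hb => ?_, fun hb => ?_⟩
    · simp [r10, r4, hcell, fv1, rv] at hb
      have hR₄ := hR'.link (j := k + 1) (by omega) (by simpa [fv1, fv2] using hb)
        (fun i h1 h2 => by omega)
      refine ⟨100 * (n - (i + 1)), ⟨i + 1, ht, _, hR₄.congr ?_ ?_ ?_, ?_, ?_, ?_, ?_, ?_, ?_, ?_, ?_,
        ?_, ?_, ?_, ?_, ?_, ?_, ?_, ?_, rfl⟩, ?_⟩
      · simp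
      · simp
      · intro a ha ha'
        interval_cases a <;> simp [r10, r4, r12, hcell, ← hx]
      · simpa using f7
      · simpa using f1
      · simpa using fv1
      · simpa using fv2
      · simpa using f2
      · simpa using f3
      · intro j hj
        rw [Function.update_of_ne (by omega), hBl j hj]
      · intro y hy
        rw [Function.update_of_ne (by omega), Function.update_self, List.mem_cons] at hy
        rcases hy with hy | rfl | hy
        exacts [hmem y (Or.inl hy), hxl, hmem y (Or.inr hy)]
      · rw [Function.update_of_ne (by omega), hlk, seg_succ, List.countP_append]
        simp [← hx, hb]
      · rw [Function.update_self, List.length_cons, hlk1, seg_succ, List.countP_append]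
        simp [← hx, hb]
      · simpa [Function.update_apply] using r10
      · simpa [Function.update_apply] using r0
      · simp [r4]
      · simpa [Function.update_apply] using r11
      · simpa [Function.update_apply] using r12
      · simpa using rv
      · simp; omega
    · simp [r10, r4, hcell, fv1, rv] at hb
      have hR₄ := hR'.link (j := k) (by omega) (by simpa [fv1, fv2] using hvle x hxl)
        (fun i h1 h2 => by
          obtain rfl : i = k + 1 := by omega
          simpa [fv1, fv2] using hb)
      refine ⟨100 * (n - (i + 1)), ⟨i + 1, ht, _, hR₄.congr ?_ ?_ ?_, ?_, ?_, ?_, ?_, ?_, ?_, ?_, ?_,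
        ?_, ?_, ?_, ?_, ?_, ?_, ?_, ?_, rfl⟩, ?_⟩
      · simp
      · simp
      · intro a ha ha'
        interval_cases a <;> simp [r10, r4, r11, hcell, ← hx]
      · simpa using f7
      · simpa using f1
      · simpa using fv1
      · simpa using fv2
      · simpa using f2
      · simpa using f3
      · intro j hj
        rw [Function.update_of_ne (by omega), hBl j hj]
      · intro y hy
        rw [Function.update_self, Function.update_of_ne (by omega), List.mem_cons] at hy
        rcases hy with (rfl | hy) | hy
        exacts [hxl, hmem y (Or.inl hy), hmem y (Or.inr hy)]
      · rw [Function.update_self, List.length_cons, hlk, seg_succ, List.countP_append]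
        simp [← hx, hb]
      · rw [Function.update_of_ne (by omega), hlk1, seg_succ, List.countP_append]
        simp [← hx, hb]
      · simpa [Function.update_apply] using r10
      · simpa [Function.update_apply] using r0
      · simp [r4]
      · simpa [Function.update_apply] using r11
      · simpa [Function.update_apply] using r12
      · simpa using rv
      · simp; omega
  · rintro s t q ⟨i, hi, Bl', hR, f7, f1, fv1, fv2, f2, f3, hBl, hmem, hlk, hlk1, r10, r0, r4, r11,
      r12, rv, rfl⟩ ht htp
    simp [r0, r4] at ht
    obtain rfl : i = n := by omega
    simp only [runs_block_nil]
    have hw7 : ∀ j < w, s.mem.nat 7 j = s₀.mem.nat 7 j := fun j hj => by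
      rw [f7]; exact e7 j (by omega)
    have hc1 := countP_le_eq_rank_add_one hnd hp
    have hc2 := l.length_eq_countP_add_countP (fun x => decide (v x ≤ v p))
    simp only [decide_eq_true_eq] at hc2
    have hll : l.length = i := length_seg ..
    change _ = l.countP _ at hlk
    change _ = l.countP _ at hlk1
    refine ⟨Bl', ?_, hw7, f1, fv1, ?_, ⟨p, hp, ?_⟩, ?_, hBl, hmem, ?_, ?_, ?_⟩
    · rw [seg_congr (W := s₀.mem.nat 7) fun j _ hj => hw7 j (by omega)]
      simpa using hR
    · intro j hj
      rw [fv2, Function.update_of_ne (by omega), hm₁.1]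
    · rw [fv2, Function.update_self]
    · funext x; simp [Memory.Live, f2, f3]
    · omega
    · omega
    · simp at htp ⊢; omega

end

/-! ### Output -/

theorem State.output_eq_seg {α : Type u} (s : State α) :
    s.output = seg (s.mem.nat 0) 0 (s.nreg 0) := by
  simp [State.output, seg]

theorem Content.remove_remove {α : Type u} (D : Content α) (S T : Finset ℕ) :
    (D.remove S).remove T = D.remove (S ∪ T) := by
  funext k
  simp only [Content.remove, Finset.mem_union]
  by_cases h1 : k ∈ S <;> by_cases h2 : k ∈ T <;> simp [h1, h2]

section
variable {α : Type u} [LinearOrder α]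

/-- The items that are kept go to block `j`, which is empty when this is used. -/
theorem outputBody_spec {M : ℕ} {B : α} {D : Content α} {F w j : ℕ} {Bl : ℕ → List ℕ}
    (s₀ : State α) (hw : s₀.nreg 10 = w) (hj : s₀.nreg 11 = j) (hM : s₀.mem.nat 1 0 = M)
    (h : Rep B s₀.mem D (j + 1) F Bl (seg (s₀.mem.nat 7) 0 w))
    (hle : M < w → ∀ x ∈ seg (s₀.mem.nat 7) 0 w, s₀.mem.val 1 x ≤ s₀.mem.val 2 j) :
    Runs procTable outputBody s₀ (fun s t => ∃ Bl',
      s.output = ((seg (s₀.mem.nat 7) 0 w).filter fun x =>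
        decide ¬ (M < w ∧ s₀.vreg 0 ≤ s₀.mem.val 1 x)).map (s₀.mem.nat 3) ∧
      Rep B s.mem (D.remove s.output.toFinset) (j + 1) F Bl' [] ∧ s.mem.nat 1 = s₀.mem.nat 1 ∧
      (∀ i < j, Bl' i = Bl i) ∧ (Bl' j).length = (Bl j).length +
        (seg (s₀.mem.nat 7) 0 w).countP (fun x => decide (M < w ∧ s₀.vreg 0 ≤ s₀.mem.val 1 x)) ∧
      t ≤ 100 * w + 20) := by
  simp only [State.output_eq_seg]
  set W := s₀.mem.nat 7 with hW
  set v := s₀.mem.val 1 with hv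
  simp only [outputBody, runs_block_cons, runs_setNat]
  refine runs_loop (p := 100 * w) (fun s p => ∃ i ≤ w, ∃ Bl',
      seg (s.mem.nat 0) 0 (s.nreg 0) = ((seg W 0 i).filter fun x =>
        decide ¬ (M < w ∧ s₀.vreg 0 ≤ v x)).map (s₀.mem.nat 3) ∧
      Rep B s.mem (D.remove (seg (s.mem.nat 0) 0 (s.nreg 0)).toFinset) (j + 1) F Bl'
        (seg W i (w - i)) ∧
      s.mem.nat 1 = s₀.mem.nat 1 ∧ s.mem.nat 3 = s₀.mem.nat 3 ∧ s.mem.nat 7 = W ∧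
      s.mem.val 1 = v ∧ s.mem.val 2 = s₀.mem.val 2 ∧ (∀ i < j, Bl' i = Bl i) ∧
      (Bl' j).length = (Bl j).length +
        (seg W 0 i).countP (fun x => decide (M < w ∧ s₀.vreg 0 ≤ v x)) ∧
      s.nreg 10 = w ∧ s.nreg 11 = j ∧ s.nreg 4 = i ∧ s.vreg 0 = s₀.vreg 0 ∧
      p = 100 * (w - i)) ?_ ?_ ?_
  · refine ⟨0, Nat.zero_le _, Bl, by simp, ?_, rfl, rfl, rfl, rfl, rfl, fun _ _ => rfl, by simp, ?_,
      ?_, by simp, rfl, rfl⟩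
    · have : D.remove ∅ = D := by funext k; simp [Content.remove]
      simpa [this] using h
    · simpa using hw
    · simpa using hj
  · rintro s p ⟨i, hi, Bl', hout, hR, f1, f3, f7, fv1, fv2, hBl, hlen, r10, r11, r4, rv, rfl⟩ ht
    simp [r10, r4] at ht
    set x := W i with hx
    have hxW : x ∈ seg W 0 w := mem_seg.2 ⟨i, ht, by simp [hx]⟩
    rw [show w - i = w - (i + 1) + 1 by omega, seg_eq_cons, ← hx] at hR
    have hseg : seg W 0 (i + 1) = seg W 0 i ++ [x] := by rw [seg_succ, Nat.zero_add]
    simp only [runs_block_cons, runs_block_nil, runs_branch, runs_setNat, linkCode, runs_storeNat]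
    refine ⟨fun hb => ?_, fun hb => ?_⟩
    · simp [r10, r4, f7, f1, hM, fv1, rv, ← hx] at hb
      have hkeep : M < w ∧ s₀.vreg 0 ≤ v x := ⟨by omega, hb.2⟩
      have hR' := hR.link (j := j) (by omega) (by rw [fv1, fv2]; exact hle hkeep.1 x hxW)
        (fun i h1 h2 => by omega)
      refine ⟨100 * (w - (i + 1)), ⟨i + 1, ht, Function.update Bl' j (x :: Bl' j), ?_,
        hR'.congr ?_ ?_ ?_, ?_, ?_, ?_, ?_, ?_, ?_, ?_, ?_, ?_, ?_, ?_, rfl⟩, ?_⟩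
      · rw [hseg]
        simp [hkeep] at hout ⊢
        exact hout
      · simp
      · simp
      · intro a ha ha'
        interval_cases a <;> simp [r4, r11, f7, ← hx]
      · simpa using f1
      · simpa using f3
      · simpa using f7
      · simpa using fv1
      · simpa using fv2
      · intro i' hi'
        rw [Function.update_of_ne (by omega), hBl i' hi']
      · rw [Function.update_self, List.length_cons, hlen, hseg, List.countP_append]
        simp [hkeep]
        omega
      · simpa [Function.update_apply] using r10
      · simpa [Function.update_apply] using r11
      · simp [r4]
      · simpa using rv
      · simp; omega
    · simp [r10, r4, f7, f1, hM, fv1, rv, ← hx] at hb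
      have hkeep : ¬ (M < w ∧ s₀.vreg 0 ≤ v x) := fun h => by
        rcases hb with hb | hb
        · omega
        · exact hb.not_ge h.2
      have hR' := hR.remove
      rw [Content.remove_remove, f3] at hR'
      refine ⟨100 * (w - (i + 1)), ⟨i + 1, ht, Bl', ?_,
        ?_, ?_, ?_, ?_, ?_, ?_, hBl, ?_, ?_, ?_, ?_, ?_, rfl⟩, ?_⟩
      rotate_left
      · have hset : (seg (Function.update (s.mem.nat 0) (s.nreg 0) (s₀.mem.nat 3 x)) 0
            (s.nreg 0 + 1)).toFinset =
            (seg (s.mem.nat 0) 0 (s.nreg 0)).toFinset ∪ {s₀.mem.nat 3 x} := by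
          rw [seg_succ, Nat.zero_add, Function.update_self, List.toFinset_append,
            seg_congr (W := s.mem.nat 0) fun j _ hj => Function.update_of_ne (by omega) _ _]
          simp
        simp [r4, f7, f3, ← hx]
        rw [hset]
        refine hR'.congr ?_ ?_ ?_
        · simp
        · simp
        · intro a ha ha'
          interval_cases a <;> simp [f3]
      · simpa using f1
      · simpa using f3
      · simpa using f7
      · simpa using fv1
      · simpa using fv2
      · rw [hlen, hseg, List.countP_append]
        simp [hkeep]
      · simpa [Function.update_apply] using r10
      · simpa [Function.update_apply] using r11
      · simp [r4]
      · simpa using rv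
      · simp; omega
      · have hfx : [x].filter (fun x => decide ¬ (M < w ∧ s₀.vreg 0 ≤ v x)) = [x] := by
          simp only [List.filter_cons, List.filter_nil, decide_eq_true hkeep, if_true]
        simp only [hseg, List.filter_append, List.map_append, ← hout, hfx]
        simp only [Function.update_apply, NExp.eval, Memory.setNat_nat]
        simp [r4, f7, f3, ← hx]
        rw [seg_succ, Nat.zero_add, Function.update_self,
          seg_congr (W := s.mem.nat 0) fun j _ hj => Function.update_of_ne (by omega) _ _]
  · rintro s t p ⟨i, hi, Bl', hout, hR, f1, f3, f7, fv1, fv2, hBl, hlen, r10, r11, r4, rv, rfl⟩ ht htp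
    simp [r10, r4] at ht
    obtain rfl : i = w := by omega
    simp only [runs_block_nil]
    refine ⟨Bl', hout, by simpa using hR, f1, hBl, hlen, ?_⟩
    simp at htp ⊢; omega

namespace Rep

variable {B : α} {m : Memory α} {D : Content α} {k F : ℕ} {Bl : ℕ → List ℕ} {W : List ℕ}

theorem keys_finite (h : Rep B m D k F Bl W) : D.keys.Finite := by
  refine ((Finset.range (F + 1)).image (m.nat 3)).finite_toSet.subset fun a ha => ?_
  simp only [Content.keys, Set.mem_ofPred_eq, h.content a, ne_eq, ite_eq_left_iff, not_forall] at ha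
  obtain ⟨ha, -⟩ := ha
  obtain ⟨h1, h2⟩ := h.cover a ha
  simp only [Finset.coe_image, Finset.coe_range, Set.mem_image, Set.mem_Iio]
  refine ⟨_, ?_, h1⟩
  rcases h2 with h2 | ⟨j, hj, h2⟩
  · have := (h.work _ h2).2.1; omega
  · have := (h.bounds j hj _ h2).2; omega

/-- Different live items have different keys. -/
theorem nodup_map_key (h : Rep B m D k F Bl W) : (W.map (m.nat 3)).Nodup :=
  h.work_nodup.map_on fun x hx y hy hxy => by
    rw [← (h.work x hx).2.2.1, ← (h.work y hy).2.2.1, hxy]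

/-- A key that is present belongs to a live item. -/
theorem exists_item (h : Rep B m D k F Bl W) {a : ℕ} (ha : a ∈ D.keys) :
    ∃ x, m.nat 3 x = a ∧ D a = m.val 1 x ∧ m.Live x ∧ (x ∈ W ∨ ∃ j < k, x ∈ Bl j) := by
  have h0 : m.nat 2 a ≠ 0 := fun h0 => ha (by rw [h.content a, if_pos h0])
  obtain ⟨h1, h2⟩ := h.cover a h0
  exact ⟨_, h1, by rw [h.content a, if_neg h0], by simp [Memory.Live, h1], h2⟩

/-- If no blocks and at most `M` items are left, a pull returns everything. -/
theorem pullCorrect_all (h : Rep B m D 0 F Bl W) {M : ℕ} (hW : W.length ≤ M) :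
    PullCorrect M B D (W.map (m.nat 3)) B := by
  have hkeys : D.keys = ((W.map (m.nat 3)).toFinset : Set ℕ) := by
    ext a
    simp only [List.coe_toFinset, List.mem_map, Set.mem_ofPred_eq]
    constructor
    · intro ha
      obtain ⟨x, h1, -, -, h2 | ⟨j, hj, -⟩⟩ := h.exists_item ha
      · exact ⟨x, h2, h1⟩
      · omega
    · rintro ⟨x, hx, rfl⟩
      have := h.content_key (h.work x hx).1 (h.work x hx).2.2.1
      simp [Content.keys, this]
  have hmem : ∀ a, a ∈ D.keys ↔ a ∈ W.map (m.nat 3) := fun a => by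
    rw [hkeys, Finset.mem_coe, List.mem_toFinset]
  refine ⟨h.nodup_map_key, fun a ha => (hmem a).2 ha, ?_, fun _ _ l hl hl' =>
    absurd ((hmem l).1 hl) hl', fun _ => rfl, fun hne => absurd ?_ hne⟩
  · rw [hkeys, Set.ncard_coe_finset, List.toFinset_card_of_nodup h.nodup_map_key, List.length_map,
      min_eq_right hW]
  · ext a
    simp only [Content.keys, Content.remove, List.mem_toFinset, Set.mem_ofPred_eq,
      Set.mem_empty_iff_false, iff_false, not_not]
    by_cases ha : a ∈ W.map (m.nat 3)
    · rw [if_pos ha]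
    · rw [if_neg ha]
      by_contra h'
      exact ha ((hmem a).1 h')

/-- If the items in `W` are smaller than all others, the item `p` of rank `M` among them separates the
result of a pull from the rest. -/
theorem pullCorrect_rank (h : Rep B m D k F Bl W) {M p : ℕ} (hp : p ∈ W)
    (hr : rank (m.val 1) W p = M)
    (hlt : ∀ x ∈ W, ∀ j < k, ∀ y ∈ Bl j, m.Live y → m.val 1 x < m.val 1 y) :
    PullCorrect M B D ((W.filter fun x => decide (m.val 1 x < m.val 1 p)).map (m.nat 3))
      (m.val 1 p) := by
  have hkey : ∀ x ∈ W, D (m.nat 3 x) = m.val 1 x := fun x hx =>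
    h.content_key (h.work x hx).1 (h.work x hx).2.2.1
  have hin : ∀ x ∈ W, m.nat 3 x ∈ D.keys := fun x hx => by simp [Content.keys, hkey x hx]
  have hmem : ∀ a, a ∈ (W.filter fun x => decide (m.val 1 x < m.val 1 p)).map (m.nat 3) ↔
      ∃ x ∈ W, m.val 1 x < m.val 1 p ∧ m.nat 3 x = a := by
    intro a; simp [and_assoc]
  have hrest : ∀ a ∈ D.keys,
      a ∉ (W.filter fun x => decide (m.val 1 x < m.val 1 p)).map (m.nat 3) →
      (m.val 1 p : WithTop α) ≤ D a := by
    intro a ha ha'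
    rw [hmem] at ha'
    obtain ⟨y, h1, h2, h3, h4⟩ := h.exists_item ha
    rw [h2, WithTop.coe_le_coe]
    rcases h4 with h4 | ⟨j, hj, h4⟩
    · exact not_lt.1 fun h5 => ha' ⟨y, h4, h5, h1⟩
    · exact (hlt p hp j hj y h4 h3).le
  refine ⟨(List.filter_sublist.map _).nodup h.nodup_map_key, ?_, ?_, ?_, ?_, ?_⟩
  · intro a ha
    obtain ⟨x, hx, -, rfl⟩ := (hmem a).1 ha
    exact hin x hx
  · rw [List.length_map]
    change rank _ _ _ = _
    rw [hr, min_eq_left]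
    have h1 : (W.map (m.nat 3)).toFinset.card ≤ D.keys.ncard := by
      rw [← Set.ncard_coe_finset]
      refine Set.ncard_le_ncard (fun a ha => ?_) h.keys_finite
      obtain ⟨x, hx, rfl⟩ := List.mem_map.1 (List.mem_toFinset.1 (Finset.mem_coe.1 ha))
      exact hin x hx
    rw [List.toFinset_card_of_nodup h.nodup_map_key, List.length_map] at h1
    have := rank_lt_length (v := m.val 1) hp
    omega
  · intro a ha l hl hl'
    obtain ⟨x, hx, hxp, rfl⟩ := (hmem a).1 ha
    refine le_trans ?_ (hrest l hl hl')
    rw [hkey x hx]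
    exact WithTop.coe_le_coe.2 hxp.le
  · intro he
    have : m.nat 3 p ∈ (D.remove ((W.filter fun x =>
        decide (m.val 1 x < m.val 1 p)).map (m.nat 3)).toFinset).keys := by
      have h1 : m.nat 3 p ∉ (W.filter fun x => decide (m.val 1 x < m.val 1 p)).map (m.nat 3) := by
        rw [hmem]
        rintro ⟨x, hx, hxp, he⟩
        have h2 := hkey x hx
        rw [he, hkey p hp, WithTop.coe_inj] at h2
        exact hxp.ne h2.symm
      simp only [Content.keys, Content.remove, List.mem_toFinset, Set.mem_ofPred_eq, if_neg h1]
      exact hin p hp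
    rw [he] at this
    exact absurd this (Set.notMem_empty _)
  · intro _
    constructor
    · intro a ha
      obtain ⟨x, hx, hxp, rfl⟩ := (hmem a).1 ha
      rw [hkey x hx]
      exact WithTop.coe_lt_coe.2 hxp
    · intro l hl
      simp only [Content.keys, Content.remove, List.mem_toFinset, Set.mem_ofPred_eq] at hl ⊢
      split_ifs at hl ⊢ with h1
      · exact absurd rfl hl
      · exact hrest l hl h1

end Rep

end

/-! ### Pull -/

section
variable {α : Type u} [LinearOrder α]

/-- During a pull, the first `w` cells of the work space hold the live items of the blocks that have
been taken from the stack, and `k` blocks are left. By `rest`, a new block with the old bound of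
block `k` can take collected items if there are more than `M` of them. -/
structure Gathered (M : ℕ) (B : α) (D : Content α) (F : ℕ) (m : Memory α) (w k : ℕ)
    (Bl : ℕ → List ℕ) : Prop where
  rep : Rep B m D k F Bl (seg (m.nat 7) 0 w)
  size : m.nat 1 0 = M
  count : m.nat 1 2 = F
  le : w ≤ 3 * M
  le_hi : ∀ x ∈ seg (m.nat 7) 0 w, ∀ j < k, m.val 1 x ≤ m.val 2 j
  lt : ∀ x ∈ seg (m.nat 7) 0 w, ∀ j < k, ∀ y ∈ Bl j, m.Live y → m.val 1 x < m.val 1 y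
  rest : M < w → (∀ x ∈ seg (m.nat 7) 0 w, m.val 1 x ≤ m.val 2 k) ∧
    (∀ j < k, ∀ y ∈ Bl j, m.Live y → m.val 2 k < m.val 1 y) ∧
    (∀ j < k, m.val 2 k ≤ m.val 2 j) ∧ ∀ j < k, M ≤ (Bl j).length
  big : ∀ j, j + 1 < k → M ≤ (Bl j).length

/-- If the block has `n` live items and `n ≤ 2M`, its potential pays for collecting them. Otherwise,
by `levelSum_half`, the split releases potential for `n - M ≥ n / 2` units. -/
theorem gatherBody_spec {M : ℕ} {B : α} {D : Content α} {F w k : ℕ} {Bl : ℕ → List ℕ}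
    (s₀ : State α) (hM : 0 < M) (hD : D.DistinctValues) (h : Gathered M B D F s₀.mem w (k + 1) Bl)
    (h10 : s₀.nreg 10 = w) (h11 : s₀.nreg 11 = k + 1) (hw : w ≤ M) :
    Runs procTable gatherBody s₀ (fun s t => ∃ Bl',
      Gathered M B D F s.mem (s.nreg 10) (s.nreg 11) Bl' ∧ s.vreg = s₀.vreg ∧
      t + 20 + pot M (s.nreg 11) Bl' ≤ pot M (k + 1) Bl) := by
  obtain ⟨hR, f0, f2, -, hA, hB, -, hbig⟩ := h
  simp only [gatherBody, runs_block_cons, runs_setNat]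
  refine runs_call_one rfl ((collectBody_spec _ (Bl k) ?_ ?_).mono ?_)
  · simpa [Function.update_apply, h11] using hR.list k (by omega)
  · exact fun x hx => (hR.bounds k (by omega) x hx).1
  rintro s₁ t₁ ⟨hm, hseg, ht₁⟩
  simp [h10] at hm hseg
  set n := s₁.nreg 0 with hn
  set l := (Bl k).filter (fun x => decide (s₀.mem.Live x)) with hl
  set v := s₀.mem.val 1 with hv
  have hnl : n ≤ (Bl k).length := by
    have h1 := congrArg List.length hseg
    rw [length_seg] at h1
    rw [h1]
    exact List.length_filter_le ..
  have e1 := hm.2.1 1 (by omega)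
  have e2 := hm.2.1 2 (by omega)
  have e3 := hm.2.1 3 (by omega)
  have hLive : s₁.mem.Live = s₀.mem.Live := by funext x; simp [Memory.Live, e2, e3]
  have h0w : seg (s₁.mem.nat 7) 0 w = seg (s₀.mem.nat 7) 0 w := hm.seg_eq (by omega)
  have hall : seg (s₁.mem.nat 7) 0 (w + n) = seg (s₀.mem.nat 7) 0 w ++ l := by
    rw [seg_add, Nat.zero_add, h0w, hseg]
  have hml : ∀ x ∈ l, x ∈ Bl k ∧ s₀.mem.Live x := fun x hx => by simpa [hl] using hx
  have hR₁ : Rep B s₁.mem D k F Bl (seg (s₁.mem.nat 7) 0 (w + n)) := by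
    rw [hall]; exact hR.pop.sameBut hm
  have hlhi : ∀ x ∈ l, v x ≤ s₀.mem.val 2 k := fun x hx =>
    hR.le_hi k (by omega) x (hml x hx).1 (hml x hx).2
  have hhi : ∀ j < k, ∀ y ∈ Bl j, s₀.mem.Live y → s₀.mem.val 2 k < v y := fun j hj y hy hy' =>
    hR.hi_lt j k hj (by omega) y hy hy'
  have hanti : ∀ j < k, s₀.mem.val 2 k ≤ s₀.mem.val 2 j := fun j hj =>
    hR.hi_anti j k hj.le (by omega)
  have hmem : ∀ x ∈ seg (s₁.mem.nat 7) 0 (w + n), v x ≤ s₀.mem.val 2 k := by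
    intro x hx
    rw [hall, List.mem_append] at hx
    exact hx.elim (fun hx => hA x hx k (by omega)) (hlhi x)
  rw [pot_succ, blockPot]
  have hsum := levelSum_mono (M := M) hnl
  refine runs_branch.2 ⟨fun hb => ?_, fun hb => ?_⟩
  · simp [e1, f0] at hb
    simp only [runs_setNat, runs_block_nil]
    simp [h10, h11]
    refine ⟨Bl, ⟨hR₁, by rw [e1, f0], by rw [e1, f2], by omega, ?_, ?_, fun _ => ⟨?_, ?_, ?_, ?_⟩,
      fun j hj => hbig j (by omega)⟩, ?_⟩
    · intro x hx j hj
      rw [hm.1]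
      exact (hmem x hx).trans (hanti j hj)
    · intro x hx j hj y hy hy'
      rw [hm.1]
      rw [hLive] at hy'
      exact (hmem x hx).trans_lt (hhi j hj y hy hy')
    · rwa [hm.1]
    · rwa [hm.1, hLive]
    · rwa [hm.1]
    · exact fun j hj => hbig j (by omega)
    · omega
  · simp [e1, f0] at hb
    rw [runs_block_cons]
    refine runs_call_none rfl ((splitBody_spec (w := w) (n := n) (k := k) (F := F) (Bl := Bl)
      (D := D) (B := B) _ hD ?_ ?_ ?_ ?_ ?_ ?_ ?_ ?_).mono ?_)
    · simpa [Function.update_apply] using h10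
    · simp [hn]
    · simp [h11]
    · omega
    · exact hR₁
    · change ∀ x ∈ seg (s₁.mem.nat 7) w n, s₁.mem.val 1 x ≤ s₁.mem.val 2 k
      rw [hseg, hm.1]
      exact hlhi
    · change ∀ j < k, s₁.mem.val 2 k ≤ s₁.mem.val 2 j
      rwa [hm.1]
    · change ∀ j < k, ∀ x ∈ Bl j, s₁.mem.Live x → s₁.mem.val 2 k < s₁.mem.val 1 x
      rwa [hm.1, hLive]
    rintro s₂ t₂ ⟨Bl', hR₂, g7, g1, gv1, gv2, ⟨p, hp, hhik⟩, gL, hBl, hin, hlen, hlen', ht₂⟩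
    change s₂.mem.nat 1 = s₁.mem.nat 1 at g1
    change s₂.mem.val 1 = s₁.mem.val 1 at gv1
    change s₂.mem.Live = s₁.mem.Live at gL
    change ∀ j < k + 1, s₂.mem.val 2 j = s₁.mem.val 2 j at gv2
    change s₂.mem.val 2 (k + 1) = s₁.mem.val 1 p at hhik
    change p ∈ seg (s₁.mem.nat 7) w n at hp
    change ∀ x, x ∈ Bl' k ∨ x ∈ Bl' (k + 1) → x ∈ seg (s₁.mem.nat 7) w n at hin
    change ∀ i < w, s₂.mem.nat 7 i = s₁.mem.nat 7 i at g7
    rw [hseg] at hp hin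
    rw [hm.1] at hhik gv1 gv2
    rw [hLive] at gL
    have h2w : seg (s₂.mem.nat 7) 0 w = seg (s₀.mem.nat 7) 0 w := by
      rw [← h0w]; exact seg_congr fun i _ hi => g7 i (by omega)
    have hhalf := levelSum_half hM n
    simp only [runs_block_nil]
    simp [h10, h11]
    refine ⟨Bl', ⟨hR₂, by rw [g1, e1, f0], by rw [g1, e1, f2], by omega, ?_, ?_,
      fun _ => by omega, ?_⟩, ?_⟩
    · rw [h2w, gv1]
      intro x hx j hj
      rcases Nat.lt_succ_iff_lt_or_eq.1 hj with hj | rfl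
      · rw [gv2 j hj]
        exact hA x hx j hj
      · rw [hhik]
        exact (hB x hx k (by omega) p (hml p hp).1 (hml p hp).2).le
    · rw [h2w, gv1, gL]
      intro x hx j hj y hy hy'
      rcases Nat.lt_or_ge j k with hj' | hj'
      · rw [hBl j hj'] at hy
        exact hB x hx j (by omega) y hy hy'
      · have hy2 : y ∈ l := by
          obtain rfl | rfl : j = k ∨ j = k + 1 := by omega
          exacts [hin y (Or.inl hy), hin y (Or.inr hy)]
        exact hB x hx k (by omega) y (hml y hy2).1 hy'
    · intro j hj
      rcases Nat.lt_or_ge j k with hj' | hj'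
      · rw [hBl j hj']
        exact hbig j (by omega)
      · obtain rfl : j = k := by omega
        rw [hlen]
        omega
    · rw [pot_succ, pot_succ, pot_congr hBl, hlen, hlen', blockPot, blockPot]
      clear * - hhalf hsum hnl ht₁ ht₂ hb
      have : (n + 1) / 2 + n / 2 = n := by omega
      omega

/-- Either everything has been collected, at most `M` items, and all of it is returned; or more than
`M` items have been collected, which are smaller than all others. -/
theorem boundCode_spec {M : ℕ} {B : α} {D : Content α} {F w k : ℕ} {Bl : ℕ → List ℕ}
    (s₀ : State α) (hD : D.DistinctValues) (h : Gathered M B D F s₀.mem w k Bl)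
    (h10 : s₀.nreg 10 = w) (hk : M < w ∨ k = 0) (hv : s₀.vreg 1 = B) :
    Runs procTable boundCode s₀ (fun s t => Gathered M B D F s.mem w k Bl ∧ s.nreg 10 = w ∧
      s.nreg 11 = s₀.nreg 11 ∧
      PullCorrect M B D (((seg (s.mem.nat 7) 0 w).filter fun x =>
        decide ¬ (M < w ∧ s.vreg 0 ≤ s.mem.val 1 x)).map (s.mem.nat 3)) (s.vreg 0) ∧
      ((seg (s.mem.nat 7) 0 w).filter fun x =>
        decide ¬ (M < w ∧ s.vreg 0 ≤ s.mem.val 1 x)).length = min M w ∧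
      t ≤ 30000 * min M w + 100) := by
  have f0 := h.size
  rw [boundCode, runs_branch]
  refine ⟨fun hb => ?_, fun hb => ?_⟩
  · simp [h10, f0] at hb
    obtain rfl : k = 0 := by omega
    rw [runs_setVal]
    have hf : ((seg (s₀.mem.nat 7) 0 w).filter fun x =>
        decide ¬ (M < w ∧ B ≤ s₀.mem.val 1 x)) = seg (s₀.mem.nat 7) 0 w :=
      List.filter_eq_self.2 fun x _ => by simp; omega
    refine ⟨h, h10, rfl, ?_, ?_, ?_⟩
    · simp only [Function.update_self, VExp.eval, hv, hf]
      exact h.rep.pullCorrect_all (by rwa [length_seg])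
    · simp only [Function.update_self, VExp.eval, hv, hf, length_seg]
      omega
    · simp
  · simp [h10, f0] at hb
    simp only [runs_block_cons, runs_setNat]
    refine runs_call_one rfl ((selectBody_spec _ ?_ ?_).mono ?_)
    · simpa [Function.update_apply, h10] using h.rep.nodup_map_val hD
    · simpa [Function.update_apply, h10, f0] using hb
    rintro s₁ t₁ ⟨hm, hp, hr, ht₁⟩
    simp [h10, f0] at hm hp hr ht₁
    simp only [runs_setVal, runs_block_nil]
    set p := s₁.nreg 5 with hpdef
    have e2 := hm.2.1 2 (by omega)
    have e3 := hm.2.1 3 (by omega)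
    have hLive : s₁.mem.Live = s₀.mem.Live := by funext x; simp [Memory.Live, e2, e3]
    have hs : seg (s₁.mem.nat 7) 0 w = seg (s₀.mem.nat 7) 0 w := hm.seg_eq (by omega)
    have hf : ((seg (s₀.mem.nat 7) 0 w).filter fun x =>
        decide ¬ (M < w ∧ s₀.mem.val 1 p ≤ s₀.mem.val 1 x)) =
        (seg (s₀.mem.nat 7) 0 w).filter fun x => decide (s₀.mem.val 1 x < s₀.mem.val 1 p) := by
      refine List.filter_congr fun x _ => ?_
      simp [hb]
    have hG : Gathered M B D F s₁.mem w k Bl := by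
      refine ⟨?_, ?_, ?_, h.le, ?_, ?_, ?_, h.big⟩
      · rw [hs]; exact h.rep.sameBut hm
      · rw [hm.2.1 1 (by omega)]; exact h.size
      · rw [hm.2.1 1 (by omega)]; exact h.count
      · rw [hs, hm.1]; exact h.le_hi
      · rw [hs, hm.1, hLive]; exact h.lt
      · rw [hs, hm.1, hLive]; exact h.rest
    refine ⟨hG, ?_, ?_, ?_, ?_, ?_⟩
    · simpa [Function.update_apply] using h10
    · simp
    · simp [hs, e3, hm.1] at hf ⊢
      rw [hf]
      exact h.rep.pullCorrect_rank hp hr h.lt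
    · simp [hs, hm.1] at hf ⊢
      rw [hf]
      refine Eq.trans hr ?_
      omega
    · have := h.le
      simp
      omega

theorem pullCode_spec {M : ℕ} {B : α} {m : Memory α} {D : Content α} {F p : ℕ} (hM : 0 < M)
    (h : Inv M B m D F p) (hD : D.DistinctValues) :
    Runs procTable pullCode (State.entry B 0 B m) (fun s t => ∃ p',
      Inv M B s.mem (D.remove s.output.toFinset) F p' ∧
      PullCorrect M B D s.output (s.vreg 0) ∧ t + p' ≤ p + 200000 * max 1 s.output.length) := by
  obtain ⟨k, Bl, hk, hR, hm0, hm1, hm2, hbig, rfl⟩ := h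
  simp only [pullCode, runs_block_cons, runs_setNat]
  refine runs_loop (p := pot M k Bl) (fun s p => ∃ Bl',
    Gathered M B D F s.mem (s.nreg 10) (s.nreg 11) Bl' ∧ s.vreg 1 = B ∧
      p = pot M (s.nreg 11) Bl') ?_ ?_ ?_
  · refine ⟨Bl, ⟨?_, ?_, ?_, ?_, ?_, ?_, ?_, ?_⟩, ?_, ?_⟩ <;>
      simp [State.entry, hm0, hm1, hm2]
    · exact hR
    · exact hbig
  · rintro s _ ⟨Bl', hG, hv, rfl⟩ hb
    simp [hG.size] at hb
    obtain ⟨j, hj⟩ := Nat.exists_eq_succ_of_ne_zero (show s.nreg 11 ≠ 0 by omega)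
    rw [hj] at hG ⊢
    refine (gatherBody_spec s hM hD hG rfl hj hb.1).mono ?_
    rintro s' t ⟨Bl'', hG', hv', ht⟩
    refine ⟨_, ⟨Bl'', hG', by rw [hv', hv], rfl⟩, ?_⟩
    simp
    omega
  · rintro s t _ ⟨Bl₁, hG, hv, rfl⟩ hb ht
    have hkw : M < s.nreg 10 ∨ s.nreg 11 = 0 := by
      simp [hG.size] at hb
      omega
    refine (boundCode_spec s hD hG rfl hkw hv).mono ?_
    rintro s₁ t₁ ⟨hG₁, h10, h11, hcorrect, hlen, ht₁⟩
    set w := s.nreg 10 with hw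
    set j := s.nreg 11 with hj
    simp only [runs_storeNat]
    have hsmall : ¬ M < w → j = 0 := fun h => hkw.resolve_left h
    have hR₂ := hG₁.rep.push (m' := (s₁.mem.setNat 5 j 0).setNat 6 j 0) (by simp) (by simp)
      (by simp) (by simp) (fun i hi => by simp [hi.ne]) (fun i hi => by simp [hi.ne])
      (fun i hi => by simp) (by simp) (by simp) (by simpa using hG₁.rep.hi_zero)
      (fun i hi => by
        by_cases hMw : M < w
        · simpa using (hG₁.rest hMw).2.2.1 i hi
        · have := hsmall hMw; omega)
      (fun i hi x hx hl => by
        by_cases hMw : M < w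
        · simpa using (hG₁.rest hMw).2.1 i hi x hx hl
        · have := hsmall hMw; omega)
    refine runs_call_one rfl ((outputBody_spec (M := M) (w := w) (j := j) (F := F) (D := D) (B := B)
      (Bl := Function.update Bl₁ j []) _ ?_ ?_ ?_ ?_ ?_).mono ?_)
    · simpa using h10
    · simpa using h11
    · simpa using hG₁.size
    · refine (hR₂.congr ?_ ?_ ?_).perm ?_
      · simp
      · simp
      · intro a ha ha'
        interval_cases a <;> simp [h11]
      · simp
    · intro hMw
      simpa using (hG₁.rest hMw).1
    rintro s₂ t₂ ⟨Bl₂, hout, hR₃, g1, hBl, hlast, ht₂⟩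
    change s₂.output = ((seg (s₁.mem.nat 7) 0 w).filter fun x =>
        decide ¬ (M < w ∧ s₁.vreg 0 ≤ s₁.mem.val 1 x)).map (s₁.mem.nat 3) at hout
    change (Bl₂ j).length = (Function.update Bl₁ j [] j).length + (seg (s₁.mem.nat 7) 0 w).countP
      (fun x => decide (M < w ∧ s₁.vreg 0 ≤ s₁.mem.val 1 x)) at hlast
    simp only [Function.update_self, List.length_nil, Nat.zero_add] at hlast
    simp at g1
    simp only [runs_block_nil]
    have houtput : ∀ x, State.output ⟨Function.update s₁.nreg 0 (s₂.nreg 0), s₁.vreg,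
        s₂.mem.setNat 1 1 x⟩ = s₂.output := fun x => by
      simp [State.output]
    simp only [NExp.eval, houtput]
    rw [← hout] at hcorrect
    have hlen' : s₂.output.length = min M w := by rw [hout, List.length_map, hlen]
    have hsum := (seg (s₁.mem.nat 7) 0 w).length_eq_countP_add_countP
      (fun x => decide (M < w ∧ s₁.vreg 0 ≤ s₁.mem.val 1 x))
    rw [length_seg, ← hlast] at hsum
    simp only [decide_eq_true_eq] at hsum
    rw [← List.countP_eq_length_filter] at hlen
    rw [hlen] at hsum
    have h3 := hG₁.le
    refine ⟨pot M (j + 1) Bl₂, ⟨j + 1, Bl₂, Nat.succ_pos _, hR₃.congr ?_ ?_ ?_, ?_, ?_, ?_, ?_, rfl⟩,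
      hcorrect, ?_⟩
    · simp
    · simp
    · intro a ha ha'
      simp [show a ≠ 1 by omega]
    · simpa [g1] using hG₁.size
    · simp [h11]
    · simpa [g1] using hG₁.count
    · intro i hi
      rw [hBl i (by omega), Function.update_of_ne (by omega)]
      by_cases hMw : M < w
      · exact (hG₁.rest hMw).2.2.2 i (by omega)
      · have := hsmall hMw
        omega
    · have h4 : pot M j Bl₂ = pot M j Bl₁ := pot_congr fun i hi => by
        rw [hBl i hi, Function.update_of_ne hi.ne]
      have h5 := levelSum_le (s := (Bl₂ j).length) hM (by omega)
      rw [pot_succ, h4, hlen', blockPot]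
      simp at ht ht₂ ⊢
      clear * - ht ht₁ ht₂ h3 h5 hsum
      omega

end

/-! ### Sequences of operations -/

theorem Content.DistinctValues.remove {α : Type u} {D : Content α} (h : D.DistinctValues) (S : Finset ℕ) :
    (D.remove S).DistinctValues := by
  intro k hk l hl hkl
  simp only [Content.keys, Content.remove, Set.mem_ofPred_eq] at hk hl hkl
  split_ifs at hk hl hkl with h1 h2
  all_goals first | exact absurd rfl hk | exact absurd rfl hl | exact h k hk l hl hkl

section
variable {α : Type u} [LinearOrder α]

theorem Op.Legal.distinctValues_next {B : α} {D : Content α} (hD : D.DistinctValues) {op : Op α}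
    (h : op.Legal B D) (s : State α) : (op.next D s).DistinctValues := by
  cases op with
  | insert a b => exact h.2
  | batchPrepend L => exact h.2
  | pull => exact hD.remove _

/-- The invariant of a sequence of operations. The number `T` counts the pairs in batches, and `Q`
is the budget of the batches and pulls. -/
theorem History.exists_inv {N M : ℕ} {B : α} (hM : 0 < M) {n : ℕ} {D : Content α} {m : Memory α}
    {t : ℕ} {β : ℝ} (h : History impl N M B n D m t β) :
    D.DistinctValues ∧ n ≤ N ∧ ∃ (F p T : ℕ) (Q : ℝ), Inv M B m D F p ∧ F ≤ n + T ∧ (T : ℝ) ≤ Q ∧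
      β = 1 + n * max 1 (Real.logb 2 ((N : ℝ) / M)) + Q ∧
      (t : ℝ) + p ≤ 200000 * (n * (1 + level M (n + T)) + Q + 1) := by
  induction h with
  | @init s t h =>
    obtain ⟨s', t', h', p, hinv, ht⟩ := initCode_spec M B
    obtain ⟨rfl, rfl⟩ := h.det h'
    refine ⟨fun k hk => absurd rfl hk, Nat.zero_le _, 0, p, 0, 0, hinv, le_rfl, by simp, by simp, ?_⟩
    have : (t : ℝ) + p ≤ 2000 := by exact_mod_cast ht
    simp
    linarith
  | @step n D m t β op s τ h hop hn hex ih =>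
    obtain ⟨hD, -, F, p, T, Q, hinv, hF, hT, hβ, ht⟩ := ih
    refine ⟨hop.distinctValues_next hD s, hn, ?_⟩
    cases op with
    | insert a b =>
      obtain ⟨s', t', h', F', p', hinv', hF', ht'⟩ := insertCode_spec hM hinv a hop.1
      obtain ⟨rfl, rfl⟩ := hex.det h'
      refine ⟨F', p', T, Q, hinv', ?_, hT, ?_, ?_⟩
      · simp only [Op.inserts]; omega
      · simp only [hβ, Op.budget, Op.inserts]; push_cast; ring
      · have h1 : level M (F + 1) ≤ level M (n + 1 + T) := level_mono hM (by omega)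
        have h2 : level M (n + T) ≤ level M (n + 1 + T) := level_mono hM (by omega)
        have h3 : (τ : ℝ) + p' ≤ p + 50000 * (1 + level M (F + 1)) := by exact_mod_cast ht'
        have h1' : (level M (F + 1) : ℝ) ≤ level M (n + 1 + T) := by exact_mod_cast h1
        have h2' : (n : ℝ) * level M (n + T) ≤ n * level M (n + 1 + T) := by
          exact_mod_cast Nat.mul_le_mul_left n h2
        have h4 : (0 : ℝ) ≤ level M (n + 1 + T) := Nat.cast_nonneg _
        simp only [Op.inserts]
        push_cast
        nlinarith
    | batchPrepend L =>
      obtain ⟨s', t', h', F', p', hinv', hF', ht'⟩ := batchCode_spec hM hinv L hop.1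
      obtain ⟨rfl, rfl⟩ := hex.det h'
      set q := (Op.batchPrepend L).budget N M s with hq
      have hq' : q = max 1 (L.length : ℝ) * max 1 (Real.logb 2 ((L.length : ℝ) / M)) := rfl
      have h1 : (L.length : ℝ) ≤ max 1 (L.length : ℝ) := le_max_right ..
      have h0 : (1 : ℝ) ≤ max 1 (L.length : ℝ) := le_max_left ..
      have h2 := level_le_logb hM L.length
      have h3 : (1 : ℝ) ≤ max 1 (Real.logb 2 ((L.length : ℝ) / M)) := le_max_left ..
      have h4 : (τ : ℝ) + p' ≤ p + 50000 * (max 1 (L.length : ℝ) * (1 + level M L.length)) := by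
        exact_mod_cast ht'
      have h5 : max 1 (L.length : ℝ) * (1 + level M L.length) ≤ 3 * q := by
        rw [hq']
        calc max 1 (L.length : ℝ) * (1 + level M L.length)
            ≤ max 1 (L.length : ℝ) * (3 * max 1 (Real.logb 2 ((L.length : ℝ) / M))) :=
              mul_le_mul_of_nonneg_left (by linarith) (by linarith)
          _ = _ := by ring
      have h6 : max 1 (L.length : ℝ) ≤ q := le_mul_of_one_le_right (by linarith) h3
      have h7 : level M (n + T) ≤ level M (n + (T + L.length)) := level_mono hM (by omega)
      have h8 : (n : ℝ) * level M (n + T) ≤ n * level M (n + (T + L.length)) := by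
        exact_mod_cast Nat.mul_le_mul_left n h7
      refine ⟨F', p', T + L.length, Q + q, hinv', ?_, ?_, ?_, ?_⟩
      · simp only [Op.inserts]; omega
      · push_cast; linarith
      · simp only [hβ, Op.inserts]; push_cast; ring
      · simp only [Op.inserts, Nat.add_zero]
        push_cast
        linarith
    | pull =>
      obtain ⟨s', t', h', p', hinv', hcorrect, ht'⟩ := pullCode_spec hM hinv hD
      obtain ⟨rfl, rfl⟩ := hex.det h'
      have h1 : (Op.pull : Op α).budget N M s = max 1 (s.output.length : ℝ) := by
        rw [Op.budget, List.toFinset_card_of_nodup hcorrect.nodup]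
      have h2 : (τ : ℝ) + p' ≤ p + 200000 * max 1 (s.output.length : ℝ) := by exact_mod_cast ht'
      have h3 : (1 : ℝ) ≤ max 1 (s.output.length : ℝ) := le_max_left ..
      refine ⟨F, p', T, Q + max 1 (s.output.length : ℝ), hinv', hF, by linarith, ?_, ?_⟩
      · rw [h1, hβ]; simp only [Op.inserts]; push_cast; ring
      · simp only [Op.inserts, Nat.add_zero]
        push_cast
        linarith

/-- Since `T ≤ Q`, `mul_level_add_le` replaces `level M (n + T)` by `level M N`. -/
theorem History.time_le {N M : ℕ} {B : α} (hM : 0 < M) {n : ℕ} {D : Content α} {m : Memory α}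
    {t : ℕ} {β : ℝ} (h : History impl N M B n D m t β) : (t : ℝ) ≤ 800000 * β := by
  obtain ⟨-, hn, F, p, T, Q, -, -, hT, rfl, ht⟩ := h.exists_inv hM
  set X := max 1 (Real.logb 2 ((N : ℝ) / M))
  have h1 : (n : ℝ) * level M (n + T) ≤ n * (level M N + 1) + 2 * T := by
    exact_mod_cast mul_level_add_le hM hn T
  have h2 : (level M N : ℝ) + 2 ≤ 4 * X := by
    linarith [level_le_logb hM N, le_max_left 1 (Real.logb 2 ((N : ℝ) / M))]
  have h3 : (n : ℝ) * (level M N + 2) ≤ n * (4 * X) := mul_le_mul_of_nonneg_left h2 n.cast_nonneg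
  have h4 : (0 : ℝ) ≤ p := p.cast_nonneg
  have h5 : (0 : ℝ) ≤ T := T.cast_nonneg
  nlinarith

theorem History.exists_exec {N M : ℕ} {B : α} (hM : 0 < M) {n : ℕ} {D : Content α} {m : Memory α}
    {t : ℕ} {β : ℝ} (h : History impl N M B n D m t β) {op : Op α} (hop : op.Legal B D) :
    ∃ (s : State α) (τ : ℕ), Exec impl.procs (op.code impl) (op.start B m) s τ ∧
      (op = .pull → PullCorrect M B D s.output (s.vreg 0)) := by
  obtain ⟨hD, -, F, p, T, Q, hinv, -⟩ := h.exists_inv hM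
  cases op with
  | insert a b =>
    obtain ⟨s, τ, hs, -⟩ := insertCode_spec hM hinv a hop.1
    exact ⟨s, τ, hs, nofun⟩
  | batchPrepend L =>
    obtain ⟨s, τ, hs, -⟩ := batchCode_spec hM hinv L hop.1
    exact ⟨s, τ, hs, nofun⟩
  | pull =>
    obtain ⟨s, τ, hs, p', -, hcorrect, -⟩ := pullCode_spec hM hinv hD
    exact ⟨s, τ, hs, fun _ => hcorrect⟩

end
end PartialHeap

theorem lemma3p3 :
    ∃ (P : PartialHeap.Implementation) (C : ℝ),
      ∀ (α : Type u) [LinearOrder α] (N M : ℕ) (B : α), 1 ≤ M →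
        (∃ (s : PartialHeap.State α) (t : ℕ), PartialHeap.Exec P.procs P.init
          (PartialHeap.State.entry B M B (PartialHeap.Memory.blank B)) s t) ∧
        ∀ (n : ℕ) (D : PartialHeap.Content α) (m : PartialHeap.Memory α) (t : ℕ) (β : ℝ),
          PartialHeap.History P N M B n D m t β →
            (t : ℝ) ≤ C * β ∧
            ∀ op : PartialHeap.Op α, op.Legal B D → n + op.inserts ≤ N →
              ∃ (s : PartialHeap.State α) (τ : ℕ), PartialHeap.Exec P.procs (op.code P)
                (op.start B m) s τ ∧
                (op = .pull → PartialHeap.PullCorrect M B D s.output (s.vreg 0)) := by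
  refine ⟨PartialHeap.impl, 800000, fun α _ N M B hM => ⟨?_, fun n D m t β h =>
    ⟨h.time_le hM, fun op hop _ => h.exists_exec hM hop⟩⟩⟩
  obtain ⟨s, t, h, -⟩ := PartialHeap.initCode_spec M B
  exact ⟨s, t, h⟩
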